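/- Let $\Gamma:[0,1]\to\mathbb{R}^2$ be an embedded regular planar arc of class $C^3$ (up to its endpoints) whose curvature vanishes nowhere. Suppose that, after an affine lattice change of coordinates $p\mapsto Ap+\tau$ with $A\in\mathrm{SL}(2,\mathbb{Z})$ and $\tau\in\mathbb{R}^2$, the image of $\Gamma$ becomes the graph $S$ of a convex function $g:[0,r]\to[0,u]$ with $r,u>0$, $g(0)=u$ and $g(r)=0$ (so that, together with two segments of the coordinate axes, it bounds a region of the first quadrant). For integers $a,b\ge 0$, not both zero, let $\gamma_{a,b}=\min_{(x,y)\in S}(ax+by)$, so that $ax+by=\gamma_{a,b}$ is the supporting line to $S$ with normal $(a,b)$, and define the boundary zeta series of $\Gamma$ by $$F_\Gamma(s)=\sum_{\substack{a,b,c,d\in\mathbb{Z}_{\ge 0}\\ ad-bc=1}}\bigl|\gamma_{a,b}+\gamma_{c,d}-\gamma_{a+c,b+d}\bigr|^{s},$$ where $0^s=0$. Then the series converges absolutely for $\operatorname{Re}(s)>\tfrac23$, and $F_\Gamma$ admits a meromorphic continuation to a neighborhood of $s=\tfrac23$ whose only singularity there is a simple pole at $s=\tfrac23$, with residue $$\operatorname{Res}_{s=2/3}F_\Gamma(s)=\frac{\sqrt3}{4^{1/3}\pi^3}\,\Gamma\!\left(\tfrac13\right)^3\,\operatorname{Length}_{\mathrm{equiaffine}}(\Gamma),$$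 where $\Gamma(\tfrac13)$ is the value of the gamma function and $\operatorname{Length}_{\mathrm{equiaffine}}(\Gamma)=\int_0^1|\det(\dot\Gamma(t),\ddot\Gamma(t))|^{1/3}\,dt$. -/

import Mathlib

open Set Filter Topology

/-- The Euclidean plane. -/
abbrev Plane : Type := EuclideanSpace ℝ (Fin 2)

/-- The determinant of the pair of plane vectors `p, q`. -/
def planeDet (p q : Plane) : ℝ := p 0 * q 1 - p 1 * q 0

/-- The velocity of a curve parametrized by `[0, 1]` (one-sided at the endpoints). -/
noncomputable def velocity (Γ : ℝ → Plane) (t : ℝ) : Plane :=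
  derivWithin Γ (Icc 0 1) t

/-- The acceleration of a curve parametrized by `[0, 1]` (one-sided at the endpoints). -/
noncomputable def acceleration (Γ : ℝ → Plane) (t : ℝ) : Plane :=
  iteratedDerivWithin 2 Γ (Icc 0 1) t

/-- The Euclidean curvature of a regular plane curve parametrized by `[0, 1]`. -/
noncomputable def curvature (Γ : ℝ → Plane) (t : ℝ) : ℝ :=
  |planeDet (velocity Γ t) (acceleration Γ t)| / ‖velocity Γ t‖ ^ 3

/-- The equiaffine length of a plane curve parametrized by `[0, 1]`. -/
noncomputable def equiaffineLength (Γ : ℝ → Plane) : ℝ :=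
  ∫ t in (0 : ℝ)..1, |planeDet (velocity Γ t) (acceleration Γ t)| ^ (1 / 3 : ℝ)

/-- `Γ : [0, 1] → ℝ²` parametrizes an embedded arc of class `C³`, up to the endpoints, whose
curvature vanishes nowhere. -/
structure IsCurvedArc (Γ : ℝ → Plane) : Prop where
  contDiffOn : ContDiffOn ℝ 3 Γ (Icc 0 1)
  injOn : InjOn Γ (Icc 0 1)
  regular : ∀ t ∈ Icc (0 : ℝ) 1, velocity Γ t ≠ 0
  curved : ∀ t ∈ Icc (0 : ℝ) 1, curvature Γ t ≠ 0

/-- The affine lattice change of coordinates `p ↦ A p + τ`, with `A ∈ SL(2, ℤ)` and `τ ∈ ℝ²`. -/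
noncomputable def latticeChart (A : Matrix.SpecialLinearGroup (Fin 2) ℤ) (τ p : Plane) : Plane :=
  !₂[(A.1 0 0 : ℝ) * p 0 + (A.1 0 1 : ℝ) * p 1 + τ 0,
     (A.1 1 0 : ℝ) * p 0 + (A.1 1 1 : ℝ) * p 1 + τ 1]

/-- `S` is the graph of a convex function `g : [0, r] → [0, u]` with `g 0 = u` and `g r = 0`:
together with segments of the two coordinate axes it bounds a region of the first quadrant, and
it is bent towards the corner of that quadrant. -/
def IsConvexCornerGraph (S : Set Plane) : Prop :=
  ∃ (r u : ℝ) (g : ℝ → ℝ), 0 < r ∧ 0 < u ∧ ConvexOn ℝ (Icc 0 r) g ∧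
    MapsTo g (Icc 0 r) (Icc 0 u) ∧ g 0 = u ∧ g r = 0 ∧
    S = (fun x : ℝ => (!₂[x, g x] : Plane)) '' Icc 0 r

/-- The number `γ_{a,b} = min {a x + b y : (x, y) ∈ S}`: the line `a x + b y = γ_{a,b}` is the
supporting line of `S` with normal `(a, b)`, and `S` lies on the side `a x + b y ≥ γ_{a,b}`. -/
noncomputable def supportNumber (S : Set Plane) (a b : ℕ) : ℝ :=
  sInf ((fun p : Plane => (a : ℝ) * p 0 + (b : ℝ) * p 1) '' S)

/-- The quadruples of nonnegative integers `(a, b, c, d)` with `a d - b c = 1`. -/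
abbrev UnimodularQuad : Type :=
  {q : ℕ × ℕ × ℕ × ℕ // (q.1 : ℤ) * q.2.2.2 - q.2.1 * q.2.2.1 = 1}

/-- The support defect `|γ_{a,b} + γ_{c,d} - γ_{a+c,b+d}|`. -/
noncomputable def supportDefect (S : Set Plane) : UnimodularQuad → ℝ
  | ⟨(a, b, c, d), _⟩ =>
    |supportNumber S a b + supportNumber S c d - supportNumber S (a + c) (b + d)|

/-- The boundary zeta series of an arc that is placed in the first quadrant: the sum of the
`s`-th powers of the support defects over all unimodular quadruples. -/
noncomputable def boundaryZeta (S : Set Plane) (s : ℂ) : ℂ :=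
  ∑' q : UnimodularQuad, (supportDefect S q : ℂ) ^ s

/-! For a unimodular pair put `B = a + b`, `D = c + d`, `x = a / B`, `y = c / D`, so that `x - y = 1
/ (B D)`. By homogeneity the support numbers are `B η(x)`, `D η(y)` and `(B + D) η(z)`, where `η(x)`
is the minimum of `x X + (1 - x) Y` over the arc and `z` is the weighted mean of `x` and `y`. The
defect is thus the Jensen gap of the concave function `η`. Where the line of weight `x` is tangent
to the arc, `-η''` is the density `(X' - Y')³ / det`, and elsewhere it is zero. Writing it as `h ^
(3/2)`, the gap is close to `h(x) ^ (3/2) / (2 B D (B + D))`. The substitution `x = -Y' / (X' - Y')`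
turns `∫ h` into the integral of `det ^ (1/3)`, the equiaffine length (`weighted_defect_mem`,
`integral_contactDensity`).

Hence a defect is at least `t` roughly when `B D (B + D) ≤ h(x) ^ (3/2) / (2 t)`. Since `a D = B c +
1`, for fixed `B < D` one counts points `(a, D)` of a box with `a D ≡ 1` modulo `B`. Kloosterman's
fourth moment argument gives equidistribution with error about `B ^ (4/5)`
(`exists_abs_inverseCount_sub_le`). Summing the main term over `B` with the mean value of Euler's
function produces `τ ^ (2/3)` times `3 / π²` times the integral of `(x (x + 1)) ^ (-2/3)` over `x >
1`, half of the Beta value at `(1/3, 1/3)`. Cutting `[0, 1]` into slowly more and more intervals, on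
most of which `h` is nearly constant, gives the count `C t ^ (-2/3) + O(t ^ (-2/3 + 1/30))`
(`exists_abs_ncard_ascending_sub_le`). The pairs with `B > D` follow by symmetry.

The series is `s` times the Mellin transform of this counting function. The main term contributes `C
s / (s - 2/3)`, and the remainder has a transform holomorphic for `Re s > 2/3 - 1/30`
(`exists_continuation_of_upperCount`). The residue is therefore `2 C / 3`. -/

/-! ### Kloosterman sums and their fourth moment -/

/-- Each of the totients `φ(g)`, `g ∣ B`, is at most `φ(B)`, and they add up to `B`. Dividing by
`φ(B)` instead of `B` therefore costs only a divisor factor. -/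
theorem le_totient_mul_card_divisors (B : ℕ) : B ≤ Nat.totient B * B.divisors.card := by
  rcases Nat.eq_zero_or_pos B with rfl | hB
  · simp
  calc B = ∑ g ∈ B.divisors, Nat.totient g := (Nat.sum_totient B).symm
    _ ≤ ∑ g ∈ B.divisors, Nat.totient B := by
        refine Finset.sum_le_sum fun g hg => ?_
        exact Nat.le_of_dvd (Nat.totient_pos.mpr hB)
          (Nat.totient_dvd_of_dvd (Nat.dvd_of_mem_divisors hg))
    _ = _ := by rw [Finset.sum_const, smul_eq_mul, mul_comm]

section Kloosterman

variable {B : ℕ} [NeZero B]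

theorem ZMod.conj_stdAddChar (x : ZMod B) :
    (starRingEnd ℂ) (ZMod.stdAddChar x) = ZMod.stdAddChar (-x) := by
  rw [AddChar.map_neg_eq_conj]

theorem ZMod.sum_stdAddChar_mul (a : ZMod B) :
    ∑ m : ZMod B, (ZMod.stdAddChar (m * a) : ℂ) = if a = 0 then (B : ℂ) else 0 := by
  have := AddChar.sum_mulShift a (ZMod.isPrimitive_stdAddChar B)
  simpa [ZMod.card] using this

/-- Parseval's identity for a two-dimensional exponential sum over a finite family of points. -/
theorem sum_normSq_exponentialSum {ι : Type*} [Fintype ι] [DecidableEq ι] (α β : ι → ZMod B) :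
    ∑ m : ZMod B, ∑ n : ZMod B,
        ‖∑ i, (ZMod.stdAddChar (m * α i + n * β i) : ℂ)‖ ^ 2 =
      (B : ℝ) ^ 2 *
        ((Finset.univ.filter fun p : ι × ι => α p.1 = α p.2 ∧ β p.1 = β p.2).card : ℝ) := by
  have key : ∑ m : ZMod B, ∑ n : ZMod B,
      ((‖∑ i, (ZMod.stdAddChar (m * α i + n * β i) : ℂ)‖ ^ 2 : ℝ) : ℂ) =
      (B : ℂ) ^ 2 *
        ((Finset.univ.filter fun p : ι × ι => α p.1 = α p.2 ∧ β p.1 = β p.2).card : ℂ) := by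
    have h1 : ∀ m n : ZMod B,
        ((‖∑ i, (ZMod.stdAddChar (m * α i + n * β i) : ℂ)‖ ^ 2 : ℝ) : ℂ) =
        ∑ p : ι × ι, (ZMod.stdAddChar (m * (α p.1 - α p.2)) : ℂ) *
          ZMod.stdAddChar (n * (β p.1 - β p.2)) := by
      intro m n
      rw [Complex.ofReal_pow, ← Complex.mul_conj', map_sum, Finset.sum_mul_sum,
        ← Finset.sum_product']
      refine Finset.sum_congr rfl fun p _ => ?_
      rw [ZMod.conj_stdAddChar, ← AddChar.map_add_eq_mul, ← AddChar.map_add_eq_mul]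
      congr 1
      ring
    simp_rw [h1]
    have h2 : ∀ m : ZMod B, ∑ n : ZMod B, ∑ p : ι × ι,
        (ZMod.stdAddChar (m * (α p.1 - α p.2)) : ℂ) * ZMod.stdAddChar (n * (β p.1 - β p.2)) =
        ∑ p : ι × ι, ∑ n : ZMod B, (ZMod.stdAddChar (m * (α p.1 - α p.2)) : ℂ) *
          ZMod.stdAddChar (n * (β p.1 - β p.2)) := fun m => Finset.sum_comm
    simp_rw [h2]
    rw [Finset.sum_comm]
    simp_rw [← Finset.mul_sum, ZMod.sum_stdAddChar_mul, ← Finset.sum_mul,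
      ZMod.sum_stdAddChar_mul]
    rw [Finset.card_filter]
    push_cast
    rw [Finset.mul_sum]
    refine Finset.sum_congr rfl fun p _ => ?_
    simp only [sub_eq_zero]
    split_ifs <;> simp_all [pow_two]
  exact_mod_cast key

/-- The Kloosterman sum of frequencies `m`, `n` to the modulus `B`. -/
noncomputable def kloosterman (m n : ZMod B) : ℂ :=
  ∑ u : (ZMod B)ˣ, ZMod.stdAddChar (m * (u : ZMod B) + n * ((u⁻¹ : (ZMod B)ˣ) : ZMod B))

theorem kloosterman_comm (m n : ZMod B) : kloosterman m n = kloosterman n m := by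
  unfold kloosterman
  rw [← Equiv.sum_comp (Equiv.inv (ZMod B)ˣ)]
  refine Finset.sum_congr rfl fun u _ => ?_
  simp [add_comm]

/-- A unit can be absorbed by translating the summation variable. Every value thus recurs along an
orbit of frequencies, which is what turns a bound on average into a bound for each sum. -/
theorem kloosterman_mul_unit (m n : ZMod B) (u : (ZMod B)ˣ) :
    kloosterman (m * (u : ZMod B)) (n * ((u⁻¹ : (ZMod B)ˣ) : ZMod B)) = kloosterman m n := by
  unfold kloosterman
  rw [← Equiv.sum_comp (Equiv.mulLeft u) (fun v : (ZMod B)ˣ =>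
    (ZMod.stdAddChar (m * (v : ZMod B) + n * ((v⁻¹ : (ZMod B)ˣ) : ZMod B)) : ℂ))]
  refine Finset.sum_congr rfl fun v _ => ?_
  congr 1
  simp only [Equiv.coe_mulLeft, mul_inv, Units.val_mul]
  ring

theorem kloosterman_zero_zero : kloosterman (0 : ZMod B) 0 = (Nat.totient B : ℂ) := by
  simp [kloosterman, ZMod.card_units_eq_totient]

/-- The number of zeros of multiplication by `k` on `ZMod B`. -/
def annCard (k : ZMod B) : ℕ := (Finset.univ.filter fun x : ZMod B => k * x = 0).card

theorem card_mul_eq_le_annCard (k l : ZMod B) :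
    (Finset.univ.filter fun x : ZMod B => k * x = l).card ≤ annCard k := by
  rcases (Finset.univ.filter fun x : ZMod B => k * x = l).eq_empty_or_nonempty with h | ⟨y, hy⟩
  · simp [h]
  · refine Finset.card_le_card_of_injOn (fun x => x - y) ?_ (fun x _ z _ h => by simpa using h)
    intro x hx
    simp only [Finset.coe_filter, Finset.mem_filter, Finset.mem_univ, true_and,
      Set.mem_ofPred_eq] at hx hy ⊢
    rw [mul_sub, hx, hy, sub_self]

theorem annCard_mul_le (k l : ZMod B) : annCard (k * l) ≤ annCard k * annCard l := by
  rw [mul_comm (annCard k)]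
  unfold annCard
  refine Finset.card_le_mul_card_image_of_maps_to (f := fun x => l * x) ?_ _ ?_
  · intro x hx
    simp only [Finset.mem_filter, Finset.mem_univ, true_and] at hx ⊢
    rw [← hx]; ring
  · intro y _
    refine le_trans (Finset.card_le_card ?_) (card_mul_eq_le_annCard l y)
    intro x hx
    simp only [Finset.mem_filter, Finset.mem_univ, true_and] at hx ⊢
    exact hx.2

/-- With `g = gcd k B`, any zero of multiplication by `k` is a multiple of `B / g`, and its quotient
by `B / g` lies below `g`. -/
theorem annCard_natCast_le (k : ℕ) : annCard (k : ZMod B) ≤ Nat.gcd k B := by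
  have hB : 0 < B := NeZero.pos B
  set g := Nat.gcd k B with hg
  have hgpos : 0 < g := Nat.gcd_pos_of_pos_right _ hB
  have hgB : g ∣ B := Nat.gcd_dvd_right _ _
  have hq : 0 < B / g := Nat.div_pos (Nat.le_of_dvd hB hgB) hgpos
  have hdvd : ∀ x : ZMod B, (k : ZMod B) * x = 0 → B / g ∣ x.val := by
    intro x hx
    have h1 : B ∣ k * x.val := by
      rw [← ZMod.natCast_eq_zero_iff]
      push_cast
      rw [ZMod.natCast_zmod_val, hx]
    have h2 : B / g ∣ (k / g) * x.val := by
      have : g * (B / g) ∣ g * ((k / g) * x.val) := by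
        rw [Nat.mul_div_cancel' hgB, ← mul_assoc, Nat.mul_div_cancel' (Nat.gcd_dvd_left _ _)]
        exact h1
      exact Nat.dvd_of_mul_dvd_mul_left hgpos this
    exact (Nat.coprime_div_gcd_div_gcd hgpos).symm.dvd_of_dvd_mul_left h2
  calc annCard (k : ZMod B) ≤ (Finset.range g).card := by
        refine Finset.card_le_card_of_injOn (fun x => x.val / (B / g)) ?_ ?_
        · intro x hx
          simp only [Finset.coe_filter, Finset.mem_univ, true_and, Set.mem_ofPred_eq] at hx
          simp only [Finset.coe_range, mem_Iio]
          rw [Nat.div_lt_iff_lt_mul hq, Nat.mul_div_cancel' hgB]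
          exact ZMod.val_lt x
        · intro x hx y hy hxy
          simp only [Finset.coe_filter, Finset.mem_univ, true_and, Set.mem_ofPred_eq] at hx hy
          apply ZMod.val_injective B
          obtain ⟨i, hi⟩ := hdvd x hx
          obtain ⟨j, hj⟩ := hdvd y hy
          simp only [hi, hj, Nat.mul_div_cancel_left _ hq] at hxy
          rw [hi, hj, hxy]
    _ = g := Finset.card_range g

theorem annCard_le_gcd (k : ZMod B) : annCard k ≤ Nat.gcd k.val B := by
  conv_lhs => rw [← ZMod.natCast_zmod_val k]
  exact annCard_natCast_le k.val

theorem ZMod.sum_eq_sum_range {M : Type*} [AddCommMonoid M] (f : ZMod B → M) :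
    ∑ x : ZMod B, f x = ∑ k ∈ Finset.range B, f (k : ZMod B) := by
  refine Finset.sum_bij' (fun x _ => x.val) (fun k _ => (k : ZMod B)) ?_ ?_ ?_ ?_ ?_
  · intro x _; simpa using ZMod.val_lt x
  · intro k _; simp
  · intro x _; simp
  · intro k hk; simpa using ZMod.val_cast_of_lt (Finset.mem_range.mp hk)
  · intro x _; simp

theorem sum_gcd_le (B : ℕ) : ∑ k ∈ Finset.range B, Nat.gcd k B ≤ B * B.divisors.card := by
  rcases Nat.eq_zero_or_pos B with rfl | hB
  · simp
  calc ∑ k ∈ Finset.range B, Nat.gcd k B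
      ≤ ∑ k ∈ Finset.range B, ∑ g ∈ B.divisors, (if g ∣ k then g else 0) := by
        refine Finset.sum_le_sum fun k _ => ?_
        have h : Nat.gcd k B ∈ B.divisors := by simp [Nat.gcd_dvd_right, hB.ne']
        refine le_trans ?_ (Finset.single_le_sum (f := fun g => if g ∣ k then g else 0)
          (fun _ _ => Nat.zero_le _) h)
        simp [Nat.gcd_dvd_left]
    _ = ∑ g ∈ B.divisors, ∑ k ∈ Finset.range B, (if g ∣ k then g else 0) := Finset.sum_comm
    _ ≤ ∑ g ∈ B.divisors, B := by
        refine Finset.sum_le_sum fun g hg => ?_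
        have hgB := Nat.dvd_of_mem_divisors hg
        have hgpos := Nat.pos_of_mem_divisors hg
        rw [← Finset.sum_filter, Finset.sum_const, smul_eq_mul]
        have : ((Finset.range B).filter fun k => g ∣ k).card ≤ (Finset.range (B / g)).card := by
          refine Finset.card_le_card_of_injOn (fun k => k / g) ?_ ?_
          · intro k hk
            simp only [Finset.coe_filter, Finset.mem_range, Set.mem_ofPred_eq] at hk
            simp only [Finset.coe_range, mem_Iio]
            rw [Nat.div_lt_iff_lt_mul hgpos, Nat.div_mul_cancel hgB]
            exact hk.1
          · intro k hk l hl hkl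
            simp only [Finset.coe_filter, Finset.mem_range, Set.mem_ofPred_eq] at hk hl hkl
            rw [← Nat.div_mul_cancel hk.2, ← Nat.div_mul_cancel hl.2, hkl]
        calc _ ≤ (B / g) * g := Nat.mul_le_mul_right _ (by simpa using this)
          _ = B := Nat.div_mul_cancel hgB
    _ = B * B.divisors.card := by rw [Finset.sum_const, smul_eq_mul, mul_comm]

theorem sum_annCard_le : ∑ k : ZMod B, annCard k ≤ B * B.divisors.card := by
  rw [ZMod.sum_eq_sum_range]
  exact (Finset.sum_le_sum fun k _ => annCard_natCast_le k).trans (sum_gcd_le B)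

/-- The number of solutions of `u₁ + u₂ = u₃ + u₄`, `u₁⁻¹ + u₂⁻¹ = u₃⁻¹ + u₄⁻¹` in units. -/
theorem card_kloosterman_solutions_le :
    (Finset.univ.filter fun p : ((ZMod B)ˣ × (ZMod B)ˣ) × ((ZMod B)ˣ × (ZMod B)ˣ) =>
      (p.1.1 : ZMod B) + p.1.2 = p.2.1 + p.2.2 ∧
      ((p.1.1⁻¹ : (ZMod B)ˣ) : ZMod B) + (p.1.2⁻¹ : (ZMod B)ˣ) =
        (p.2.1⁻¹ : (ZMod B)ˣ) + (p.2.2⁻¹ : (ZMod B)ˣ)).card ≤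
      2 * (B * B.divisors.card) ^ 2 := by
  classical
  calc _ ≤ (Finset.univ.filter fun z : ZMod B × ZMod B × ZMod B =>
            (2 * z.1 - z.2.1 - z.2.2) * (z.2.1 * z.2.2) = 0).card := by
        -- Clearing denominators and eliminating `x2 = x3 + x4 - x1` leaves `(x3 + x4) (x1 - x3) (x1
        -- - x4) = 0`. In terms of `x1` and the two differences, the first factor is twice `x1`
        -- minus both differences.
        refine Finset.card_le_card_of_injOn (fun p => ((p.1.1 : ZMod B),
          (p.1.1 : ZMod B) - p.2.1, (p.1.1 : ZMod B) - p.2.2)) ?_ ?_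
        · rintro ⟨⟨u1, u2⟩, ⟨u3, u4⟩⟩ h
          simp only [Finset.coe_filter, Finset.mem_univ, true_and, Set.mem_ofPred_eq] at h ⊢
          obtain ⟨h1, h2⟩ := h
          have e1 : (u1 : ZMod B) * (u1⁻¹ : (ZMod B)ˣ) = 1 := u1.mul_inv
          have e2 : (u2 : ZMod B) * (u2⁻¹ : (ZMod B)ˣ) = 1 := u2.mul_inv
          have e3 : (u3 : ZMod B) * (u3⁻¹ : (ZMod B)ˣ) = 1 := u3.mul_inv
          have e4 : (u4 : ZMod B) * (u4⁻¹ : (ZMod B)ˣ) = 1 := u4.mul_inv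
          generalize ((u1⁻¹ : (ZMod B)ˣ) : ZMod B) = v1 at *
          generalize ((u2⁻¹ : (ZMod B)ˣ) : ZMod B) = v2 at *
          generalize ((u3⁻¹ : (ZMod B)ˣ) : ZMod B) = v3 at *
          generalize ((u4⁻¹ : (ZMod B)ˣ) : ZMod B) = v4 at *
          generalize (u1 : ZMod B) = x1 at *
          generalize (u2 : ZMod B) = x2 at *
          generalize (u3 : ZMod B) = x3 at *
          generalize (u4 : ZMod B) = x4 at *
          have k1 : (x1 + x2) * (x3 * x4) = (x3 + x4) * (x1 * x2) := by
            have a1 : x1 * x2 * (v1 + v2) = x1 + x2 := by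
              linear_combination x2 * e1 + x1 * e2
            have a2 : x3 * x4 * (v3 + v4) = x3 + x4 := by
              linear_combination x4 * e3 + x3 * e4
            rw [← a1, ← a2, h2]; ring
          have k2 : x2 = x3 + x4 - x1 := by linear_combination h1
          rw [k2] at k1
          linear_combination k1
        · rintro ⟨⟨u1, u2⟩, ⟨u3, u4⟩⟩ h ⟨⟨w1, w2⟩, ⟨w3, w4⟩⟩ h' e
          simp only [Finset.coe_filter, Finset.mem_univ, true_and, Set.mem_ofPred_eq, Prod.mk.injEq]
            at h h' e ⊢
          obtain ⟨e1, e3, e4⟩ := e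
          rw [e1] at e3 e4
          have e3' : (u3 : ZMod B) = w3 := by linear_combination -e3
          have e4' : (u4 : ZMod B) = w4 := by linear_combination -e4
          have e2' : (u2 : ZMod B) = w2 := by
            linear_combination h.1 - h'.1 - e1 + e3' + e4'
          exact ⟨⟨Units.ext e1, Units.ext e2'⟩, Units.ext e3', Units.ext e4'⟩
    _ = ∑ q : ZMod B × ZMod B, (Finset.univ.filter fun x : ZMod B =>
            (2 * x - q.1 - q.2) * (q.1 * q.2) = 0).card := by
        simp only [Finset.card_filter]
        rw [← Finset.univ_product_univ, Finset.sum_product_right]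
    _ ≤ ∑ q : ZMod B × ZMod B, 2 * (annCard q.1 * annCard q.2) := by
        refine Finset.sum_le_sum fun q _ => ?_
        -- For fixed differences the equation is linear in the remaining unknown, with leading
        -- coefficient `2 * (q.1 * q.2)`.
        calc _ ≤ (Finset.univ.filter fun x : ZMod B =>
              (2 * (q.1 * q.2)) * x = (q.1 + q.2) * (q.1 * q.2)).card := by
              refine Finset.card_le_card fun x hx => ?_
              simp only [Finset.mem_filter, Finset.mem_univ, true_and] at hx ⊢
              linear_combination hx
          _ ≤ annCard (2 * (q.1 * q.2)) := card_mul_eq_le_annCard _ _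
          _ ≤ annCard (2 : ZMod B) * annCard (q.1 * q.2) := annCard_mul_le _ _
          _ ≤ 2 * (annCard q.1 * annCard q.2) := by
              refine Nat.mul_le_mul ?_ (annCard_mul_le _ _)
              have := annCard_natCast_le (B := B) 2
              push_cast at this
              exact this.trans (Nat.gcd_le_left _ (by norm_num))
    _ = 2 * (∑ k : ZMod B, annCard k) ^ 2 := by
        rw [← Finset.mul_sum, ← Finset.univ_product_univ, Finset.sum_product, pow_two,
          Finset.sum_mul_sum]
    _ ≤ 2 * (B * B.divisors.card) ^ 2 := by
        gcongr
        exact sum_annCard_le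

theorem sum_norm_kloosterman_pow_four_le :
    ∑ m : ZMod B, ∑ n : ZMod B, ‖kloosterman m n‖ ^ 4 ≤
      2 * (B : ℝ) ^ 4 * (B.divisors.card : ℝ) ^ 2 := by
  classical
  have h1 : ∀ m n : ZMod B, ‖kloosterman m n‖ ^ 4 =
      ‖∑ i : (ZMod B)ˣ × (ZMod B)ˣ, (ZMod.stdAddChar (m * ((i.1 : ZMod B) + (i.2 : ZMod B)) +
        n * (((i.1⁻¹ : (ZMod B)ˣ) : ZMod B) + ((i.2⁻¹ : (ZMod B)ˣ) : ZMod B))) : ℂ)‖ ^ 2 := by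
    intro m n
    -- The square of a Kloosterman sum is an exponential sum over pairs of units, so Parseval's
    -- identity for it counts the solutions bounded above.
    rw [show (4 : ℕ) = 2 * 2 from rfl, pow_mul, ← norm_pow]
    congr 2
    rw [pow_two, kloosterman, Finset.sum_mul_sum, ← Finset.sum_product']
    refine Finset.sum_congr rfl fun i _ => ?_
    rw [← AddChar.map_add_eq_mul]
    congr 1
    ring
  simp_rw [h1]
  rw [sum_normSq_exponentialSum]
  have := card_kloosterman_solutions_le (B := B)
  have h2 : ((Finset.univ.filter fun p : ((ZMod B)ˣ × (ZMod B)ˣ) × ((ZMod B)ˣ × (ZMod B)ˣ) =>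
      (p.1.1 : ZMod B) + p.1.2 = p.2.1 + p.2.2 ∧
      ((p.1.1⁻¹ : (ZMod B)ˣ) : ZMod B) + (p.1.2⁻¹ : (ZMod B)ˣ) =
        (p.2.1⁻¹ : (ZMod B)ˣ) + (p.2.2⁻¹ : (ZMod B)ˣ)).card : ℝ) ≤
      2 * ((B : ℝ) * B.divisors.card) ^ 2 := by exact_mod_cast this
  calc _ ≤ (B : ℝ) ^ 2 * (2 * ((B : ℝ) * B.divisors.card) ^ 2) := by gcongr
    _ = _ := by ring

/-- The same value occurs at `φ(B)` frequency pairs `(m u, n u⁻¹)`, and a given first frequency is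
hit by at most `gcd m B` units. The fourth moment, multiplied by this gcd, therefore bounds `φ(B)`
copies of the fourth power. -/
theorem norm_kloosterman_pow_four_le (m n : ZMod B) :
    ‖kloosterman m n‖ ^ 4 ≤
      2 * (Nat.gcd m.val B : ℝ) * (B : ℝ) ^ 3 * (B.divisors.card : ℝ) ^ 3 := by
  classical
  have hB : (0 : ℝ) < B := by exact_mod_cast NeZero.pos B
  have h1 : (Nat.totient B : ℝ) * ‖kloosterman m n‖ ^ 4 ≤
      (Nat.gcd m.val B : ℝ) * (2 * (B : ℝ) ^ 4 * (B.divisors.card : ℝ) ^ 2) := by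
    calc (Nat.totient B : ℝ) * ‖kloosterman m n‖ ^ 4
        = ∑ u : (ZMod B)ˣ, ‖kloosterman (m * (u : ZMod B)) (n * ((u⁻¹ : (ZMod B)ˣ) : ZMod B))‖ ^ 4 := by
          simp_rw [kloosterman_mul_unit]
          simp [ZMod.card_units_eq_totient]
      _ ≤ ∑ u : (ZMod B)ˣ, ∑ y : ZMod B, ‖kloosterman (m * (u : ZMod B)) y‖ ^ 4 := by
          refine Finset.sum_le_sum fun u _ => ?_
          exact Finset.single_le_sum (f := fun y => ‖kloosterman (m * (u : ZMod B)) y‖ ^ 4)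
            (fun _ _ => by positivity) (Finset.mem_univ _)
      _ = ∑ x : ZMod B, ∑ u ∈ Finset.univ.filter (fun u : (ZMod B)ˣ => m * (u : ZMod B) = x),
            ∑ y : ZMod B, ‖kloosterman (m * (u : ZMod B)) y‖ ^ 4 :=
          (Finset.sum_fiberwise _ _ _).symm
      _ ≤ ∑ x : ZMod B, (Nat.gcd m.val B : ℝ) * ∑ y : ZMod B, ‖kloosterman x y‖ ^ 4 := by
          refine Finset.sum_le_sum fun x _ => ?_
          calc _ = ∑ u ∈ Finset.univ.filter (fun u : (ZMod B)ˣ => m * (u : ZMod B) = x),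
                ∑ y : ZMod B, ‖kloosterman x y‖ ^ 4 := by
                refine Finset.sum_congr rfl fun u hu => ?_
                rw [(Finset.mem_filter.mp hu).2]
            _ = ((Finset.univ.filter (fun u : (ZMod B)ˣ => m * (u : ZMod B) = x)).card : ℝ) *
                ∑ y : ZMod B, ‖kloosterman x y‖ ^ 4 := by
                rw [Finset.sum_const, nsmul_eq_mul]
            _ ≤ _ := by
                refine mul_le_mul_of_nonneg_right ?_ (Finset.sum_nonneg fun _ _ => by positivity)
                have : (Finset.univ.filter (fun u : (ZMod B)ˣ => m * (u : ZMod B) = x)).card ≤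
                    (Finset.univ.filter (fun v : ZMod B => m * v = x)).card := by
                  refine Finset.card_le_card_of_injOn (fun u => (u : ZMod B)) ?_
                    (fun u _ v _ h => Units.ext h)
                  intro u hu
                  simpa using hu
                exact_mod_cast this.trans ((card_mul_eq_le_annCard m x).trans (annCard_le_gcd m))
      _ = (Nat.gcd m.val B : ℝ) * ∑ x : ZMod B, ∑ y : ZMod B, ‖kloosterman x y‖ ^ 4 := by
          rw [Finset.mul_sum]
      _ ≤ _ := by gcongr; exact sum_norm_kloosterman_pow_four_le
  have h2 : (B : ℝ) ≤ Nat.totient B * B.divisors.card := by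
    exact_mod_cast le_totient_mul_card_divisors B
  have h3 : (B : ℝ) * ‖kloosterman m n‖ ^ 4 ≤
      B * (2 * (Nat.gcd m.val B : ℝ) * (B : ℝ) ^ 3 * (B.divisors.card : ℝ) ^ 3) := by
    calc (B : ℝ) * ‖kloosterman m n‖ ^ 4
        ≤ (Nat.totient B * B.divisors.card) * ‖kloosterman m n‖ ^ 4 := by gcongr
      _ = B.divisors.card * ((Nat.totient B : ℝ) * ‖kloosterman m n‖ ^ 4) := by ring
      _ ≤ B.divisors.card * ((Nat.gcd m.val B : ℝ) *
            (2 * (B : ℝ) ^ 4 * (B.divisors.card : ℝ) ^ 2)) := by gcongr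
      _ = _ := by ring
  exact le_of_mul_le_mul_left h3 hB

end Kloosterman


/-! ### Divisor bound and sums of greatest common divisors -/

/-- The divisor bound `d(n) = O(n ^ (1 / k))`. -/
theorem exists_card_divisors_le (k : ℕ) (hk : 0 < k) :
    ∃ C : ℝ, 1 ≤ C ∧ ∀ n : ℕ, n ≠ 0 → (n.divisors.card : ℝ) ≤ C * (n : ℝ) ^ (1 / k : ℝ) := by
  have hl : 0 < Real.log 2 := Real.log_pos (by norm_num)
  have hl1 : Real.log 2 ≤ 1 := by
    have := Real.log_two_lt_d9; linarith
  have hk1 : (1 : ℝ) ≤ k := by exact_mod_cast hk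
  -- From `1 + e log 2 / k ≤ 2 ^ (e / k)`, multiplication by this `c ≥ 1` gives `c + e ≥ e + 1` on
  -- the left. The loss `c` is paid only at primes below `2 ^ k`, fewer than `2 ^ k` in number.
  -- Larger primes satisfy `e + 1 ≤ 2 ^ e ≤ p ^ (e / k)` without loss.
  set c : ℝ := k / Real.log 2 with hc
  have hc1 : 1 ≤ c := by
    rw [hc, le_div_iff₀ hl]; linarith
  have hsmall : ∀ p e : ℕ, 2 ≤ p → ((e : ℝ) + 1) ≤ c * ((p : ℝ) ^ e) ^ (1 / k : ℝ) := by
    intro p e hp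
    have h2 : (1 : ℝ) + e * (Real.log 2 / k) ≤ ((p : ℝ) ^ e) ^ (1 / k : ℝ) := by
      calc (1 : ℝ) + e * (Real.log 2 / k) ≤ Real.exp (e * (Real.log 2 / k)) := by
            have := Real.add_one_le_exp ((e : ℝ) * (Real.log 2 / k)); linarith
        _ = ((2 : ℝ) ^ e) ^ (1 / k : ℝ) := by
            rw [← Real.rpow_natCast, ← Real.rpow_mul (by norm_num), Real.rpow_def_of_pos (by norm_num)]
            congr 1; ring
        _ ≤ _ := by
            have : (2 : ℝ) ≤ p := by exact_mod_cast hp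
            gcongr
    calc (e : ℝ) + 1 ≤ c * (1 + e * (Real.log 2 / k)) := by
          have : c * (1 + e * (Real.log 2 / k)) = c + e := by
            rw [hc]; field_simp
          rw [this]; linarith
      _ ≤ _ := by gcongr
  have hlarge : ∀ p e : ℕ, 2 ^ k ≤ p → ((e : ℝ) + 1) ≤ ((p : ℝ) ^ e) ^ (1 / k : ℝ) := by
    intro p e hp
    calc ((e : ℝ) + 1) ≤ (2 : ℝ) ^ e := by
          exact_mod_cast Nat.lt_two_pow_self
      _ = (((2 : ℝ) ^ k) ^ e) ^ (1 / k : ℝ) := by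
          rw [← pow_mul, mul_comm, pow_mul, ← Real.rpow_natCast (_ ^ e), ← Real.rpow_mul (by positivity)]
          rw [mul_one_div_cancel (by positivity), Real.rpow_one]
      _ ≤ _ := by
          have : (2 : ℝ) ^ k ≤ p := by exact_mod_cast hp
          gcongr
  refine ⟨c ^ (2 ^ k), one_le_pow₀ hc1, fun n hn => ?_⟩
  have hprod : (n : ℝ) ^ (1 / k : ℝ) =
      ∏ p ∈ n.primeFactors, ((p : ℝ) ^ (n.factorization p)) ^ (1 / k : ℝ) := by
    rw [Real.finsetProd_rpow _ _ (fun _ _ => by positivity)]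
    congr 1
    conv_lhs => rw [← Nat.prod_factorization_pow_eq_self hn]
    rw [Finsupp.prod, Nat.support_factorization]
    push_cast
    rfl
  rw [Nat.card_divisors hn, hprod]
  push_cast
  calc ∏ p ∈ n.primeFactors, ((n.factorization p : ℝ) + 1)
      ≤ ∏ p ∈ n.primeFactors, ((if p < 2 ^ k then c else 1) *
          ((p : ℝ) ^ (n.factorization p)) ^ (1 / k : ℝ)) := by
        refine Finset.prod_le_prod (fun _ _ => by positivity) fun p hp => ?_
        split_ifs with h
        · exact hsmall p _ (Nat.prime_of_mem_primeFactors hp).two_le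
        · rw [one_mul]; exact hlarge p _ (not_lt.mp h)
    _ = (∏ p ∈ n.primeFactors, (if p < 2 ^ k then c else 1)) *
          ∏ p ∈ n.primeFactors, ((p : ℝ) ^ (n.factorization p)) ^ (1 / k : ℝ) :=
        Finset.prod_mul_distrib
    _ ≤ _ := by
        refine mul_le_mul_of_nonneg_right ?_ (Finset.prod_nonneg fun _ _ => by positivity)
        rw [← Finset.prod_filter, Finset.prod_const]
        refine pow_le_pow_right₀ hc1 ?_
        calc _ ≤ (Finset.range (2 ^ k)).card := by
              refine Finset.card_le_card fun p hp => ?_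
              simpa using (Finset.mem_filter.mp hp).2
          _ = _ := Finset.card_range _

/-- The gcd is one term of the sum of all divisors `g` common to `k` and `B`. Writing `k = g j`,
each `g` contributes at most a full harmonic sum in `j`. -/
theorem sum_gcd_div_le (B : ℕ) :
    ∑ k ∈ Finset.Ico 1 B, (Nat.gcd k B : ℝ) / k ≤
      B.divisors.card * ∑ k ∈ Finset.Ico 1 B, (1 : ℝ) / k := by
  rcases Nat.eq_zero_or_pos B with rfl | hB
  · simp
  calc ∑ k ∈ Finset.Ico 1 B, (Nat.gcd k B : ℝ) / k
      ≤ ∑ k ∈ Finset.Ico 1 B, ∑ g ∈ B.divisors, (if g ∣ k then (g : ℝ) / k else 0) := by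
        refine Finset.sum_le_sum fun k _ => ?_
        have h : Nat.gcd k B ∈ B.divisors := by simp [Nat.gcd_dvd_right, hB.ne']
        refine le_trans ?_ (Finset.single_le_sum (f := fun g : ℕ => if g ∣ k then (g : ℝ) / k else 0)
          (fun _ _ => by split_ifs <;> positivity) h)
        simp [Nat.gcd_dvd_left]
    _ = ∑ g ∈ B.divisors, ∑ k ∈ Finset.Ico 1 B, (if g ∣ k then (g : ℝ) / k else 0) :=
        Finset.sum_comm
    _ ≤ ∑ g ∈ B.divisors, ∑ k ∈ Finset.Ico 1 B, (1 : ℝ) / k := by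
        refine Finset.sum_le_sum fun g hg => ?_
        have hgpos := Nat.pos_of_mem_divisors hg
        rw [← Finset.sum_filter]
        have hinj : Set.InjOn (fun k => k / g)
            (((Finset.Ico 1 B).filter fun k => g ∣ k : Finset ℕ) : Set ℕ) := by
          intro k hk l hl hkl
          simp only [Finset.coe_filter, Set.mem_ofPred_eq] at hk hl hkl
          rw [← Nat.div_mul_cancel hk.2, ← Nat.div_mul_cancel hl.2, hkl]
        calc ∑ k ∈ (Finset.Ico 1 B).filter (fun k => g ∣ k), (g : ℝ) / k
            = ∑ k ∈ (Finset.Ico 1 B).filter (fun k => g ∣ k), (1 : ℝ) / ((k / g : ℕ) : ℝ) := by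
              refine Finset.sum_congr rfl fun k hk => ?_
              have hk := (Finset.mem_filter.mp hk).2
              rw [Nat.cast_div hk (by positivity), one_div_div]
          _ = ∑ j ∈ ((Finset.Ico 1 B).filter (fun k => g ∣ k)).image (fun k => k / g),
                (1 : ℝ) / j := (Finset.sum_image (f := fun j : ℕ => (1 : ℝ) / j) hinj).symm
          _ ≤ _ := by
              refine Finset.sum_le_sum_of_subset_of_nonneg ?_ (fun _ _ _ => by positivity)
              intro j hj
              obtain ⟨k, hk, rfl⟩ := Finset.mem_image.mp hj
              simp only [Finset.mem_filter, Finset.mem_Ico] at hk ⊢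
              exact ⟨Nat.div_pos (Nat.le_of_dvd (by omega) hk.2) hgpos,
                lt_of_le_of_lt (Nat.div_le_self _ _) hk.1.2⟩
    _ = _ := by rw [Finset.sum_const, nsmul_eq_mul]

theorem sum_one_div_Ico_le (B : ℕ) :
    ∑ k ∈ Finset.Ico 1 B, (1 : ℝ) / k ≤ 1 + Real.log B := by
  have h := harmonic_le_one_add_log B
  rw [harmonic_eq_sum_Icc] at h
  push_cast at h
  refine le_trans ?_ h
  simp_rw [one_div]
  exact Finset.sum_le_sum_of_subset_of_nonneg Finset.Ico_subset_Icc_self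
    (fun _ _ _ => by positivity)

/-! ### Equidistribution of inverses modulo `B` -/

section Box

variable {B : ℕ} [NeZero B]

/-- The Fourier transform of the indicator of an interval of length `L` starting at `p`. -/
noncomputable def intervalSum (p L : ℕ) (m : ZMod B) : ℂ :=
  ∑ j ∈ Finset.range L, ZMod.stdAddChar (-(m * ((p + j : ℕ) : ZMod B)))

theorem intervalSum_zero (p L : ℕ) : intervalSum p L (0 : ZMod B) = L := by
  simp [intervalSum]

/-- A geometric sum with ratio `e(k / B)` is at most `1 / sin(π k / B)`, and Jordan's inequality
bounds the sine below by twice the distance of `k / B` to the nearest integer. Keeping both `1 / k`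
and `1 / (B - k)` avoids later case distinctions. -/
theorem norm_intervalSum_le (p L k : ℕ) (hk : 0 < k) (hkB : k < B) :
    ‖intervalSum p L (k : ZMod B)‖ ≤ B / 2 * (1 / k + 1 / (B - k : ℕ)) := by
  have hB : (0 : ℝ) < B := by exact_mod_cast NeZero.pos B
  set r : ℂ := ZMod.stdAddChar (k : ZMod B) with hr
  have hr' : r = Complex.exp (Complex.I * ((2 * Real.pi * k / B : ℝ) : ℂ)) := by
    have := ZMod.stdAddChar_coe (N := B) (k : ℤ)
    push_cast at this
    rw [hr, this]
    push_cast
    congr 1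
    ring
  have h1 : ‖intervalSum p L (k : ZMod B)‖ = ‖∑ j ∈ Finset.range L, r ^ j‖ := by
    rw [← RCLike.norm_conj (∑ j ∈ Finset.range L, r ^ j), intervalSum, map_sum]
    have : ∀ j : ℕ, (ZMod.stdAddChar (-((k : ZMod B) * ((p + j : ℕ) : ZMod B))) : ℂ) =
        ZMod.stdAddChar (-((k : ZMod B) * (p : ZMod B))) * (starRingEnd ℂ) (r ^ j) := by
      intro j
      rw [hr, ← AddChar.map_nsmul_eq_pow, ZMod.conj_stdAddChar, ← AddChar.map_add_eq_mul]
      congr 1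
      push_cast
      rw [nsmul_eq_mul]
      ring
    simp_rw [this, ← Finset.mul_sum, norm_mul]
    rw [AddChar.norm_apply, one_mul]
  have hnr : ‖r‖ = 1 := AddChar.norm_apply _ _
  have h2 : ‖∑ j ∈ Finset.range L, r ^ j‖ * ‖r - 1‖ ≤ 2 := by
    rw [← norm_mul, geom_sum_mul]
    calc _ ≤ ‖r ^ L‖ + ‖(1 : ℂ)‖ := norm_sub_le _ _
      _ = 2 := by rw [norm_pow, hnr]; norm_num
  have h3 : ‖r - 1‖ = 2 * Real.sin (Real.pi * k / B) := by
    rw [hr', Complex.norm_exp_I_mul_ofReal_sub_one, Real.norm_eq_abs, abs_of_nonneg]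
    · congr 2; ring
    · have : 0 ≤ Real.sin (2 * Real.pi * k / B / 2) := by
        apply Real.sin_nonneg_of_nonneg_of_le_pi (by positivity)
        have : (k : ℝ) / B ≤ 1 := by
          rw [div_le_one hB]; exact_mod_cast hkB.le
        calc 2 * Real.pi * k / B / 2 = Real.pi * (k / B) := by ring
          _ ≤ Real.pi * 1 := by gcongr
          _ = _ := mul_one _
      positivity
  have hsin : ∀ l : ℕ, 0 < l → 2 * l ≤ B → 2 * (l / B : ℝ) ≤ Real.sin (Real.pi * l / B) := by
    intro l hl hlB
    have hlB' : 2 * (l : ℝ) ≤ B := by exact_mod_cast hlB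
    have := Real.mul_le_sin (x := Real.pi * l / B) (by positivity) (by
      rw [div_le_div_iff₀ hB (by norm_num)]
      nlinarith [Real.pi_pos])
    refine le_trans (le_of_eq ?_) this
    field_simp
  have hkey : ∀ l : ℕ, 0 < l → 2 * (l / B : ℝ) ≤ Real.sin (Real.pi * k / B) →
      ‖∑ j ∈ Finset.range L, r ^ j‖ ≤ B / 2 * (1 / l) := by
    intro l hl hs
    have hl' : (0 : ℝ) < l := by exact_mod_cast hl
    rw [h3] at h2
    have h4 : ‖∑ j ∈ Finset.range L, r ^ j‖ * (2 * (2 * (l / B : ℝ))) ≤ 2 :=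
      le_trans (by gcongr) h2
    rw [← sub_nonneg] at h4 ⊢
    have : (B : ℝ) / 2 * (1 / l) - ‖∑ j ∈ Finset.range L, r ^ j‖ =
      (2 - ‖∑ j ∈ Finset.range L, r ^ j‖ * (2 * (2 * (l / B : ℝ)))) * (B / (4 * l)) := by
      field_simp; ring
    rw [this]
    positivity
  rw [h1]
  have hBk : (0 : ℝ) < ((B - k : ℕ) : ℝ) := by
    have : 0 < B - k := by omega
    exact_mod_cast this
  have hk' : (0 : ℝ) < k := by exact_mod_cast hk
  rcases le_total (2 * k) B with h | h
  · refine (hkey k hk (hsin k hk h)).trans ?_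
    gcongr
    linarith [one_div_pos.mpr hBk]
  · refine (hkey (B - k) (by omega) ?_).trans ?_
    · refine (hsin (B - k) (by omega) (by omega)).trans (le_of_eq ?_)
      rw [Nat.cast_sub hkB.le, ← Real.sin_pi_sub]
      congr 1
      field_simp
      ring
    · gcongr
      linarith [one_div_pos.mpr hk']

theorem ZMod.sum_eq_zero_add_sum_Ico {M : Type*} [AddCommMonoid M] (f : ZMod B → M) :
    ∑ x : ZMod B, f x = f 0 + ∑ k ∈ Finset.Ico 1 B, f (k : ZMod B) := by
  rw [ZMod.sum_eq_sum_range, Finset.range_eq_Ico, Finset.sum_eq_sum_Ico_succ_bot (NeZero.pos B)]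
  simp

/-- The number of pairs in a product of two intervals whose product is `1` modulo `B`. -/
def inverseCount (B p L q L' : ℕ) : ℕ :=
  ((Finset.range L ×ˢ Finset.range L').filter fun z =>
    ((p + z.1 : ℕ) : ZMod B) * ((q + z.2 : ℕ) : ZMod B) = 1).card

/-- A point is counted when some unit `u` equals its first coordinate and `u⁻¹` its second.
Detecting both equalities by additive characters and summing over `u` first makes the Kloosterman
sum appear. -/
theorem inverseCount_eq_sum (p L q L' : ℕ) :
    ((B : ℂ) ^ 2) * (inverseCount B p L q L' : ℂ) =
      ∑ m : ZMod B, ∑ n : ZMod B, intervalSum p L m * intervalSum q L' n * kloosterman m n := by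
  classical
  have h1 : (inverseCount B p L q L' : ℂ) = ∑ z ∈ Finset.range L ×ˢ Finset.range L',
      ∑ u : (ZMod B)ˣ, (if (u : ZMod B) - ((p + z.1 : ℕ) : ZMod B) = 0 then (1 : ℂ) else 0) *
        (if ((u⁻¹ : (ZMod B)ˣ) : ZMod B) - ((q + z.2 : ℕ) : ZMod B) = 0 then (1 : ℂ) else 0) := by
    rw [inverseCount, Finset.card_filter]
    push_cast
    refine Finset.sum_congr rfl fun z _ => ?_
    split_ifs with h
    · set x : ZMod B := (p : ZMod B) + z.1
      set y : ZMod B := (q : ZMod B) + z.2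
      have hyx : y * x = 1 := by rw [mul_comm]; exact h
      rw [Finset.sum_eq_single (⟨x, y, h, hyx⟩ : (ZMod B)ˣ)]
      · simp
      · intro u _ hu
        rw [if_neg, zero_mul]
        intro h0
        exact hu (Units.ext (by simpa using sub_eq_zero.mp h0))
      · simp
    · symm
      refine Finset.sum_eq_zero fun u _ => ?_
      split_ifs with ha hb <;> simp
      apply h
      rw [← sub_eq_zero.mp ha, ← sub_eq_zero.mp hb, Units.mul_inv]
  have h2 : ∀ x : ZMod B, (B : ℂ) * (if x = 0 then (1 : ℂ) else 0) =
      ∑ m : ZMod B, (ZMod.stdAddChar (m * x) : ℂ) := by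
    intro x
    rw [ZMod.sum_stdAddChar_mul]; simp
  calc ((B : ℂ) ^ 2) * (inverseCount B p L q L' : ℂ)
      = ∑ z ∈ Finset.range L ×ˢ Finset.range L', ∑ u : (ZMod B)ˣ,
          (∑ m : ZMod B, (ZMod.stdAddChar (m * ((u : ZMod B) - ((p + z.1 : ℕ) : ZMod B))) : ℂ)) *
          (∑ n : ZMod B, (ZMod.stdAddChar
            (n * (((u⁻¹ : (ZMod B)ˣ) : ZMod B) - ((q + z.2 : ℕ) : ZMod B))) : ℂ)) := by
        rw [h1, Finset.mul_sum]
        refine Finset.sum_congr rfl fun z _ => ?_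
        rw [Finset.mul_sum]
        refine Finset.sum_congr rfl fun u _ => ?_
        rw [← h2, ← h2]; ring
    _ = ∑ z ∈ Finset.range L ×ˢ Finset.range L', ∑ u : (ZMod B)ˣ, ∑ w : ZMod B × ZMod B,
          (ZMod.stdAddChar (-(w.1 * ((p + z.1 : ℕ) : ZMod B))) : ℂ) *
          ZMod.stdAddChar (-(w.2 * ((q + z.2 : ℕ) : ZMod B))) *
          ZMod.stdAddChar (w.1 * (u : ZMod B) + w.2 * ((u⁻¹ : (ZMod B)ˣ) : ZMod B)) := by
        refine Finset.sum_congr rfl fun z _ => Finset.sum_congr rfl fun u _ => ?_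
        rw [Finset.sum_mul_sum, ← Finset.sum_product', Finset.univ_product_univ]
        refine Finset.sum_congr rfl fun w _ => ?_
        simp only [← AddChar.map_add_eq_mul]
        congr 1
        ring
    _ = ∑ w : ZMod B × ZMod B, ∑ z ∈ Finset.range L ×ˢ Finset.range L', ∑ u : (ZMod B)ˣ,
          (ZMod.stdAddChar (-(w.1 * ((p + z.1 : ℕ) : ZMod B))) : ℂ) *
          ZMod.stdAddChar (-(w.2 * ((q + z.2 : ℕ) : ZMod B))) *
          ZMod.stdAddChar (w.1 * (u : ZMod B) + w.2 * ((u⁻¹ : (ZMod B)ˣ) : ZMod B)) := by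
        rw [Finset.sum_congr rfl fun z _ => Finset.sum_comm]
        exact Finset.sum_comm
    _ = _ := by
        rw [← Finset.univ_product_univ, Finset.sum_product]
        refine Finset.sum_congr rfl fun m _ => Finset.sum_congr rfl fun n _ => ?_
        rw [intervalSum, intervalSum, kloosterman, Finset.sum_mul_sum, Finset.sum_mul,
          Finset.sum_product]
        refine Finset.sum_congr rfl fun i _ => ?_
        rw [Finset.sum_mul]
        refine Finset.sum_congr rfl fun j _ => ?_
        rw [Finset.mul_sum]

theorem norm_kloosterman_le (m n : ZMod B) :
    ‖kloosterman m n‖ ≤ (2 * (B : ℝ) ^ 3 * (B.divisors.card : ℝ) ^ 3) ^ (1 / 4 : ℝ) *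
      (Nat.gcd n.val B : ℝ) ^ (1 / 4 : ℝ) := by
  rw [← Real.mul_rpow (by positivity) (by positivity), kloosterman_comm]
  have h := norm_kloosterman_pow_four_le n m
  calc ‖kloosterman n m‖ = (‖kloosterman n m‖ ^ 4) ^ (1 / 4 : ℝ) := by
        rw [← Real.rpow_natCast, ← Real.rpow_mul (norm_nonneg _)]
        norm_num
    _ ≤ _ := by
        refine Real.rpow_le_rpow (by positivity) (h.trans (le_of_eq (by ring))) (by norm_num)

theorem norm_kloosterman_le_gcd (m n : ZMod B) :
    ‖kloosterman m n‖ ≤ (2 * (B : ℝ) ^ 3 * (B.divisors.card : ℝ) ^ 3) ^ (1 / 4 : ℝ) *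
      (Nat.gcd n.val B : ℝ) := by
  refine (norm_kloosterman_le m n).trans ?_
  gcongr
  have : (1 : ℝ) ≤ Nat.gcd n.val B := by
    exact_mod_cast Nat.gcd_pos_of_pos_right _ (NeZero.pos B)
  calc _ ≤ (Nat.gcd n.val B : ℝ) ^ (1 : ℝ) := Real.rpow_le_rpow_of_exponent_le this (by norm_num)
    _ = _ := Real.rpow_one _

/-- The reflection `k ↦ B - k` exchanges the two halves of the geometric sum bound. It is applied to
the weights `1` and `gcd k B`. -/
theorem sum_Ico_reflect_half (B : ℕ) (g : ℕ → ℝ) (hg : ∀ k ∈ Finset.Ico 1 B, g (B - k) = g k) :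
    ∑ k ∈ Finset.Ico 1 B, (B : ℝ) / 2 * (1 / k + 1 / (B - k : ℕ)) * g k =
      B * ∑ k ∈ Finset.Ico 1 B, g k / k := by
  have h : ∑ k ∈ Finset.Ico 1 B, g k / ((B - k : ℕ) : ℝ) = ∑ k ∈ Finset.Ico 1 B, g k / k := by
    refine Finset.sum_bij' (fun k _ => B - k) (fun k _ => B - k) ?_ ?_ ?_ ?_ ?_
    · intro k hk; simp only [Finset.mem_Ico] at hk ⊢; omega
    · intro k hk; simp only [Finset.mem_Ico] at hk ⊢; omega
    · intro k hk; simp only [Finset.mem_Ico] at hk ⊢; omega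
    · intro k hk; simp only [Finset.mem_Ico] at hk ⊢; omega
    · intro k hk; rw [hg k hk]
  calc _ = (B : ℝ) / 2 * (∑ k ∈ Finset.Ico 1 B, g k / k +
        ∑ k ∈ Finset.Ico 1 B, g k / ((B - k : ℕ) : ℝ)) := by
        rw [← Finset.sum_add_distrib, Finset.mul_sum]
        refine Finset.sum_congr rfl fun k _ => ?_
        ring
    _ = _ := by rw [h]; ring

/-- The pair of zero frequencies gives the main term, since the Kloosterman sum there is `φ(B)`. The
two axes and the remaining frequencies are bounded separately, each time placing the gcd on one
nonzero frequency. -/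
theorem abs_inverseCount_sub_le (p L q L' : ℕ) :
    |(inverseCount B p L q L' : ℝ) - (Nat.totient B : ℝ) * L * L' / (B : ℝ) ^ 2| ≤
      (2 * (B : ℝ) ^ 3 * (B.divisors.card : ℝ) ^ 3) ^ (1 / 4 : ℝ) *
      (∑ k ∈ Finset.Ico 1 B, (Nat.gcd k B : ℝ) / k) *
      (((L : ℝ) + L') / B + ∑ k ∈ Finset.Ico 1 B, (1 : ℝ) / k) := by
  have hB : (0 : ℝ) < B := by exact_mod_cast NeZero.pos B
  set κ := (2 * (B : ℝ) ^ 3 * (B.divisors.card : ℝ) ^ 3) ^ (1 / 4 : ℝ)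
  set W := ∑ k ∈ Finset.Ico 1 B, (Nat.gcd k B : ℝ) / k
  set V := ∑ k ∈ Finset.Ico 1 B, (1 : ℝ) / k
  have hκ : 0 ≤ κ := by positivity
  have hbound : ∀ (p L : ℕ), ∀ k ∈ Finset.Ico 1 B, ‖intervalSum p L (k : ZMod B)‖ ≤
      B / 2 * (1 / k + 1 / (B - k : ℕ)) := fun p L k hk =>
    norm_intervalSum_le p L k (Finset.mem_Ico.mp hk).1 (Finset.mem_Ico.mp hk).2
  have hg : ∀ k ∈ Finset.Ico 1 B, Nat.gcd (k : ZMod B).val B = Nat.gcd k B := by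
    intro k hk
    rw [ZMod.val_cast_of_lt (Finset.mem_Ico.mp hk).2]
  have hV : ∀ p L, ∑ k ∈ Finset.Ico 1 B, ‖intervalSum p L (k : ZMod B)‖ ≤ B * V := by
    intro p L
    calc _ ≤ ∑ k ∈ Finset.Ico 1 B, (B : ℝ) / 2 * (1 / k + 1 / (B - k : ℕ)) * 1 := by
          refine Finset.sum_le_sum fun k hk => ?_
          rw [mul_one]; exact hbound p L k hk
      _ = _ := sum_Ico_reflect_half B (fun _ => 1) (fun _ _ => rfl)
  have hW : ∀ p L, ∑ k ∈ Finset.Ico 1 B, ‖intervalSum p L (k : ZMod B)‖ * (Nat.gcd k B : ℝ) ≤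
      B * W := by
    intro p L
    calc _ ≤ ∑ k ∈ Finset.Ico 1 B, (B : ℝ) / 2 * (1 / k + 1 / (B - k : ℕ)) * (Nat.gcd k B : ℝ) := by
          refine Finset.sum_le_sum fun k hk => ?_
          gcongr
          exact hbound p L k hk
      _ = _ := by
          refine sum_Ico_reflect_half B (fun k => (Nat.gcd k B : ℝ)) fun k hk => ?_
          rw [Nat.gcd_comm, Nat.gcd_self_sub_right (Finset.mem_Ico.mp hk).2.le, Nat.gcd_comm]
  have hW0 : 0 ≤ W := Finset.sum_nonneg fun _ _ => by positivity
  have hV0 : 0 ≤ V := Finset.sum_nonneg fun _ _ => by positivity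
  have hK1 : ∀ (m : ZMod B), ∀ k ∈ Finset.Ico 1 B,
      ‖kloosterman m (k : ZMod B)‖ ≤ κ * (Nat.gcd k B : ℝ) := by
    intro m k hk
    have := norm_kloosterman_le_gcd m (k : ZMod B)
    rwa [hg k hk] at this
  have hmain : ((B : ℂ) ^ 2) * (inverseCount B p L q L' : ℂ) - (L : ℂ) * L' * Nat.totient B =
      ∑ n ∈ Finset.Ico 1 B, (L : ℂ) * intervalSum q L' (n : ZMod B) * kloosterman 0 (n : ZMod B) +
      ∑ m ∈ Finset.Ico 1 B, (intervalSum p L (m : ZMod B) * L' * kloosterman (m : ZMod B) 0 +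
        ∑ n ∈ Finset.Ico 1 B, intervalSum p L (m : ZMod B) * intervalSum q L' (n : ZMod B) *
          kloosterman (m : ZMod B) (n : ZMod B)) := by
    rw [inverseCount_eq_sum, ZMod.sum_eq_zero_add_sum_Ico]
    simp_rw [ZMod.sum_eq_zero_add_sum_Ico (B := B)]
    rw [intervalSum_zero, intervalSum_zero, kloosterman_zero_zero]
    ring
  have hnorm : ‖((B : ℂ) ^ 2) * (inverseCount B p L q L' : ℂ) - (L : ℂ) * L' * Nat.totient B‖ ≤
      κ * W * (B * L + B * L' + B ^ 2 * V) := by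
    rw [hmain]
    have e1 : ‖∑ n ∈ Finset.Ico 1 B, (L : ℂ) * intervalSum q L' (n : ZMod B) *
        kloosterman 0 (n : ZMod B)‖ ≤ L * κ * (B * W) := by
      refine (norm_sum_le _ _).trans ?_
      refine le_trans ?_ (mul_le_mul_of_nonneg_left (hW q L') (by positivity))
      rw [Finset.mul_sum]
      refine Finset.sum_le_sum fun n hn => ?_
      rw [norm_mul, norm_mul, Complex.norm_natCast]
      calc _ ≤ (L : ℝ) * ‖intervalSum q L' (n : ZMod B)‖ * (κ * (Nat.gcd n B : ℝ)) := by
            gcongr; exact hK1 _ _ hn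
        _ = _ := by ring
    have e2 : ‖∑ m ∈ Finset.Ico 1 B, intervalSum p L (m : ZMod B) * L' *
        kloosterman (m : ZMod B) 0‖ ≤ L' * κ * (B * W) := by
      refine (norm_sum_le _ _).trans ?_
      refine le_trans ?_ (mul_le_mul_of_nonneg_left (hW p L) (by positivity))
      rw [Finset.mul_sum]
      refine Finset.sum_le_sum fun n hn => ?_
      rw [norm_mul, norm_mul, Complex.norm_natCast, kloosterman_comm]
      calc _ ≤ ‖intervalSum p L (n : ZMod B)‖ * L' * (κ * (Nat.gcd n B : ℝ)) := by
            gcongr; exact hK1 _ _ hn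
        _ = _ := by ring
    have e3 : ‖∑ m ∈ Finset.Ico 1 B, ∑ n ∈ Finset.Ico 1 B, intervalSum p L (m : ZMod B) *
        intervalSum q L' (n : ZMod B) * kloosterman (m : ZMod B) (n : ZMod B)‖ ≤
        (B * V) * (κ * (B * W)) := by
      calc _ ≤ ∑ m ∈ Finset.Ico 1 B, ‖intervalSum p L (m : ZMod B)‖ * (κ * (B * W)) := by
            refine (norm_sum_le _ _).trans (Finset.sum_le_sum fun m _ => ?_)
            refine (norm_sum_le _ _).trans ?_
            calc _ ≤ ∑ n ∈ Finset.Ico 1 B, ‖intervalSum p L (m : ZMod B)‖ * (κ *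
                  (‖intervalSum q L' (n : ZMod B)‖ * (Nat.gcd n B : ℝ))) := by
                  refine Finset.sum_le_sum fun n hn => ?_
                  rw [norm_mul, norm_mul]
                  calc _ ≤ ‖intervalSum p L (m : ZMod B)‖ * ‖intervalSum q L' (n : ZMod B)‖ *
                        (κ * (Nat.gcd n B : ℝ)) := by gcongr; exact hK1 _ _ hn
                    _ = _ := by ring
              _ = ‖intervalSum p L (m : ZMod B)‖ * (κ * ∑ n ∈ Finset.Ico 1 B,
                  (‖intervalSum q L' (n : ZMod B)‖ * (Nat.gcd n B : ℝ))) := by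
                  rw [Finset.mul_sum, Finset.mul_sum]
              _ ≤ _ := by gcongr; exact hW q L'
        _ ≤ _ := by
            rw [← Finset.sum_mul]
            gcongr
            exact hV p L
    rw [Finset.sum_add_distrib]
    refine (norm_add_le _ _).trans ((add_le_add e1 ((norm_add_le _ _).trans
      (add_le_add e2 e3))).trans (le_of_eq ?_))
    ring
  have hcast : ((B : ℂ) ^ 2) * (inverseCount B p L q L' : ℂ) - (L : ℂ) * L' * Nat.totient B =
      (((B : ℝ) ^ 2 * ((inverseCount B p L q L' : ℝ) -
        (Nat.totient B : ℝ) * L * L' / (B : ℝ) ^ 2) : ℝ) : ℂ) := by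
    push_cast
    have : (B : ℂ) ≠ 0 := by exact_mod_cast hB.ne'
    field_simp
  rw [hcast, Complex.norm_real, Real.norm_eq_abs, abs_mul, abs_of_nonneg (by positivity)] at hnorm
  have hB2 : (0 : ℝ) < (B : ℝ) ^ 2 := by positivity
  refine le_of_mul_le_mul_left (hnorm.trans (le_of_eq ?_)) hB2
  field_simp

end Box

/-- Equidistribution of pairs of inverses modulo `B` with a power saving. -/
theorem exists_abs_inverseCount_sub_le :
    ∃ C : ℝ, 0 ≤ C ∧ ∀ B p L q L' : ℕ, 1 ≤ B → L ≤ B →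
      |(inverseCount B p L q L' : ℝ) - (Nat.totient B : ℝ) * L * L' / (B : ℝ) ^ 2| ≤
        C * (B : ℝ) ^ (4 / 5 : ℝ) * (1 + L' / B) := by
  obtain ⟨C₁, hC₁, hd⟩ := exists_card_divisors_le 100 (by norm_num)
  -- Divisor functions and logarithms are each at most a constant times `x = B ^ (1/100)`. Two
  -- factors of each kind occur, and one spare `x` rounds the exponent to `3/4 + 5/100 = 4/5`.
  refine ⟨2 * C₁ ^ 3 * 102 ^ 2, by positivity, fun B p L q L' hB hL => ?_⟩
  have : NeZero B := ⟨by omega⟩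
  have hB1 : (1 : ℝ) ≤ B := by exact_mod_cast hB
  have hB0 : (0 : ℝ) < B := by linarith
  refine (abs_inverseCount_sub_le p L q L').trans ?_
  set d : ℝ := (B.divisors.card : ℝ) with hdd
  set x : ℝ := (B : ℝ) ^ (1 / 100 : ℝ) with hx
  have hx1 : 1 ≤ x := Real.one_le_rpow hB1 (by norm_num)
  have hdx : d ≤ C₁ * x := by
    have := hd B (by omega); push_cast at this; exact this
  have hd1 : 1 ≤ d := by
    have : 0 < B.divisors.card := Finset.card_pos.mpr ⟨1, by simp; omega⟩
    rw [hdd]; exact_mod_cast this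
  set V := ∑ k ∈ Finset.Ico 1 B, (1 : ℝ) / k
  have hV0 : 0 ≤ V := Finset.sum_nonneg fun _ _ => by positivity
  have hV : 1 + V ≤ 102 * x := by
    have h1 := sum_one_div_Ico_le B
    have h2 : Real.log B ≤ 100 * x := by
      have := Real.log_le_rpow_div (x := (B : ℝ)) hB0.le (ε := 1 / 100) (by norm_num)
      rw [← hx] at this
      linarith
    linarith
  have hκ : (2 * (B : ℝ) ^ 3 * d ^ 3) ^ (1 / 4 : ℝ) ≤ 2 * (B : ℝ) ^ (3 / 4 : ℝ) * d := by
    have h1 : (2 * (B : ℝ) ^ 3 * d ^ 3) ≤ (2 * (B : ℝ) ^ (3 / 4 : ℝ) * d) ^ 4 := by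
      have : ((B : ℝ) ^ (3 / 4 : ℝ)) ^ 4 = (B : ℝ) ^ 3 := by
        rw [← Real.rpow_natCast, ← Real.rpow_mul hB0.le]; norm_num
      rw [mul_pow, mul_pow, this]
      have h3 : d ^ 3 ≤ d ^ 4 := pow_le_pow_right₀ hd1 (by norm_num)
      have : (0 : ℝ) ≤ (B : ℝ) ^ 3 := by positivity
      calc 2 * (B : ℝ) ^ 3 * d ^ 3 ≤ 2 ^ 4 * (B : ℝ) ^ 3 * d ^ 4 := by gcongr; norm_num
        _ = _ := rfl
    calc _ ≤ ((2 * (B : ℝ) ^ (3 / 4 : ℝ) * d) ^ 4) ^ (1 / 4 : ℝ) :=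
          Real.rpow_le_rpow (by positivity) h1 (by norm_num)
      _ = _ := by
          rw [← Real.rpow_natCast, ← Real.rpow_mul (by positivity)]
          norm_num
  have hW : ∑ k ∈ Finset.Ico 1 B, (Nat.gcd k B : ℝ) / k ≤ d * (1 + V) :=
    (sum_gcd_div_le B).trans (by gcongr; linarith)
  have hlast : ((L : ℝ) + L') / B + V ≤ (1 + V) * (1 + L' / B) := by
    have : (L : ℝ) / B ≤ 1 := by
      rw [div_le_one hB0]; exact_mod_cast hL
    have h2 : (0 : ℝ) ≤ L' / B := by positivity
    rw [add_div]
    nlinarith [mul_nonneg hV0 h2]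
  have hpow : (B : ℝ) ^ (3 / 4 : ℝ) * x ^ 5 = (B : ℝ) ^ (4 / 5 : ℝ) := by
    rw [hx, ← Real.rpow_natCast, ← Real.rpow_mul hB0.le, ← Real.rpow_add hB0]
    norm_num
  calc _ ≤ (2 * (B : ℝ) ^ (3 / 4 : ℝ) * d) * (d * (1 + V)) * ((1 + V) * (1 + L' / B)) := by
        gcongr
    _ = 2 * (B : ℝ) ^ (3 / 4 : ℝ) * (d ^ 2 * (1 + V) ^ 2) * (1 + L' / B) := by ring
    _ ≤ 2 * (B : ℝ) ^ (3 / 4 : ℝ) * ((C₁ * x) ^ 2 * (102 * x) ^ 2) * (1 + L' / B) := by gcongr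
    _ = 2 * C₁ ^ 2 * 102 ^ 2 * ((B : ℝ) ^ (3 / 4 : ℝ) * x ^ 4) * (1 + L' / B) := by ring
    _ ≤ 2 * C₁ ^ 3 * 102 ^ 2 * ((B : ℝ) ^ (3 / 4 : ℝ) * x ^ 5) * (1 + L' / B) := by
        gcongr <;> norm_num
    _ = _ := by rw [hpow]


/-! ### Mean value of Euler's function -/

open ArithmeticFunction in
theorem sum_totient_eq_sum_moebius (N : ℕ) :
    ∑ n ∈ Finset.Ioc 0 N, (Nat.totient n : ℝ) =
      ∑ d ∈ Finset.Ioc 0 N, (moebius d : ℝ) * (((N / d : ℕ) : ℝ) * ((N / d : ℕ) + 1) / 2) := by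
  have h := (sum_eq_iff_sum_mul_moebius_eq (R := ℝ) (f := fun n => (Nat.totient n : ℝ))
    (g := fun n => (n : ℝ))).mp (fun n _ => by exact_mod_cast Nat.sum_totient n)
  have h2 := sum_Ioc_mul_eq_sum_sum ((moebius : ArithmeticFunction ℤ) : ArithmeticFunction ℝ)
    ((ArithmeticFunction.id : ArithmeticFunction ℕ) : ArithmeticFunction ℝ) N
  calc _ = ∑ n ∈ Finset.Ioc 0 N, (((moebius : ArithmeticFunction ℤ) : ArithmeticFunction ℝ) *
      ((ArithmeticFunction.id : ArithmeticFunction ℕ) : ArithmeticFunction ℝ)) n := by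
        refine Finset.sum_congr rfl fun n hn => ?_
        rw [← h n (Finset.mem_Ioc.mp hn).1, ArithmeticFunction.mul_apply]
        simp
    _ = _ := by
        rw [h2]
        refine Finset.sum_congr rfl fun d _ => ?_
        congr 1
        have : ∀ k : ℕ, ∑ m ∈ Finset.Ioc 0 k, (m : ℝ) = (k : ℝ) * (k + 1) / 2 := by
          intro k
          induction k with
          | zero => simp
          | succ k ih =>
            rw [Finset.sum_Ioc_succ_top (Nat.zero_le _), ih]; push_cast; ring
        simpa using this (N / d)

open ArithmeticFunction in
theorem hasSum_moebius_div_sq :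
    HasSum (fun d : ℕ => (moebius d : ℝ) / (d : ℝ) ^ 2) (6 / Real.pi ^ 2) := by
  have hs : (1 : ℝ) < (2 : ℂ).re := by norm_num
  have h1 := LSeries_one_mul_Lseries_moebius hs
  rw [LSeries_one_eq_riemannZeta hs, riemannZeta_two] at h1
  have h2 : LSeriesSummable (fun n => ((moebius n : ℤ) : ℂ)) 2 := LSeriesSummable_moebius_iff.mpr hs
  have h3 := h2.hasSum
  have hpi : (Real.pi : ℂ) ≠ 0 := by exact_mod_cast Real.pi_ne_zero
  have h4 : (∑' n, LSeries.term (fun n => ((moebius n : ℤ) : ℂ)) 2 n) = ((6 / Real.pi ^ 2 : ℝ) : ℂ) := by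
    have h5 : (∑' n, LSeries.term (fun n => ((moebius n : ℤ) : ℂ)) 2 n) =
      LSeries (fun n => ((moebius n : ℤ) : ℂ)) 2 := rfl
    rw [h5]
    push_cast
    field_simp at h1 ⊢
    linear_combination h1
  rw [h4] at h3
  rw [← Complex.hasSum_ofReal]
  convert h3 using 1
  ext n
  rcases Nat.eq_zero_or_pos n with rfl | hn
  · simp
  · rw [LSeries.term_of_ne_zero hn.ne']
    push_cast
    congr 1
    norm_cast

open ArithmeticFunction in
theorem abs_sum_moebius_div_sq_sub_le (N : ℕ) (hN : 1 ≤ N) :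
    |∑ d ∈ Finset.Ioc 0 N, (moebius d : ℝ) / (d : ℝ) ^ 2 - 6 / Real.pi ^ 2| ≤ 1 / (N : ℝ) := by
  have hlim : Tendsto (fun M : ℕ => |∑ d ∈ Finset.Ioc 0 N, (moebius d : ℝ) / (d : ℝ) ^ 2 -
      ∑ d ∈ Finset.Ioc 0 M, (moebius d : ℝ) / (d : ℝ) ^ 2|) atTop
      (𝓝 |∑ d ∈ Finset.Ioc 0 N, (moebius d : ℝ) / (d : ℝ) ^ 2 - 6 / Real.pi ^ 2|) := by
    have h := (hasSum_moebius_div_sq.tendsto_sum_nat.comp (tendsto_add_atTop_nat 1))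
    refine ((tendsto_const_nhds).sub (h.congr fun M => ?_)).abs
    simp only [Function.comp]
    rw [Finset.range_eq_Ico, Finset.sum_eq_sum_Ico_succ_bot (by omega)]
    simp only [CharP.cast_eq_zero, ne_eq, OfNat.ofNat_ne_zero, not_false_eq_true, zero_pow, div_zero, zero_add]
    rfl
  refine le_of_tendsto hlim (eventually_atTop.mpr ⟨N, fun M hM => ?_⟩)
  rw [← Finset.sum_Ioc_consecutive _ (Nat.zero_le N) hM, sub_add_cancel_left, abs_neg]
  calc _ ≤ ∑ d ∈ Finset.Ioc N M, ((d : ℝ) ^ 2)⁻¹ := by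
        refine (Finset.abs_sum_le_sum_abs _ _).trans (Finset.sum_le_sum fun d _ => ?_)
        rw [abs_div, abs_of_nonneg (by positivity : (0 : ℝ) ≤ (d : ℝ) ^ 2), div_eq_mul_inv]
        have : |(moebius d : ℝ)| ≤ 1 := by
          exact_mod_cast abs_moebius_le_one
        calc _ ≤ 1 * ((d : ℝ) ^ 2)⁻¹ := by gcongr
          _ = _ := one_mul _
    _ ≤ (N : ℝ)⁻¹ - (M : ℝ)⁻¹ := sum_Ioc_inv_sq_le_sub (by omega) hM
    _ ≤ 1 / N := by
        rw [one_div]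
        have : (0 : ℝ) ≤ (M : ℝ)⁻¹ := by positivity
        linarith

-- In the Möbius formula, replacing each `⌊N / d⌋` by `N / d` costs at most half of `N / d`, hence a
-- harmonic sum. Completing the Möbius series to `1 / ζ(2) = 6 / π²` costs at most `N / 2`.
open ArithmeticFunction in
theorem abs_sum_totient_sub_le (N : ℕ) (hN : 1 ≤ N) :
    |∑ n ∈ Finset.Ioc 0 N, (Nat.totient n : ℝ) - 3 / Real.pi ^ 2 * (N : ℝ) ^ 2| ≤
      N * (2 + Real.log N) := by
  have hN0 : (0 : ℝ) < N := by exact_mod_cast hN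
  rw [sum_totient_eq_sum_moebius]
  have e1 : |∑ d ∈ Finset.Ioc 0 N, (moebius d : ℝ) * (((N / d : ℕ) : ℝ) * ((N / d : ℕ) + 1) / 2) -
      (N : ℝ) ^ 2 / 2 * ∑ d ∈ Finset.Ioc 0 N, (moebius d : ℝ) / (d : ℝ) ^ 2| ≤
      N / 2 * (1 + Real.log N) := by
    rw [Finset.mul_sum, ← Finset.sum_sub_distrib]
    have hH : ∑ d ∈ Finset.Ioc 0 N, (1 : ℝ) / d ≤ 1 + Real.log N := by
      have h := harmonic_le_one_add_log N
      rw [harmonic_eq_sum_Icc] at h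
      push_cast at h
      simp_rw [one_div]
      exact h
    calc _ ≤ ∑ d ∈ Finset.Ioc 0 N, (N : ℝ) / 2 * (1 / d) := by
          refine (Finset.abs_sum_le_sum_abs _ _).trans (Finset.sum_le_sum fun d hd => ?_)
          obtain ⟨hd0, hdN⟩ := Finset.mem_Ioc.mp hd
          have hd0' : (0 : ℝ) < d := by exact_mod_cast hd0
          have hm : |(moebius d : ℝ)| ≤ 1 := by exact_mod_cast abs_moebius_le_one
          have k1 : ((N / d : ℕ) : ℝ) ≤ N / d := Nat.cast_div_le
          have k2 : (N : ℝ) / d - 1 ≤ ((N / d : ℕ) : ℝ) := by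
            have : N < (N / d + 1) * d := by
              rw [mul_comm]; exact Nat.lt_mul_div_succ N hd0
            have : (N : ℝ) < (((N / d : ℕ) : ℝ) + 1) * d := by exact_mod_cast this
            rw [sub_le_iff_le_add, div_le_iff₀ hd0']
            exact this.le
          have k3 : (0 : ℝ) ≤ ((N / d : ℕ) : ℝ) := by positivity
          have : (moebius d : ℝ) * (((N / d : ℕ) : ℝ) * ((N / d : ℕ) + 1) / 2) -
              (N : ℝ) ^ 2 / 2 * ((moebius d : ℝ) / (d : ℝ) ^ 2) =
              (moebius d : ℝ) * ((((N / d : ℕ) : ℝ) * ((N / d : ℕ) + 1) - (N / d : ℝ) ^ 2) / 2) := by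
            field_simp
          rw [this, abs_mul]
          have h5 : |(((N / d : ℕ) : ℝ) * ((N / d : ℕ) + 1) - (N / d : ℝ) ^ 2) / 2| ≤
              (N : ℝ) / d / 2 := by
            rw [abs_le]
            constructor <;> nlinarith
          calc _ ≤ 1 * ((N : ℝ) / d / 2) := by gcongr
            _ = _ := by ring
      _ = N / 2 * ∑ d ∈ Finset.Ioc 0 N, (1 : ℝ) / d := by rw [Finset.mul_sum]
      _ ≤ _ := by gcongr
  have e2 : |(N : ℝ) ^ 2 / 2 * ∑ d ∈ Finset.Ioc 0 N, (moebius d : ℝ) / (d : ℝ) ^ 2 -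
      3 / Real.pi ^ 2 * (N : ℝ) ^ 2| ≤ (N : ℝ) / 2 := by
    have := abs_sum_moebius_div_sq_sub_le N hN
    have h : (N : ℝ) ^ 2 / 2 * ∑ d ∈ Finset.Ioc 0 N, (moebius d : ℝ) / (d : ℝ) ^ 2 -
      3 / Real.pi ^ 2 * (N : ℝ) ^ 2 = (N : ℝ) ^ 2 / 2 *
        (∑ d ∈ Finset.Ioc 0 N, (moebius d : ℝ) / (d : ℝ) ^ 2 - 6 / Real.pi ^ 2) := by ring
    rw [h, abs_mul, abs_of_nonneg (by positivity)]
    calc _ ≤ (N : ℝ) ^ 2 / 2 * (1 / N) := by gcongr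
      _ = _ := by field_simp
  have hlog : 0 ≤ Real.log N := Real.log_nonneg (by exact_mod_cast hN)
  refine (abs_sub_le _ _ _).trans ((add_le_add e1 e2).trans ?_)
  nlinarith [mul_nonneg hN0.le hlog]

/-- The logarithm is absorbed into a power. The exponent `7/4` is below `2`, so that there is a
saving, and above `3/2`, so that the error stays integrable once `R` is the cube root of `τ / (x (x
+ 1))`. The range `R < 1`, where the sum is empty, is needed in that integral. -/
theorem abs_sum_totient_floor_sub_le (R : ℝ) (hR : 0 ≤ R) :
    |∑ n ∈ Finset.Ioc 0 ⌊R⌋₊, (Nat.totient n : ℝ) - 3 / Real.pi ^ 2 * R ^ 2| ≤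
      12 * R ^ (7 / 4 : ℝ) := by
  have hpi : 3 / Real.pi ^ 2 ≤ 1 := by
    rw [div_le_one (by positivity)]
    nlinarith [Real.pi_gt_three]
  have hpi0 : 0 < 3 / Real.pi ^ 2 := by positivity
  rcases lt_or_ge R 1 with h | h
  · rw [Nat.floor_eq_zero.mpr h]
    simp only [Finset.Ioc_self, Finset.sum_empty, zero_sub, abs_neg]
    rw [abs_of_nonneg (by positivity)]
    have : R ^ 2 ≤ R ^ (7 / 4 : ℝ) := by
      rcases hR.eq_or_lt with rfl | hR'
      · simp
      · rw [← Real.rpow_natCast]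
        exact Real.rpow_le_rpow_of_exponent_ge hR' h.le (by norm_num)
    have h0 : 0 ≤ R ^ (7 / 4 : ℝ) := by positivity
    nlinarith [sq_nonneg R]
  · set N := ⌊R⌋₊ with hNdef
    have hN : 1 ≤ N := Nat.le_floor (by exact_mod_cast h)
    have hN1 : (1 : ℝ) ≤ N := by exact_mod_cast hN
    have hNR : (N : ℝ) ≤ R := Nat.floor_le hR
    have hRN : R < N + 1 := Nat.lt_floor_add_one R
    have h1 := abs_sum_totient_sub_le N hN
    have h2 : |3 / Real.pi ^ 2 * (N : ℝ) ^ 2 - 3 / Real.pi ^ 2 * R ^ 2| ≤ 3 * R := by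
      rw [← mul_sub, abs_mul, abs_of_pos hpi0, abs_sub_comm]
      have : |R ^ 2 - (N : ℝ) ^ 2| ≤ 3 * R := by
        rw [abs_of_nonneg (by nlinarith)]
        nlinarith
      calc _ ≤ 1 * (3 * R) := by gcongr
        _ = _ := one_mul _
    have hlog : Real.log N ≤ 4 / 3 * R ^ (3 / 4 : ℝ) := by
      have h3 := Real.log_le_rpow_div (x := R) hR (ε := 3 / 4) (by norm_num)
      have h4 : Real.log N ≤ Real.log R := Real.log_le_log (by linarith) hNR
      linarith
    have hlog0 : 0 ≤ Real.log N := Real.log_nonneg hN1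
    have hr1 : 1 ≤ R ^ (3 / 4 : ℝ) := Real.one_le_rpow h (by norm_num)
    have hpow : R ^ (7 / 4 : ℝ) = R * R ^ (3 / 4 : ℝ) := by
      rw [← Real.rpow_one_add' hR (by norm_num)]; norm_num
    calc _ ≤ N * (2 + Real.log N) + 3 * R := (abs_sub_le _ _ _).trans (add_le_add h1 h2)
      _ ≤ R * (2 + 4 / 3 * R ^ (3 / 4 : ℝ)) + 3 * R := by gcongr
      _ ≤ _ := by rw [hpow]; nlinarith

/-! ### The pronic integral and the weighted totient sum -/

/-- The positive root `x` of `x (x + 1) = w`. -/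
noncomputable def pronicRoot (w : ℝ) : ℝ := (Real.sqrt (1 + 4 * w) - 1) / 2

theorem pronicRoot_nonneg {w : ℝ} (hw : 0 ≤ w) : 0 ≤ pronicRoot w := by
  have : 1 ≤ Real.sqrt (1 + 4 * w) := Real.one_le_sqrt.mpr (by linarith)
  unfold pronicRoot; linarith

theorem pronicRoot_mul {w : ℝ} (hw : 0 ≤ w) : pronicRoot w * (pronicRoot w + 1) = w := by
  have := Real.sq_sqrt (show 0 ≤ 1 + 4 * w by linarith)
  unfold pronicRoot; nlinarith

theorem le_pronicRoot_iff {w x : ℝ} (hw : 0 ≤ w) (hx : 0 ≤ x) :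
    x ≤ pronicRoot w ↔ x * (x + 1) ≤ w := by
  have h1 := pronicRoot_mul hw
  have h2 := pronicRoot_nonneg hw
  constructor
  · intro h; nlinarith
  · intro h; by_contra! h3; nlinarith

theorem pronicRoot_le_sqrt {w : ℝ} (hw : 0 ≤ w) : pronicRoot w ≤ Real.sqrt w := by
  apply Real.le_sqrt_of_sq_le
  have h1 := pronicRoot_mul hw
  have h2 := pronicRoot_nonneg hw
  nlinarith

/-- The constant `∫_1^∞ (x (x + 1)) ^ (-2 / 3) dx`. -/
noncomputable def pronicIntegral : ℝ := ∫ x in Ioi (1 : ℝ), (x * (x + 1)) ^ (-(2 / 3) : ℝ)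

theorem integrableOn_pronic_rpow {p : ℝ} (hp : 1 / 2 < p) :
    MeasureTheory.IntegrableOn (fun x : ℝ => (x * (x + 1)) ^ (-p)) (Ioi 1) := by
  have h := integrableOn_Ioi_rpow_of_lt (show -(2 * p) < -1 by linarith) (zero_lt_one (α := ℝ))
  refine MeasureTheory.Integrable.mono' h ?_ ?_
  · refine ContinuousOn.aestronglyMeasurable ?_ measurableSet_Ioi
    refine ContinuousOn.rpow_const (by fun_prop) fun x hx => Or.inl ?_
    have : (1 : ℝ) < x := hx
    positivity
  · filter_upwards [MeasureTheory.ae_restrict_mem measurableSet_Ioi] with x hx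
    have hx1 : (1 : ℝ) < x := hx
    rw [Real.norm_of_nonneg (by positivity)]
    calc (x * (x + 1)) ^ (-p) ≤ (x ^ 2) ^ (-p) :=
          Real.rpow_le_rpow_of_nonpos (by positivity) (by nlinarith) (by linarith)
      _ = x ^ (-(2 * p)) := by
          rw [← Real.rpow_natCast, ← Real.rpow_mul (by linarith)]
          congr 1; push_cast; ring

/-- The substitution `u = 1 / (1 + x)` turns the integrand into `(u (1 - u)) ^ (-2/3)` on `(0,
1/2)`, half of a symmetric Beta integral. The reflection formula then removes `Γ(2/3)`. -/
theorem pronicIntegral_eq :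
    pronicIntegral = Real.sqrt 3 / (4 * Real.pi) * Real.Gamma (1 / 3) ^ 3 := by
  have hbeta : ∫ u in (0 : ℝ)..1, (u * (1 - u)) ^ (-(2 / 3) : ℝ) =
      Real.Gamma (1 / 3) * Real.Gamma (1 / 3) / Real.Gamma (2 / 3) := by
    have h := ProbabilityTheory.beta_eq_betaIntegralReal (1 / 3) (1 / 3) (by norm_num) (by norm_num)
    rw [ProbabilityTheory.beta] at h
    norm_num at h
    norm_num
    rw [h, Complex.betaIntegral]
    have : ∫ x in (0 : ℝ)..1, ((x : ℂ) ^ ((1 / 3 : ℂ) - 1) * (1 - (x : ℂ)) ^ ((1 / 3 : ℂ) - 1)) =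
        ((∫ u in (0 : ℝ)..1, (u * (1 - u)) ^ (-(2 / 3) : ℝ) : ℝ) : ℂ) := by
      rw [← intervalIntegral.integral_ofReal]
      refine intervalIntegral.integral_congr fun u hu => ?_
      rw [uIcc_of_le zero_le_one] at hu
      rw [Real.mul_rpow hu.1 (by linarith [hu.2]), Complex.ofReal_mul,
        Complex.ofReal_cpow hu.1, Complex.ofReal_cpow (by linarith [hu.2])]
      push_cast
      norm_num
    norm_num at this ⊢
    rw [this, Complex.ofReal_re]
  -- A non-integrable function has integral `0` by convention, which the positive Beta value
  -- excludes.
  have hint : IntervalIntegrable (fun u : ℝ => (u * (1 - u)) ^ (-(2 / 3) : ℝ))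
      MeasureTheory.volume 0 1 := by
    by_contra hcon
    rw [intervalIntegral.integral_undef hcon] at hbeta
    have : 0 < Real.Gamma (1 / 3) * Real.Gamma (1 / 3) / Real.Gamma (2 / 3) := by
      have h1 := Real.Gamma_pos_of_pos (show (0 : ℝ) < 1 / 3 by norm_num)
      have h2 := Real.Gamma_pos_of_pos (show (0 : ℝ) < 2 / 3 by norm_num)
      positivity
    linarith
  have hhalf : ∫ u in (0 : ℝ)..1, (u * (1 - u)) ^ (-(2 / 3) : ℝ) =
      2 * ∫ u in (0 : ℝ)..(1 / 2), (u * (1 - u)) ^ (-(2 / 3) : ℝ) := by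
    have hs : ∫ u in (1 / 2 : ℝ)..1, (u * (1 - u)) ^ (-(2 / 3) : ℝ) =
        ∫ u in (0 : ℝ)..(1 / 2), (u * (1 - u)) ^ (-(2 / 3) : ℝ) := by
      have := intervalIntegral.integral_comp_sub_left (a := (0 : ℝ)) (b := 1 / 2)
        (fun u : ℝ => (u * (1 - u)) ^ (-(2 / 3) : ℝ)) 1
      norm_num at this ⊢
      rw [← this]
      refine intervalIntegral.integral_congr fun u _ => ?_
      rw [mul_comm]
    rw [← intervalIntegral.integral_add_adjacent_intervals (b := 1 / 2)
      (hint.mono_set ?_) (hint.mono_set ?_), hs]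
    · ring
    · rw [uIcc_of_le (by norm_num), uIcc_of_le (by norm_num)]
      exact Icc_subset_Icc le_rfl (by norm_num)
    · rw [uIcc_of_le (by norm_num), uIcc_of_le (by norm_num)]
      exact Icc_subset_Icc (by norm_num) le_rfl
  have hsub : pronicIntegral = ∫ u in (0 : ℝ)..(1 / 2), (u * (1 - u)) ^ (-(2 / 3) : ℝ) := by
    have himage : (fun x : ℝ => 1 / (1 + x)) '' Ioi 1 = Ioo 0 (1 / 2) := by
      ext u
      constructor
      · rintro ⟨x, hx, rfl⟩
        have hx : (1 : ℝ) < x := hx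
        refine ⟨by positivity, ?_⟩
        exact one_div_lt_one_div_of_lt (by norm_num) (by linarith)
      · rintro ⟨h0, h1⟩
        refine ⟨1 / u - 1, ?_, by simp⟩
        have : 2 < 1 / u := by rw [lt_div_iff₀ h0]; linarith
        show 1 < 1 / u - 1
        linarith
    have hcv := MeasureTheory.integral_image_eq_integral_abs_deriv_smul (s := Ioi (1 : ℝ))
      (f := fun x : ℝ => 1 / (1 + x)) (f' := fun x => -1 / (1 + x) ^ 2) measurableSet_Ioi
      (fun x hx => by
        have hx : (1 : ℝ) < x := hx
        have h := ((hasDerivAt_id x).const_add 1).inv (by simp; linarith)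
        simp only [id] at h
        have h' : HasDerivAt (fun x : ℝ => 1 / (1 + x)) (-1 / (1 + x) ^ 2) x := by
          simp only [one_div]
          exact h
        exact h'.hasDerivWithinAt)
      (by
        intro x hx y hy hxy
        have hx : (1 : ℝ) < x := hx
        have hy : (1 : ℝ) < y := hy
        simp only [one_div, inv_inj] at hxy
        linarith)
      (fun u : ℝ => (u * (1 - u)) ^ (-(2 / 3) : ℝ))
    rw [himage] at hcv
    rw [intervalIntegral.integral_of_le (by norm_num), MeasureTheory.integral_Ioc_eq_integral_Ioo,
      hcv, pronicIntegral]
    refine MeasureTheory.setIntegral_congr_fun measurableSet_Ioi fun x hx => ?_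
    have hx : (1 : ℝ) < x := hx
    have hx0 : (0 : ℝ) < x := by linarith
    have hx1 : (0 : ℝ) < 1 + x := by linarith
    have e1 : 1 / (1 + x) * (1 - 1 / (1 + x)) = (x * (x + 1)) * ((1 + x) ^ 3)⁻¹ := by
      field_simp
      ring
    have e2 : (((1 + x) ^ 3)⁻¹) ^ (-(2 / 3) : ℝ) = (1 + x) ^ 2 := by
      rw [Real.inv_rpow (by positivity), ← Real.rpow_neg (by positivity), ← Real.rpow_natCast,
        ← Real.rpow_mul hx1.le, ← Real.rpow_natCast]
      norm_num
    simp only [smul_eq_mul]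
    rw [e1, Real.mul_rpow (x := x * (x + 1)) (by positivity) (by positivity), e2, abs_div, abs_neg, abs_one,
      abs_of_pos (by positivity)]
    field_simp
  have hrefl : Real.Gamma (1 / 3) * Real.Gamma (2 / 3) = 2 * Real.pi / Real.sqrt 3 := by
    have := Real.Gamma_mul_Gamma_one_sub (1 / 3)
    rw [show Real.pi * (1 / 3) = Real.pi / 3 by ring, Real.sin_pi_div_three] at this
    norm_num at this ⊢
    rw [this]
    field_simp
  have hG1 := Real.Gamma_pos_of_pos (show (0 : ℝ) < 1 / 3 by norm_num)
  have hG2 := Real.Gamma_pos_of_pos (show (0 : ℝ) < 2 / 3 by norm_num)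
  have h3 : (0 : ℝ) < Real.sqrt 3 := by positivity
  have hpi := Real.pi_pos
  have e : pronicIntegral = Real.Gamma (1 / 3) * Real.Gamma (1 / 3) / Real.Gamma (2 / 3) / 2 := by
    rw [hsub]; linarith
  rw [e]
  field_simp at hrefl ⊢
  linear_combination (-2) * hrefl

theorem le_cube_root_iff {x y : ℝ} (hx : 0 ≤ x) (hy : 0 ≤ y) : x ≤ y ^ (1 / 3 : ℝ) ↔ x ^ 3 ≤ y := by
  have h : (y ^ (1 / 3 : ℝ)) ^ 3 = y := by
    rw [← Real.rpow_natCast, ← Real.rpow_mul hy]; norm_num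
  conv_rhs => rw [← h]
  exact (pow_le_pow_iff_left₀ hx (by positivity) (by norm_num)).symm

/-- Asymptotics of `∑ φ(B) (x_B - 1)⁺`, where `B³ x_B (x_B + 1) = τ`. -/
theorem exists_abs_sum_totient_pronicRoot_sub_le :
    ∃ C : ℝ, 0 ≤ C ∧ ∀ (τ : ℝ) (N : ℕ), 0 ≤ τ → τ ≤ (N : ℝ) ^ 3 →
      |∑ B ∈ Finset.Ioc 0 N, (Nat.totient B : ℝ) * max (pronicRoot (τ / (B : ℝ) ^ 3) - 1) 0 -
        3 / Real.pi ^ 2 * pronicIntegral * τ ^ (2 / 3 : ℝ)| ≤ C * τ ^ (7 / 12 : ℝ) := by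
  have hI1 := integrableOn_pronic_rpow (p := 7 / 12) (by norm_num)
  have hI2 := integrableOn_pronic_rpow (p := 2 / 3) (by norm_num)
  -- Layer cake: `(x_B - 1)⁺` is the integral over `x > 1` of the indicator of `x ≤ x_B`, and this
  -- condition reads `B ≤ (τ / (x (x + 1))) ^ (1/3)`. Exchanging sum and integral leaves totient
  -- sums, whose error exponent `7/4` becomes `7/12`.
  refine ⟨12 * ∫ x in Ioi (1 : ℝ), (x * (x + 1)) ^ (-(7 / 12) : ℝ), ?_, fun τ N hτ hN => ?_⟩
  · have : 0 ≤ ∫ x in Ioi (1 : ℝ), (x * (x + 1)) ^ (-(7 / 12) : ℝ) := by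
      refine MeasureTheory.setIntegral_nonneg measurableSet_Ioi fun x hx => ?_
      have : (1 : ℝ) < x := hx
      positivity
    positivity
  have hset : ∀ B ∈ Finset.Ioc 0 N, {x : ℝ | 1 < x ∧ x ≤ pronicRoot (τ / (B : ℝ) ^ 3)} =
      {x : ℝ | 1 < x ∧ B ≤ ⌊(τ / (x * (x + 1))) ^ (1 / 3 : ℝ)⌋₊} := by
    intro B hB
    have hB0 : (0 : ℝ) < B := by exact_mod_cast (Finset.mem_Ioc.mp hB).1
    ext x
    simp only [Set.mem_ofPred_eq]
    refine and_congr_right fun hx => ?_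
    have hx0 : (0 : ℝ) < x * (x + 1) := by positivity
    rw [Nat.le_floor_iff (by positivity), le_cube_root_iff hB0.le (by positivity),
      le_pronicRoot_iff (by positivity) (by linarith), le_div_iff₀ (by positivity),
      le_div_iff₀ hx0, mul_comm]
  have hsum : ∀ x : ℝ, 1 < x → ∑ B ∈ Finset.Ioc 0 N, (Nat.totient B : ℝ) *
      (if B ≤ ⌊(τ / (x * (x + 1))) ^ (1 / 3 : ℝ)⌋₊ then 1 else 0) =
      ∑ B ∈ Finset.Ioc 0 ⌊(τ / (x * (x + 1))) ^ (1 / 3 : ℝ)⌋₊, (Nat.totient B : ℝ) := by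
    intro x hx
    -- Since `x (x + 1) ≥ 1` and `τ ≤ N ^ 3`, truncating the sum at `N` loses nothing.
    have hle : ⌊(τ / (x * (x + 1))) ^ (1 / 3 : ℝ)⌋₊ ≤ N := by
      refine Nat.floor_le_of_le ?_
      have hx0 : (1 : ℝ) ≤ x * (x + 1) := by nlinarith
      have h1 : (τ / (x * (x + 1))) ≤ (N : ℝ) ^ 3 := (div_le_self hτ hx0).trans hN
      calc (τ / (x * (x + 1))) ^ (1 / 3 : ℝ) ≤ ((N : ℝ) ^ 3) ^ (1 / 3 : ℝ) := by gcongr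
        _ = N := by
          rw [← Real.rpow_natCast, ← Real.rpow_mul (by positivity)]; norm_num
    simp only [mul_ite, mul_one, mul_zero]
    rw [← Finset.sum_filter]
    refine Finset.sum_congr ?_ fun _ _ => rfl
    ext B
    simp only [Finset.mem_filter, Finset.mem_Ioc]
    constructor
    · rintro ⟨⟨h1, _⟩, h3⟩; exact ⟨h1, h3⟩
    · rintro ⟨h1, h2⟩; exact ⟨⟨h1, h2.trans hle⟩, h2⟩
  have hmeas : ∀ B : ℕ, MeasurableSet {x : ℝ | 1 < x ∧ x ≤ pronicRoot (τ / (B : ℝ) ^ 3)} :=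
    fun B => measurableSet_Ioc
  have hterm : ∀ B : ℕ, ∫ x in Ioi (1 : ℝ),
      ({x : ℝ | 1 < x ∧ x ≤ pronicRoot (τ / (B : ℝ) ^ 3)}.indicator (fun _ => (1 : ℝ)) x) =
      max (pronicRoot (τ / (B : ℝ) ^ 3) - 1) 0 := by
    intro B
    rw [MeasureTheory.setIntegral_indicator (hmeas B)]
    have : Ioi (1 : ℝ) ∩ {x : ℝ | 1 < x ∧ x ≤ pronicRoot (τ / (B : ℝ) ^ 3)} =
        Ioc 1 (pronicRoot (τ / (B : ℝ) ^ 3)) := by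
      ext x; simp
    rw [this]
    simp [max_comm]
  have hint : ∀ B : ℕ, MeasureTheory.IntegrableOn
      (fun x : ℝ => {x : ℝ | 1 < x ∧ x ≤ pronicRoot (τ / (B : ℝ) ^ 3)}.indicator
        (fun _ => (1 : ℝ)) x) (Ioi 1) := by
    intro B
    have hfin : MeasureTheory.volume {x : ℝ | 1 < x ∧ x ≤ pronicRoot (τ / (B : ℝ) ^ 3)} ≠ ⊤ :=
      (measure_Ioc_lt_top (a := (1 : ℝ)) (b := pronicRoot (τ / (B : ℝ) ^ 3))).ne
    exact ((MeasureTheory.integrable_indicator_iff (hmeas B)).mpr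
      (MeasureTheory.integrableOn_const hfin)).integrableOn
  have hrepr : ∑ B ∈ Finset.Ioc 0 N, (Nat.totient B : ℝ) *
      max (pronicRoot (τ / (B : ℝ) ^ 3) - 1) 0 = ∫ x in Ioi (1 : ℝ),
      ∑ B ∈ Finset.Ioc 0 ⌊(τ / (x * (x + 1))) ^ (1 / 3 : ℝ)⌋₊, (Nat.totient B : ℝ) := by
    simp_rw [← hterm, ← MeasureTheory.integral_const_mul]
    rw [← MeasureTheory.integral_finsetSum _ fun B _ => (hint B).const_mul _]
    refine MeasureTheory.setIntegral_congr_fun measurableSet_Ioi fun x hx => ?_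
    rw [← hsum x hx]
    refine Finset.sum_congr rfl fun B hB => ?_
    rw [hset B hB]
    congr 1
    have hx' : 1 < x := hx
    simp [Set.indicator_apply, hx']
  have hpow : ∀ x : ℝ, 1 < x → ((τ / (x * (x + 1))) ^ (1 / 3 : ℝ)) ^ 2 =
      τ ^ (2 / 3 : ℝ) * (x * (x + 1)) ^ (-(2 / 3) : ℝ) := by
    intro x hx
    have hx0 : (0 : ℝ) ≤ x * (x + 1) := by positivity
    rw [← Real.rpow_natCast, ← Real.rpow_mul (by positivity), Real.div_rpow hτ hx0,
      Real.rpow_neg hx0]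
    norm_num
    rw [div_eq_mul_inv]
  have hpow' : ∀ x : ℝ, 1 < x → ((τ / (x * (x + 1))) ^ (1 / 3 : ℝ)) ^ (7 / 4 : ℝ) =
      τ ^ (7 / 12 : ℝ) * (x * (x + 1)) ^ (-(7 / 12) : ℝ) := by
    intro x hx
    have hx0 : (0 : ℝ) ≤ x * (x + 1) := by positivity
    rw [← Real.rpow_mul (by positivity), Real.div_rpow hτ hx0, Real.rpow_neg hx0]
    norm_num
    rw [div_eq_mul_inv]
  have hmain : 3 / Real.pi ^ 2 * pronicIntegral * τ ^ (2 / 3 : ℝ) =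
      ∫ x in Ioi (1 : ℝ), 3 / Real.pi ^ 2 * (τ ^ (2 / 3 : ℝ) * (x * (x + 1)) ^ (-(2 / 3) : ℝ)) := by
    rw [MeasureTheory.integral_const_mul, MeasureTheory.integral_const_mul, pronicIntegral]
    ring
  have hint2 : MeasureTheory.IntegrableOn (fun x : ℝ =>
      ∑ B ∈ Finset.Ioc 0 ⌊(τ / (x * (x + 1))) ^ (1 / 3 : ℝ)⌋₊, (Nat.totient B : ℝ)) (Ioi 1) := by
    have h : MeasureTheory.IntegrableOn (fun x : ℝ => ∑ B ∈ Finset.Ioc 0 N, (Nat.totient B : ℝ) *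
        {x : ℝ | 1 < x ∧ x ≤ pronicRoot (τ / (B : ℝ) ^ 3)}.indicator
        (fun _ => (1 : ℝ)) x) (Ioi 1) :=
      MeasureTheory.integrable_finsetSum _ fun B _ => (hint B).const_mul _
    refine h.congr_fun (fun x hx => ?_) measurableSet_Ioi
    simp only
    rw [← hsum x hx]
    refine Finset.sum_congr rfl fun B hB => ?_
    rw [hset B hB]
    congr 1
    have hx' : 1 < x := hx
    simp [Set.indicator_apply, hx']
  rw [hrepr, hmain, ← MeasureTheory.integral_sub hint2 ((hI2.const_mul _).const_mul _)]
  rw [← Real.norm_eq_abs]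
  calc _ ≤ ∫ x in Ioi (1 : ℝ), 12 * (τ ^ (7 / 12 : ℝ) * (x * (x + 1)) ^ (-(7 / 12) : ℝ)) := by
        refine MeasureTheory.norm_integral_le_of_norm_le ((hI1.const_mul _).const_mul _) ?_
        filter_upwards [MeasureTheory.ae_restrict_mem measurableSet_Ioi] with x hx
        have hx1 : (1 : ℝ) < x := hx
        rw [← hpow x hx1, ← hpow' x hx1]
        exact abs_sum_totient_floor_sub_le _ (by positivity)
    _ = _ := by
        rw [MeasureTheory.integral_const_mul, MeasureTheory.integral_const_mul]
        ring


/-! ### Unimodular pairs with given first height -/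

namespace UnimodularQuad

/-- The sum of the coordinates of the first vector of a unimodular pair. -/
def fstHeight (q : UnimodularQuad) : ℕ := q.1.1 + q.1.2.1

/-- The sum of the coordinates of the second vector of a unimodular pair. -/
def sndHeight (q : UnimodularQuad) : ℕ := q.1.2.2.1 + q.1.2.2.2

/-- The determinant condition in the coordinates `(a, B, c, D)`: the entry `a` is inverse to `D`
modulo `B`, which leads to Kloosterman sums. -/
theorem fst_mul_sndHeight (q : UnimodularQuad) :
    q.1.1 * q.sndHeight = q.fstHeight * q.1.2.2.1 + 1 := by
  have h := q.2
  unfold fstHeight sndHeight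
  zify
  linear_combination h

theorem fstHeight_pos (q : UnimodularQuad) : 0 < q.fstHeight := by
  have h := q.2
  by_contra h0
  have h1 : q.1.1 = 0 := by unfold fstHeight at h0; omega
  have h2 : q.1.2.1 = 0 := by unfold fstHeight at h0; omega
  simp [h1, h2] at h

theorem sndHeight_pos (q : UnimodularQuad) : 0 < q.sndHeight := by
  have h := q.2
  by_contra h0
  have h1 : q.1.2.2.1 = 0 := by unfold sndHeight at h0; omega
  have h2 : q.1.2.2.2 = 0 := by unfold sndHeight at h0; omega
  simp [h1, h2] at h

/-- A unimodular pair is determined by its heights and the first coordinate. -/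
theorem ext_of_heights {q q' : UnimodularQuad} (ha : q.1.1 = q'.1.1)
    (hB : q.fstHeight = q'.fstHeight) (hD : q.sndHeight = q'.sndHeight) : q = q' := by
  have h1 := q.fst_mul_sndHeight
  have h2 := q'.fst_mul_sndHeight
  rw [ha, hB, hD, h2] at h1
  have hc : q.1.2.2.1 = q'.1.2.2.1 :=
    Nat.eq_of_mul_eq_mul_left q'.fstHeight_pos (by omega)
  obtain ⟨⟨a, b, c, d⟩, h⟩ := q
  obtain ⟨⟨a', b', c', d'⟩, h'⟩ := q'
  simp only [fstHeight, sndHeight] at *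
  subst ha hc
  have hb : b = b' := by omega
  have hd : d = d' := by omega
  subst hb hd
  rfl

theorem exists_of_mul_eq (a B c D : ℕ) (h : a * D = B * c + 1) (ha : a ≤ B) (hc : c ≤ D) :
    ∃ q : UnimodularQuad, q.1.1 = a ∧ q.fstHeight = B ∧ q.sndHeight = D := by
  refine ⟨⟨(a, B - a, c, D - c), ?_⟩, rfl, ?_, ?_⟩
  · push_cast [ha, hc]
    zify at h
    linear_combination h
  · simp only [fstHeight]; omega
  · simp only [sndHeight]; omega

/-- The product `B D (B + D)` of the three heights attached to a unimodular pair. -/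
def volume (q : UnimodularQuad) : ℝ :=
  (q.fstHeight : ℝ) * q.sndHeight * (q.fstHeight + q.sndHeight)

theorem volume_pos (q : UnimodularQuad) : 0 < q.volume := by
  have h1 : (0 : ℝ) < q.fstHeight := by exact_mod_cast q.fstHeight_pos
  have h2 : (0 : ℝ) < q.sndHeight := by exact_mod_cast q.sndHeight_pos
  unfold volume; positivity

theorem finite_volume_le (τ : ℝ) : {q : UnimodularQuad | q.volume ≤ τ}.Finite := by
  have hsub : {q : UnimodularQuad | q.volume ≤ τ} ⊆
      Subtype.val ⁻¹' (Set.Iic (⌊τ⌋₊, ⌊τ⌋₊, ⌊τ⌋₊, ⌊τ⌋₊) : Set (ℕ × ℕ × ℕ × ℕ)) := by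
    intro q hq
    have hq : q.volume ≤ τ := hq
    have h1 : (1 : ℝ) ≤ q.fstHeight := by exact_mod_cast q.fstHeight_pos
    have h2 : (1 : ℝ) ≤ q.sndHeight := by exact_mod_cast q.sndHeight_pos
    have h4 : (q.fstHeight : ℝ) + q.sndHeight ≤ τ := by
      refine le_trans ?_ hq
      unfold volume
      have : (1 : ℝ) ≤ q.fstHeight * q.sndHeight := by nlinarith
      nlinarith
    have hB : q.fstHeight ≤ ⌊τ⌋₊ := Nat.le_floor (by linarith)
    have hD : q.sndHeight ≤ ⌊τ⌋₊ := Nat.le_floor (by linarith)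
    simp only [fstHeight, sndHeight] at hB hD
    show q.1 ≤ (⌊τ⌋₊, ⌊τ⌋₊, ⌊τ⌋₊, ⌊τ⌋₊)
    exact ⟨by simp; omega, by simp; omega, by simp; omega, by simp; omega⟩
  exact ((Set.finite_Iic _).preimage Subtype.val_injective.injOn).subset hsub

/-- The pairs of first height `B`, second height larger than `B`, volume at most `τ`, and first
slope in the `i`-th of `J` equal intervals. -/
def halfFiber (J B i : ℕ) (τ : ℝ) : Set UnimodularQuad :=
  {q | q.fstHeight = B ∧ B < q.sndHeight ∧ q.volume ≤ τ ∧ J * q.1.1 / B = i}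

theorem finite_halfFiber (J B i : ℕ) (τ : ℝ) : (halfFiber J B i τ).Finite :=
  (finite_volume_le τ).subset fun _ hq => hq.2.2.1

/-- The smallest `a` with `i B ≤ J a`. -/
def fiberStart (J B i : ℕ) : ℕ := (i * B + J - 1) / J

theorem fiberStart_le_iff {J B i a : ℕ} (hJ : 1 ≤ J) : fiberStart J B i ≤ a ↔ i * B ≤ J * a := by
  unfold fiberStart
  rw [← Nat.lt_succ_iff, Nat.div_lt_iff_lt_mul hJ, Nat.succ_mul, mul_comm a J]
  omega

theorem div_eq_iff_fiberStart {J B i a : ℕ} (hJ : 1 ≤ J) (hB : 0 < B) :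
    J * a / B = i ↔ fiberStart J B i ≤ a ∧ a < fiberStart J B (i + 1) := by
  rw [fiberStart_le_iff hJ, ← not_le, fiberStart_le_iff hJ, Nat.div_eq_iff hB, not_le, Nat.succ_mul]
  omega

/-- For `D > B` the volume condition reads `D / B ≤ x_B` with `B³ x_B (x_B + 1) = τ`. So `D` runs
over an interval starting at `B + 1`, and `a` over the interval cut out by its slope. -/
theorem ncard_halfFiber_eq (J B i : ℕ) (τ : ℝ) (hJ : 1 ≤ J) (hJB : J < B) (hi : i < J)
    (hτ : 0 ≤ τ) :
    (halfFiber J B i τ).ncard = inverseCount B (fiberStart J B i)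
      (fiberStart J B (i + 1) - fiberStart J B i) (B + 1)
      ⌊B * max (pronicRoot (τ / (B : ℝ) ^ 3) - 1) 0⌋₊ := by
  have hB : 0 < B := by omega
  have hB0 : (0 : ℝ) < B := by exact_mod_cast hB
  set y := max (pronicRoot (τ / (B : ℝ) ^ 3) - 1) 0 with hy
  have hvol : ∀ D : ℕ, B < D → ((B : ℝ) * D * (B + D) ≤ τ ↔ D - B - 1 < ⌊B * y⌋₊) := by
    intro D hD
    have hDB : (B : ℝ) < D := by exact_mod_cast hD
    have h1 : D - B - 1 < ⌊B * y⌋₊ ↔ (D : ℝ) - B ≤ B * y := by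
      rw [show D - B - 1 < ⌊B * y⌋₊ ↔ D - B ≤ ⌊B * y⌋₊ by omega,
        Nat.le_floor_iff (by positivity), Nat.cast_sub hD.le]
    have h2 : (D : ℝ) - B ≤ B * y ↔ (D : ℝ) / B ≤ pronicRoot (τ / (B : ℝ) ^ 3) := by
      have e : (D : ℝ) = B * (D / B) := by field_simp
      have h1 : 1 < (D : ℝ) / B := by rwa [one_lt_div hB0]
      constructor
      · intro h
        have : (D : ℝ) / B - 1 ≤ y := by
          rw [e] at h; nlinarith
        rcases le_max_iff.mp this with h | h <;> linarith
      · intro h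
        have : (D : ℝ) / B - 1 ≤ y := le_max_of_le_left (by linarith)
        rw [e]; nlinarith
    rw [h1, h2, le_pronicRoot_iff (by positivity) (by positivity), le_div_iff₀ (by positivity)]
    have : (D : ℝ) / B * (D / B + 1) * (B : ℝ) ^ 3 = B * D * (B + D) := by field_simp; ring
    rw [this]
  rw [inverseCount, ← Set.ncard_coe_finset]
  refine Set.ncard_congr (fun q _ => (q.1.1 - fiberStart J B i, q.sndHeight - B - 1)) ?_ ?_ ?_
  · rintro q ⟨h1, h2, h3, h4⟩
    rw [div_eq_iff_fiberStart hJ hB] at h4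
    rw [volume, h1, hvol _ h2] at h3
    simp only [Finset.coe_filter, Set.mem_ofPred_eq, Finset.mem_product, Finset.mem_range]
    refine ⟨⟨by omega, h3⟩, ?_⟩
    rw [show fiberStart J B i + (q.1.1 - fiberStart J B i) = q.1.1 by omega,
      show B + 1 + (q.sndHeight - B - 1) = q.sndHeight by omega, ← Nat.cast_mul,
      fst_mul_sndHeight, h1]
    simp
  · rintro q q' ⟨h1, h2, h3, h4⟩ ⟨h1', h2', h3', h4'⟩ h
    rw [div_eq_iff_fiberStart hJ hB] at h4 h4'
    simp only [Prod.mk.injEq] at h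
    exact ext_of_heights (by omega) (by omega) (by omega)
  · rintro ⟨x, k⟩ h
    simp only [Finset.coe_filter, Set.mem_ofPred_eq, Finset.mem_product, Finset.mem_range] at h
    obtain ⟨⟨hx, hk⟩, h⟩ := h
    set a := fiberStart J B i + x with ha
    have haB : J * a / B = i := by rw [div_eq_iff_fiberStart hJ hB]; omega
    have haB' : a < B := by
      have h1 : J * a / B < J := by omega
      rw [Nat.div_lt_iff_lt_mul hB] at h1
      exact Nat.lt_of_mul_lt_mul_left h1
    -- Here `1 ≤ J < B` forces `B ≥ 2`, so that the residue class of `1` is represented by `1`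
    -- itself.
    have hmod : (a * (B + 1 + k)) % B = 1 := by
      have h' : ((a * (B + 1 + k) : ℕ) : ZMod B) = ((1 : ℕ) : ZMod B) := by
        rw [Nat.cast_mul, h, Nat.cast_one]
      rw [ZMod.natCast_eq_natCast_iff'] at h'
      rw [h', Nat.mod_eq_of_lt (by omega)]
    have hc := Nat.div_add_mod (a * (B + 1 + k)) B
    rw [hmod] at hc
    have hcD : a * (B + 1 + k) / B ≤ B + 1 + k := by
      refine Nat.div_le_of_le_mul ?_
      exact Nat.mul_le_mul_right _ haB'.le
    obtain ⟨q, q1, q2, q3⟩ := exists_of_mul_eq a B _ _ hc.symm haB'.le hcD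
    refine ⟨q, ⟨q2, by omega, ?_, by rw [q1]; exact haB⟩, ?_⟩
    · rw [volume, q2, q3, hvol _ (by omega)]
      omega
    · rw [q1, q3, Prod.mk.injEq]
      omega

/-- The two sides of the box have lengths within `1` of `B / J` and `B y`. Multiplied by the density
`φ(B) / B² ≤ 1 / B`, this rounding changes the main term by at most `1 + y`. -/
theorem exists_abs_ncard_halfFiber_sub_le :
    ∃ C : ℝ, 0 ≤ C ∧ ∀ (J B i : ℕ) (τ : ℝ), 1 ≤ J → J < B → i < J → 0 ≤ τ →
      |((halfFiber J B i τ).ncard : ℝ) -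
        (Nat.totient B : ℝ) * max (pronicRoot (τ / (B : ℝ) ^ 3) - 1) 0 / J| ≤
      C * (B : ℝ) ^ (4 / 5 : ℝ) * (1 + max (pronicRoot (τ / (B : ℝ) ^ 3) - 1) 0) := by
  obtain ⟨C, hC, h⟩ := exists_abs_inverseCount_sub_le
  refine ⟨C + 1, by linarith, fun J B i τ hJ hJB hi hτ => ?_⟩
  have hB : 0 < B := by omega
  have hB0 : (0 : ℝ) < B := by exact_mod_cast hB
  have hB1 : (1 : ℝ) ≤ B := by exact_mod_cast hB
  have hJ0 : (0 : ℝ) < J := by exact_mod_cast hJ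
  have hJ1 : (1 : ℝ) ≤ J := by exact_mod_cast hJ
  rw [ncard_halfFiber_eq J B i τ hJ hJB hi hτ]
  set y := max (pronicRoot (τ / (B : ℝ) ^ 3) - 1) 0
  have hy0 : 0 ≤ y := le_max_right _ _
  set p := fiberStart J B i
  set p' := fiberStart J B (i + 1)
  set K := ⌊B * y⌋₊ with hK
  have hK1 : (K : ℝ) ≤ B * y := Nat.floor_le (by positivity)
  have hK2 : B * y < K + 1 := Nat.lt_floor_add_one _
  have hp1 : (i : ℝ) * B ≤ J * p := by
    exact_mod_cast (fiberStart_le_iff hJ).mp le_rfl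
  have hp1' : ((i : ℝ) + 1) * B ≤ J * p' := by
    exact_mod_cast (fiberStart_le_iff hJ).mp (le_refl p')
  have hlt : ∀ i, J * fiberStart J B i < i * B + J := by
    intro i
    have := Nat.div_mul_le_self (i * B + J - 1) J
    unfold fiberStart
    rw [mul_comm]; omega
  have hp2 : (J : ℝ) * p < i * B + J := by exact_mod_cast hlt i
  have hp2' : (J : ℝ) * p' < (i + 1) * B + J := by exact_mod_cast hlt (i + 1)
  have hpp : p ≤ p' := by
    rw [fiberStart_le_iff hJ]
    refine le_trans ?_ ((fiberStart_le_iff hJ).mp (le_refl p'))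
    exact Nat.mul_le_mul_right _ (Nat.le_succ i)
  have hp'B : p' ≤ B := by
    rw [fiberStart_le_iff hJ]
    exact Nat.mul_le_mul_right _ hi
  have hL : |((p' - p : ℕ) : ℝ) - B / J| ≤ 1 := by
    rw [Nat.cast_sub hpp, abs_le]
    have e : (B : ℝ) / J * J = B := by field_simp
    constructor <;> nlinarith
  have hLB : ((p' - p : ℕ) : ℝ) ≤ B := by exact_mod_cast (by omega : p' - p ≤ B)
  have h1 := h B p (p' - p) (B + 1) K hB (by omega)
  have hφ : (Nat.totient B : ℝ) ≤ B := by exact_mod_cast Nat.totient_le B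
  have h2 : |(Nat.totient B : ℝ) * (p' - p : ℕ) * K / (B : ℝ) ^ 2 - (Nat.totient B : ℝ) * y / J| ≤
      1 + y := by
    have e : (Nat.totient B : ℝ) * (p' - p : ℕ) * K / (B : ℝ) ^ 2 - (Nat.totient B : ℝ) * y / J =
        (Nat.totient B : ℝ) / B * ((((p' - p : ℕ) : ℝ) - B / J) * (K / B) + (K - B * y) / J) := by
      field_simp
      ring
    have hKB : (K : ℝ) / B ≤ y := by rw [div_le_iff₀ hB0]; linarith
    have hf : (Nat.totient B : ℝ) / B ≤ 1 := by rw [div_le_one hB0]; exact hφ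
    rw [e, abs_mul, abs_of_nonneg (by positivity : (0 : ℝ) ≤ (Nat.totient B : ℝ) / B)]
    have a1 : |(((p' - p : ℕ) : ℝ) - B / J) * (K / B)| ≤ 1 * y := by
      rw [abs_mul, abs_of_nonneg (by positivity : (0 : ℝ) ≤ (K : ℝ) / B)]
      gcongr
    have a2 : |((K : ℝ) - B * y) / J| ≤ 1 := by
      rw [abs_div, abs_of_pos hJ0, div_le_one hJ0]
      refine le_trans ?_ hJ1
      rw [abs_le]; constructor <;> linarith
    calc _ ≤ 1 * (1 * y + 1) := by
          gcongr
          exact (abs_add_le _ _).trans (add_le_add a1 a2)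
      _ = 1 + y := by ring
  have hBp : 1 ≤ (B : ℝ) ^ (4 / 5 : ℝ) := Real.one_le_rpow hB1 (by norm_num)
  have hKB : (K : ℝ) / B ≤ y := by rw [div_le_iff₀ hB0]; linarith
  calc _ ≤ C * (B : ℝ) ^ (4 / 5 : ℝ) * (1 + K / B) + (1 + y) :=
        (abs_sub_le _ _ _).trans (add_le_add h1 h2)
    _ ≤ C * (B : ℝ) ^ (4 / 5 : ℝ) * (1 + y) + (B : ℝ) ^ (4 / 5 : ℝ) * (1 + y) := by
        gcongr
        nlinarith
    _ = _ := by ring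

end UnimodularQuad


/-! ### Summation over the first height -/

/-- The induction step is Bernoulli's inequality for the concave power `3/10`. The exponent `-7/10 =
4/5 - 3/2` comes from the error `B ^ (4/5)` multiplied by `y_B ≤ (P / B) ^ (3/2)`. -/
theorem sum_rpow_neg_seven_tenths_le (R : ℕ) :
    ∑ B ∈ Finset.Ioc 0 R, (B : ℝ) ^ (-(7 / 10) : ℝ) ≤ 10 / 3 * (R : ℝ) ^ (3 / 10 : ℝ) := by
  induction R with
  | zero => simp
  | succ n ih =>
    rw [Finset.sum_Ioc_succ_top (Nat.zero_le _)]
    have hn : (0 : ℝ) < (n : ℝ) + 1 := by positivity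
    have h1 : (n : ℝ) ^ (3 / 10 : ℝ) ≤
        ((n : ℝ) + 1) ^ (3 / 10 : ℝ) * (1 - 3 / 10 / ((n : ℝ) + 1)) := by
      have e : (n : ℝ) = ((n : ℝ) + 1) * (1 + -(1 / ((n : ℝ) + 1))) := by field_simp; ring
      have hle : 1 / ((n : ℝ) + 1) ≤ 1 := by rw [div_le_one hn]; linarith [n.cast_nonneg (α := ℝ)]
      conv_lhs => rw [e]
      rw [Real.mul_rpow hn.le (by linarith)]
      gcongr
      have := rpow_one_add_le_one_add_mul_self (s := -(1 / ((n : ℝ) + 1))) (by linarith)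
        (p := 3 / 10) (by norm_num) (by norm_num)
      refine this.trans (le_of_eq ?_)
      ring
    have h2 : ((n : ℝ) + 1) ^ (-(7 / 10) : ℝ) = ((n : ℝ) + 1) ^ (3 / 10 : ℝ) / ((n : ℝ) + 1) := by
      rw [← Real.rpow_sub_one hn.ne']; norm_num
    push_cast
    rw [h2]
    have h3 : ((n : ℝ) + 1) ^ (3 / 10 : ℝ) * (1 - 3 / 10 / ((n : ℝ) + 1)) =
      ((n : ℝ) + 1) ^ (3 / 10 : ℝ) - 3 / 10 * (((n : ℝ) + 1) ^ (3 / 10 : ℝ) / ((n : ℝ) + 1)) := by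
      ring
    rw [h3] at h1
    linarith

namespace UnimodularQuad

/-- The equidistribution errors `B ^ (4/5) (1 + y_B)` over `B ≤ ⌈P⌉` add up to `P ^ (9/5)`, which
beats the size `P ^ 2` of the main term. Uniformity in `J` and `i` allows the number of intervals to
grow. -/
theorem exists_abs_sum_ncard_halfFiber_sub_le :
    ∃ K : ℝ, 0 ≤ K ∧ ∀ (P τ : ℝ) (J i : ℕ), 1 ≤ P → 0 ≤ τ → τ ≤ P ^ 3 → 1 ≤ J → J ≤ ⌈P⌉₊ → i < J →
      |∑ B ∈ Finset.Ioc J ⌈P⌉₊, ((halfFiber J B i τ).ncard : ℝ) -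
        3 / Real.pi ^ 2 * pronicIntegral * τ ^ (2 / 3 : ℝ) / J| ≤ K * P ^ (9 / 5 : ℝ) := by
  obtain ⟨C, hC, hA⟩ := exists_abs_ncard_halfFiber_sub_le
  obtain ⟨C₁, hC₁, hT⟩ := exists_abs_sum_totient_pronicRoot_sub_le
  refine ⟨11 * C + 1 + C₁, by positivity, fun P τ J i hP hτ hτP hJ hJR hi => ?_⟩
  set R := ⌈P⌉₊ with hR
  have hP0 : (0 : ℝ) < P := by linarith
  have hJ1 : (1 : ℝ) ≤ J := by exact_mod_cast hJ
  have hPR : P ≤ R := Nat.le_ceil P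
  have hR2 : (R : ℝ) ≤ 2 * P := by
    have := (Nat.ceil_lt_add_one hP0.le).le; linarith
  set y : ℕ → ℝ := fun B => max (pronicRoot (τ / (B : ℝ) ^ 3) - 1) 0 with hy
  have hy0 : ∀ B, 0 ≤ y B := fun B => le_max_right _ _
  have hyle : ∀ B : ℕ, 0 < B → y B ≤ P ^ (3 / 2 : ℝ) * (B : ℝ) ^ (-(3 / 2) : ℝ) := by
    intro B hB
    have hB0 : (0 : ℝ) < B := by exact_mod_cast hB
    refine max_le ?_ (by positivity)
    have h1 := pronicRoot_le_sqrt (w := τ / (B : ℝ) ^ 3) (by positivity)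
    have h2 : Real.sqrt (τ / (B : ℝ) ^ 3) ≤ Real.sqrt (P ^ 3 / (B : ℝ) ^ 3) := by gcongr
    have h3 : Real.sqrt (P ^ 3 / (B : ℝ) ^ 3) = P ^ (3 / 2 : ℝ) * (B : ℝ) ^ (-(3 / 2) : ℝ) := by
      rw [Real.sqrt_div (by positivity), Real.sqrt_eq_rpow, Real.sqrt_eq_rpow,
        Real.rpow_neg hB0.le, ← Real.rpow_natCast, ← Real.rpow_natCast,
        ← Real.rpow_mul hP0.le, ← Real.rpow_mul hB0.le]
      norm_num
      rw [div_eq_mul_inv]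
    linarith
  have hsplit : ∑ B ∈ Finset.Ioc J R, (Nat.totient B : ℝ) * y B =
      ∑ B ∈ Finset.Ioc 0 R, (Nat.totient B : ℝ) * y B -
      ∑ B ∈ Finset.Ioc 0 J, (Nat.totient B : ℝ) * y B := by
    rw [← Finset.sum_Ioc_consecutive _ (Nat.zero_le J) hJR]; ring
  have hP3 : P ^ (3 / 2 : ℝ) ≤ P ^ (9 / 5 : ℝ) := Real.rpow_le_rpow_of_exponent_le hP (by norm_num)
  have e1 : |∑ B ∈ Finset.Ioc J R, ((halfFiber J B i τ).ncard : ℝ) -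
      (∑ B ∈ Finset.Ioc J R, (Nat.totient B : ℝ) * y B) / J| ≤ 11 * C * P ^ (9 / 5 : ℝ) := by
    rw [Finset.sum_div, ← Finset.sum_sub_distrib]
    calc _ ≤ ∑ B ∈ Finset.Ioc J R, C * (B : ℝ) ^ (4 / 5 : ℝ) * (1 + y B) := by
          refine (Finset.abs_sum_le_sum_abs _ _).trans (Finset.sum_le_sum fun B hB => ?_)
          exact hA J B i τ hJ (Finset.mem_Ioc.mp hB).1 hi hτ
      _ ≤ ∑ B ∈ Finset.Ioc 0 R, C * (B : ℝ) ^ (4 / 5 : ℝ) * (1 + y B) := by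
          refine Finset.sum_le_sum_of_subset_of_nonneg
            (Finset.Ioc_subset_Ioc_left (Nat.zero_le _)) fun B _ _ => ?_
          have := hy0 B
          positivity
      _ ≤ ∑ B ∈ Finset.Ioc 0 R, C * ((R : ℝ) ^ (4 / 5 : ℝ) +
            P ^ (3 / 2 : ℝ) * (B : ℝ) ^ (-(7 / 10) : ℝ)) := by
          refine Finset.sum_le_sum fun B hB => ?_
          obtain ⟨hB0, hBR⟩ := Finset.mem_Ioc.mp hB
          have hB0' : (0 : ℝ) < B := by exact_mod_cast hB0
          have hBR' : (B : ℝ) ≤ R := by exact_mod_cast hBR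
          rw [mul_assoc, mul_add, mul_one]
          refine mul_le_mul_of_nonneg_left (add_le_add (by gcongr) ?_) hC
          calc _ ≤ (B : ℝ) ^ (4 / 5 : ℝ) * (P ^ (3 / 2 : ℝ) * (B : ℝ) ^ (-(3 / 2) : ℝ)) := by
                gcongr; exact hyle B hB0
            _ = P ^ (3 / 2 : ℝ) * ((B : ℝ) ^ (4 / 5 : ℝ) * (B : ℝ) ^ (-(3 / 2) : ℝ)) := by ring
            _ = _ := by rw [← Real.rpow_add hB0']; norm_num
      _ = C * (R * (R : ℝ) ^ (4 / 5 : ℝ) + P ^ (3 / 2 : ℝ) *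
            ∑ B ∈ Finset.Ioc 0 R, (B : ℝ) ^ (-(7 / 10) : ℝ)) := by
          rw [← Finset.mul_sum, Finset.sum_add_distrib, Finset.mul_sum]
          simp
      _ ≤ C * (2 * P * (2 * P ^ (4 / 5 : ℝ)) + P ^ (3 / 2 : ℝ) *
            (10 / 3 * (2 * P ^ (3 / 10 : ℝ)))) := by
          have k1 : ∀ p : ℝ, 0 ≤ p → p ≤ 1 → (R : ℝ) ^ p ≤ 2 * P ^ p := by
            intro p hp0 hp1
            calc (R : ℝ) ^ p ≤ (2 * P) ^ p := by gcongr
              _ = 2 ^ p * P ^ p := Real.mul_rpow (by norm_num) hP0.le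
              _ ≤ 2 * P ^ p := by
                gcongr
                calc (2 : ℝ) ^ p ≤ 2 ^ (1 : ℝ) :=
                      Real.rpow_le_rpow_of_exponent_le (by norm_num) hp1
                  _ = 2 := Real.rpow_one 2
          have k2 := sum_rpow_neg_seven_tenths_le R
          have k3 := k1 (4 / 5) (by norm_num) (by norm_num)
          have k4 := k1 (3 / 10) (by norm_num) (by norm_num)
          gcongr
          linarith
      _ = C * (4 + 20 / 3) * P ^ (9 / 5 : ℝ) := by
          have k1 : P * P ^ (4 / 5 : ℝ) = P ^ (9 / 5 : ℝ) := by
            rw [← Real.rpow_one_add' hP0.le (by norm_num)]; norm_num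
          have k2 : P ^ (3 / 2 : ℝ) * P ^ (3 / 10 : ℝ) = P ^ (9 / 5 : ℝ) := by
            rw [← Real.rpow_add hP0]; norm_num
          linear_combination C * 4 * k1 + C * (20 / 3) * k2
      _ ≤ _ := by
          have : 0 ≤ C * P ^ (9 / 5 : ℝ) := by positivity
          nlinarith
  -- The asymptotic totient sum also contains the heights `B ≤ J`. Each such term is at most `P ^
  -- (3/2)`, and the division by `J` offsets their number.
  have e2 : |(∑ B ∈ Finset.Ioc 0 J, (Nat.totient B : ℝ) * y B) / J| ≤ P ^ (9 / 5 : ℝ) := by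
    rw [abs_of_nonneg (div_nonneg (Finset.sum_nonneg fun B _ => mul_nonneg (by positivity) (hy0 B))
      (by positivity)), div_le_iff₀ (by linarith)]
    calc _ ≤ ∑ B ∈ Finset.Ioc 0 J, P ^ (9 / 5 : ℝ) := by
          refine Finset.sum_le_sum fun B hB => ?_
          have hB0 := (Finset.mem_Ioc.mp hB).1
          have hB1 : (1 : ℝ) ≤ B := by exact_mod_cast hB0
          have hφ : (Nat.totient B : ℝ) ≤ B := by exact_mod_cast Nat.totient_le B
          calc _ ≤ (B : ℝ) * (P ^ (3 / 2 : ℝ) * (B : ℝ) ^ (-(3 / 2) : ℝ)) := by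
                gcongr
                exact hyle B hB0
            _ = P ^ (3 / 2 : ℝ) * (B : ℝ) ^ (-(1 / 2) : ℝ) := by
                rw [mul_left_comm, ← Real.rpow_one_add' (by linarith) (by norm_num)]; norm_num
            _ ≤ P ^ (9 / 5 : ℝ) * 1 := by
                gcongr
                exact Real.rpow_le_one_of_one_le_of_nonpos hB1 (by norm_num)
            _ = _ := mul_one _
      _ = _ := by simp [mul_comm]
  have e3 : |(∑ B ∈ Finset.Ioc 0 R, (Nat.totient B : ℝ) * y B) / J -
      3 / Real.pi ^ 2 * pronicIntegral * τ ^ (2 / 3 : ℝ) / J| ≤ C₁ * P ^ (9 / 5 : ℝ) := by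
    rw [← sub_div, abs_div, abs_of_nonneg (by positivity : (0 : ℝ) ≤ J)]
    refine (div_le_self (abs_nonneg _) hJ1).trans ?_
    refine (hT τ R hτ (hτP.trans (by gcongr))).trans ?_
    gcongr
    calc τ ^ (7 / 12 : ℝ) ≤ (P ^ 3) ^ (7 / 12 : ℝ) := by gcongr
      _ = P ^ (7 / 4 : ℝ) := by
          rw [← Real.rpow_natCast, ← Real.rpow_mul hP0.le]; norm_num
      _ ≤ _ := Real.rpow_le_rpow_of_exponent_le hP (by norm_num)
  rw [hsplit, sub_div] at e1
  rw [abs_le] at *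
  constructor <;> nlinarith [e1.1, e1.2, e2.1, e2.2, e3.1, e3.2]

end UnimodularQuad

/-! ### Riemann sums with bounded total oscillation -/

/-- `h` is nonnegative and bounded on `[0, 1]`, and its oscillations over `J` equal intervals
(each enlarged to the left by its own length) add up to a quantity bounded independently of `J`. -/
def HasBoundedOscillation (h : ℝ → ℝ) : Prop :=
  ∃ C : ℝ, ∀ J : ℕ, 1 ≤ J → ∃ m M : ℕ → ℝ,
    (∀ i < J, 0 ≤ m i ∧ m i ≤ M i ∧ M i ≤ C) ∧
    (∀ i < J, ∀ x ∈ Icc (0 : ℝ) 1, (i : ℝ) - 1 ≤ J * x → J * x ≤ i + 1 → m i ≤ h x ∧ h x ≤ M i) ∧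
    ∑ i ∈ Finset.range J, (M i - m i) ≤ C

theorem sum_div_le_integral_of_le {h : ℝ → ℝ} (hint : IntervalIntegrable h MeasureTheory.volume 0 1)
    {J : ℕ} (hJ : 1 ≤ J) {m : ℕ → ℝ}
    (hm : ∀ i < J, ∀ x ∈ Icc (0 : ℝ) 1, (i : ℝ) - 1 ≤ J * x → J * x ≤ i + 1 → m i ≤ h x) :
    (∑ i ∈ Finset.range J, m i) / J ≤ ∫ x in (0 : ℝ)..1, h x := by
  have hJ0 : (0 : ℝ) < J := by exact_mod_cast hJ
  have hmem : ∀ i : ℕ, i < J → ∀ x ∈ Icc ((i : ℝ) / J) (((i + 1 : ℕ) : ℝ) / J), x ∈ Icc (0 : ℝ) 1 := by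
    intro i hi x hx
    have hi1 : ((i + 1 : ℕ) : ℝ) ≤ J := by exact_mod_cast hi
    exact ⟨le_trans (by positivity) hx.1, hx.2.trans ((div_le_one hJ0).mpr hi1)⟩
  have hle : ∀ i : ℕ, ((i : ℕ) : ℝ) / J ≤ ((i + 1 : ℕ) : ℝ) / J := by
    intro i; gcongr; linarith
  have hii : ∀ i < J, IntervalIntegrable h MeasureTheory.volume ((i : ℝ) / J) (((i + 1 : ℕ) : ℝ) / J) := by
    intro i hi
    refine hint.mono_set ?_
    rw [uIcc_of_le (hle i), uIcc_of_le zero_le_one]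
    exact hmem i hi
  have hsum := intervalIntegral.sum_integral_adjacent_intervals (a := fun i : ℕ => (i : ℝ) / J)
    (n := J) (fun i hi => hii i hi)
  rw [Nat.cast_zero, zero_div, div_self hJ0.ne'] at hsum
  rw [← hsum, Finset.sum_div]
  refine Finset.sum_le_sum fun i hi => ?_
  have hi := Finset.mem_range.mp hi
  calc m i / J = ∫ _x in ((i : ℝ) / J)..(((i + 1 : ℕ) : ℝ) / J), m i := by
        rw [intervalIntegral.integral_const, smul_eq_mul]
        push_cast; field_simp; ring
    _ ≤ _ := by
        refine intervalIntegral.integral_mono_on (hle i) (by simp) (hii i hi) fun x hx => ?_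
        refine hm i hi x (hmem i hi x hx) ?_ ?_
        · have := (div_le_iff₀ hJ0).mp hx.1
          linarith
        · have := (le_div_iff₀ hJ0).mp hx.2
          push_cast at this
          linarith

theorem integral_le_sum_div_of_le {h : ℝ → ℝ} (hint : IntervalIntegrable h MeasureTheory.volume 0 1)
    {J : ℕ} (hJ : 1 ≤ J) {M : ℕ → ℝ}
    (hM : ∀ i < J, ∀ x ∈ Icc (0 : ℝ) 1, (i : ℝ) - 1 ≤ J * x → J * x ≤ i + 1 → h x ≤ M i) :
    ∫ x in (0 : ℝ)..1, h x ≤ (∑ i ∈ Finset.range J, M i) / J := by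
  have := sum_div_le_integral_of_le (h := fun x => -h x) hint.neg hJ (m := fun i => -M i)
    (fun i hi x hx h1 h2 => neg_le_neg (hM i hi x hx h1 h2))
  rw [intervalIntegral.integral_neg, Finset.sum_neg_distrib, neg_div] at this
  linarith


/-! ### Counting pairs of large defect -/

namespace UnimodularQuad

/-- The defect function `δ` is governed by the density `h ^ (3 / 2)` on pairs of increasing
heights. -/
def IsGoverned (h : ℝ → ℝ) (δ : UnimodularQuad → ℝ) : Prop :=
  ∀ q : UnimodularQuad, q.fstHeight < q.sndHeight → ∀ m M : ℝ, 0 ≤ m → 0 ≤ M →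
    (∀ x ∈ Icc ((q.1.2.2.1 : ℝ) / q.sndHeight) ((q.1.1 : ℝ) / q.fstHeight), m ≤ h x ∧ h x ≤ M) →
    m ^ (3 / 2 : ℝ) / (2 * q.volume) ≤ δ q ∧ δ q ≤ M ^ (3 / 2 : ℝ) / (2 * q.volume)

theorem fst_le_fstHeight (q : UnimodularQuad) : q.1.1 ≤ q.fstHeight := Nat.le_add_right _ _

theorem div_sub_div_heights (q : UnimodularQuad) :
    (q.1.1 : ℝ) / q.fstHeight - (q.1.2.2.1 : ℝ) / q.sndHeight =
      1 / ((q.fstHeight : ℝ) * q.sndHeight) := by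
  have h1 : (0 : ℝ) < q.fstHeight := by exact_mod_cast q.fstHeight_pos
  have h2 : (0 : ℝ) < q.sndHeight := by exact_mod_cast q.sndHeight_pos
  have h3 : (q.1.1 : ℝ) * q.sndHeight = q.fstHeight * q.1.2.2.1 + 1 := by
    exact_mod_cast q.fst_mul_sndHeight
  field_simp
  linarith

theorem Icc_slopes_subset (q : UnimodularQuad) :
    Icc ((q.1.2.2.1 : ℝ) / q.sndHeight) ((q.1.1 : ℝ) / q.fstHeight) ⊆ Icc (0 : ℝ) 1 := by
  have h1 : (0 : ℝ) < q.fstHeight := by exact_mod_cast q.fstHeight_pos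
  have h3 : (q.1.1 : ℝ) ≤ q.fstHeight := by exact_mod_cast q.fst_le_fstHeight
  exact Icc_subset_Icc (by positivity) ((div_le_one h1).mpr h3)

/-- Pairs of increasing heights with defect at least `t`. -/
def ascending (δ : UnimodularQuad → ℝ) (t : ℝ) : Set UnimodularQuad :=
  {q | q.fstHeight < q.sndHeight ∧ t ≤ δ q}

/-- A bounded density makes the defect at most a constant divided by the volume. Together with the
finiteness of the set of pairs of bounded volume, this makes the counting function finite. -/
theorem volume_le_of_mem_ascending {h : ℝ → ℝ} {δ : UnimodularQuad → ℝ} (hδ : IsGoverned h δ)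
    {C : ℝ} (hC : ∀ x ∈ Icc (0 : ℝ) 1, 0 ≤ h x ∧ h x ≤ C) {t : ℝ} (ht : 0 < t)
    {q : UnimodularQuad} (hq : q ∈ ascending δ t) : q.volume ≤ C ^ (3 / 2 : ℝ) / (2 * t) := by
  have hC0 : 0 ≤ C := (hC 0 (by simp)).1.trans (hC 0 (by simp)).2
  have h1 := (hδ q hq.1 0 C le_rfl hC0 fun x hx => hC x (q.Icc_slopes_subset hx)).2
  have h2 := hq.2.trans h1
  have hv := q.volume_pos
  rw [le_div_iff₀ (by positivity)] at h2 ⊢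
  linarith

/-- A crude bound for small heights: a pair is determined by `a ≤ B` and `D`, and `D ^ 2 ≤ B D (B +
D)` bounds `D` by `X`. -/
theorem card_filter_fstHeight_le (s : Finset UnimodularQuad) (B : ℕ) {X : ℝ} (hX : 0 ≤ X)
    (hs : ∀ q ∈ s, q.volume ≤ X ^ 2) :
    ((s.filter fun q => q.fstHeight = B).card : ℝ) ≤ (B + 1) * X := by
  have h1 : (s.filter fun q => q.fstHeight = B).card ≤
      (Finset.range (B + 1) ×ˢ Finset.Ioc 0 ⌊X⌋₊).card := by
    refine Finset.card_le_card_of_injOn (fun q => (q.1.1, q.sndHeight)) ?_ ?_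
    · intro q hq
      obtain ⟨hq, hB⟩ := Finset.mem_filter.mp (Finset.mem_coe.mp hq)
      simp only [Finset.coe_product, Finset.coe_range, Finset.coe_Ioc, Set.mem_prod, mem_Iio,
        Set.mem_Ioc]
      refine ⟨?_, q.sndHeight_pos, Nat.le_floor ?_⟩
      · have := q.fst_le_fstHeight; omega
      · have h1 : (1 : ℝ) ≤ q.fstHeight := by exact_mod_cast q.fstHeight_pos
        have h2 : (1 : ℝ) ≤ q.sndHeight := by exact_mod_cast q.sndHeight_pos
        refine le_of_sq_le_sq ?_ hX
        refine le_trans ?_ (hs q hq)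
        unfold volume
        have : (q.sndHeight : ℝ) ≤ q.fstHeight * q.sndHeight := by nlinarith
        nlinarith
    · intro q hq q' hq' he
      have hB := (Finset.mem_filter.mp (Finset.mem_coe.mp hq)).2
      have hB' := (Finset.mem_filter.mp (Finset.mem_coe.mp hq')).2
      simp only [Prod.mk.injEq] at he
      exact ext_of_heights he.1 (by omega) he.2
  calc _ ≤ (((Finset.range (B + 1) ×ˢ Finset.Ioc 0 ⌊X⌋₊).card : ℕ) : ℝ) := by exact_mod_cast h1
    _ = (B + 1) * (⌊X⌋₊ : ℝ) := by simp
    _ ≤ _ := by gcongr; exact Nat.floor_le hX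

/-- If `a = B`, then `B` divides both sides of `a D = B c + 1` except for the term `1`. Strictness
places `a / B` in one of the `J` half-open intervals of `[0, 1)`. -/
theorem fst_lt_fstHeight (q : UnimodularQuad) (h : 1 < q.fstHeight) : q.1.1 < q.fstHeight := by
  refine lt_of_le_of_ne q.fst_le_fstHeight fun he => ?_
  have h1 := q.fst_mul_sndHeight
  rw [he] at h1
  have h2 : q.fstHeight ∣ 1 := by
    rw [← Nat.dvd_add_right (Dvd.intro q.1.2.2.1 rfl), ← h1]
    exact Dvd.intro _ rfl
  have := Nat.le_of_dvd one_pos h2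
  omega

theorem card_filter_fstHeight_eq_sum (s : Finset UnimodularQuad) {J B : ℕ} (hJ : 1 ≤ J)
    (hJB : J < B) :
    (s.filter fun q => q.fstHeight = B).card = ∑ i ∈ Finset.range J,
      (s.filter fun q => q.fstHeight = B ∧ J * q.1.1 / B = i).card := by
  rw [Finset.card_eq_sum_card_fiberwise (f := fun q => J * q.1.1 / B) (t := Finset.range J)]
  · refine Finset.sum_congr rfl fun i _ => ?_
    rw [Finset.filter_filter]
  · intro q hq
    have hB := (Finset.mem_filter.mp (Finset.mem_coe.mp hq)).2
    have := q.fst_lt_fstHeight (by omega)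
    simp only [Finset.coe_range, mem_Iio]
    rw [Nat.div_lt_iff_lt_mul (by omega)]
    rw [hB] at this
    exact Nat.mul_lt_mul_of_pos_left this hJ

/-- On the slope interval the unknown defect is squeezed between constants divided by the volume, so
its level set is squeezed between two fibres defined by the volume alone. -/
theorem card_filter_ascending_bounds {h : ℝ → ℝ} {δ : UnimodularQuad → ℝ} (hδ : IsGoverned h δ)
    {t : ℝ} (ht : 0 < t) (hfin : (ascending δ t).Finite) {J B i : ℕ} (hJ : 1 ≤ J) (hJB : J < B)
    {m M : ℝ} (hm : 0 ≤ m) (hmM : m ≤ M)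
    (hh : ∀ x ∈ Icc (0 : ℝ) 1, (i : ℝ) - 1 ≤ J * x → J * x ≤ i + 1 → m ≤ h x ∧ h x ≤ M) :
    (halfFiber J B i (m ^ (3 / 2 : ℝ) / (2 * t))).ncard ≤
      (hfin.toFinset.filter fun q => q.fstHeight = B ∧ J * q.1.1 / B = i).card ∧
    (hfin.toFinset.filter fun q => q.fstHeight = B ∧ J * q.1.1 / B = i).card ≤
      (halfFiber J B i (M ^ (3 / 2 : ℝ) / (2 * t))).ncard := by
  have hB0 : 0 < B := by omega
  have key : ∀ q : UnimodularQuad, q.fstHeight = B → B < q.sndHeight → J * q.1.1 / B = i →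
      m ^ (3 / 2 : ℝ) / (2 * q.volume) ≤ δ q ∧ δ q ≤ M ^ (3 / 2 : ℝ) / (2 * q.volume) := by
    intro q hB hD hi
    refine hδ q (by omega) m M hm (hm.trans hmM) fun x hx => ?_
    have hB' : (0 : ℝ) < B := by exact_mod_cast hB0
    have hD' : (1 : ℝ) ≤ q.sndHeight := by exact_mod_cast q.sndHeight_pos
    have hJ' : (0 : ℝ) < J := by exact_mod_cast hJ
    have hJB' : (J : ℝ) ≤ B := by exact_mod_cast hJB.le
    have hs := q.div_sub_div_heights
    rw [hB] at hs hx
    rw [Nat.div_eq_iff hB0] at hi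
    have h1 : (i : ℝ) * B ≤ J * q.1.1 := by exact_mod_cast hi.1
    have h2 : (J : ℝ) * q.1.1 ≤ (i + 1) * B := by
      have : J * q.1.1 ≤ (i + 1) * B := by rw [Nat.succ_mul]; omega
      exact_mod_cast this
    refine hh x (q.Icc_slopes_subset (by rw [hB]; exact hx)) ?_ ?_
    · have h3 : (i : ℝ) ≤ J * (q.1.1 / B) := by
        rw [← mul_div_assoc, le_div_iff₀ hB']; exact h1
      -- The second slope lies `1 / (B D) ≤ 1 / J` to the left of the first. This is why the bounds
      -- on `h` are required on an interval enlarged to the left by one step.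
      have h4 : (J : ℝ) * (1 / (B * q.sndHeight)) ≤ 1 := by
        rw [mul_one_div, div_le_one (by positivity)]
        nlinarith
      have h5 := mul_le_mul_of_nonneg_left hx.1 hJ'.le
      have h6 : (J : ℝ) * (q.1.2.2.1 / q.sndHeight) =
          J * (q.1.1 / B) - J * (1 / (B * q.sndHeight)) := by rw [← hs]; ring
      linarith
    · have h5 := mul_le_mul_of_nonneg_left hx.2 hJ'.le
      have h3 : (J : ℝ) * (q.1.1 / B) ≤ i + 1 := by
        rw [← mul_div_assoc, div_le_iff₀ hB']; exact h2
      linarith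
  rw [← Set.ncard_coe_finset]
  constructor
  · refine Set.ncard_le_ncard ?_ (Finset.finite_toSet _)
    rintro q ⟨h1, h2, h3, h4⟩
    simp only [Finset.coe_filter, Set.Finite.mem_toFinset, Set.mem_ofPred_eq]
    refine ⟨⟨by omega, ?_⟩, h1, h4⟩
    refine le_trans ?_ (key q h1 h2 h4).1
    have hv := q.volume_pos
    rw [le_div_iff₀ (by positivity)] at h3 ⊢
    linarith
  · refine Set.ncard_le_ncard ?_ (finite_halfFiber _ _ _ _)
    intro q hq
    simp only [Finset.coe_filter, Set.Finite.mem_toFinset, Set.mem_ofPred_eq] at hq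
    obtain ⟨⟨h1, h2⟩, h3, h4⟩ := hq
    refine ⟨h3, by omega, ?_, h4⟩
    have h5 := h2.trans (key q h3 (by omega) h4).2
    have hv := q.volume_pos
    rw [le_div_iff₀ (by positivity)] at h5 ⊢
    linarith

theorem rpow_three_halves_div_rpow {m t : ℝ} (hm : 0 ≤ m) (ht : 0 < t) :
    (m ^ (3 / 2 : ℝ) / (2 * t)) ^ (2 / 3 : ℝ) = m * (2 * t) ^ (-(2 / 3) : ℝ) := by
  rw [Real.div_rpow (by positivity) (by positivity), ← Real.rpow_mul hm, Real.rpow_neg (by positivity)]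
  norm_num
  rw [div_eq_mul_inv]

theorem finite_ascending {h : ℝ → ℝ} {δ : UnimodularQuad → ℝ} (hosc : HasBoundedOscillation h)
    (hδ : IsGoverned h δ) {t : ℝ} (ht : 0 < t) : (ascending δ t).Finite := by
  obtain ⟨C, hC⟩ := hosc
  obtain ⟨m, M, h1, h2, _⟩ := hC 1 le_rfl
  have hb : ∀ x ∈ Icc (0 : ℝ) 1, 0 ≤ h x ∧ h x ≤ C := by
    intro x hx
    have h3 := h2 0 one_pos x hx (by simp; linarith [hx.1]) (by simp; linarith [hx.2])
    have h4 := h1 0 one_pos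
    exact ⟨h4.1.trans h3.1, h3.2.trans h4.2.2⟩
  exact (finite_volume_le _).subset fun q hq => volume_le_of_mem_ascending hδ hb ht hq

set_option maxHeartbeats 1000000 in
/-- Asymptotics of the number of unimodular pairs of increasing heights with defect at least `t`. -/
theorem exists_abs_ncard_ascending_sub_le {h : ℝ → ℝ} {δ : UnimodularQuad → ℝ}
    (hosc : HasBoundedOscillation h) (hint : IntervalIntegrable h MeasureTheory.volume 0 1)
    (hδ : IsGoverned h δ) :
    ∃ K : ℝ, ∀ t ∈ Ioc (0 : ℝ) 1, |((ascending δ t).ncard : ℝ) -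
      3 / Real.pi ^ 2 * pronicIntegral * (2 * t) ^ (-(2 / 3) : ℝ) * ∫ x in (0 : ℝ)..1, h x| ≤
      K * t ^ (-(2 / 3) + 1 / 30 : ℝ) := by
  have hfinall : ∀ t : ℝ, 0 < t → (ascending δ t).Finite := fun t ht => finite_ascending hosc hδ ht
  obtain ⟨K, hK, hB⟩ := exists_abs_sum_ncard_halfFiber_sub_le
  obtain ⟨C, hC⟩ := hosc
  have hb : ∀ x ∈ Icc (0 : ℝ) 1, 0 ≤ h x ∧ h x ≤ C := by
    obtain ⟨m, M, h1, h2, _⟩ := hC 1 le_rfl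
    intro x hx
    have h3 := h2 0 one_pos x hx (by simp; linarith [hx.1]) (by simp; linarith [hx.2])
    have h4 := h1 0 one_pos
    exact ⟨h4.1.trans h3.1, h3.2.trans h4.2.2⟩
  have hC0 : 0 ≤ C := (hb 0 (by simp)).1.trans (hb 0 (by simp)).2
  set κ : ℝ := 3 / Real.pi ^ 2 * pronicIntegral with hκ
  have hκ0 : 0 ≤ κ := by
    have : 0 ≤ pronicIntegral := by
      refine MeasureTheory.setIntegral_nonneg measurableSet_Ioi fun x hx => ?_
      have : (1 : ℝ) < x := hx
      positivity
    positivity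
  -- With this `G` every volume threshold that occurs is at most `P ^ 3 = G ^ 3 / t`.
  obtain ⟨G, hG2, hGC⟩ : ∃ G : ℝ, 2 ≤ G ∧ C ^ (3 / 2 : ℝ) / 2 ≤ G ^ 3 := by
    refine ⟨max 2 (C ^ (3 / 2 : ℝ) / 2), le_max_left _ _, ?_⟩
    refine (le_max_right 2 _).trans ?_
    exact le_self_pow₀ (le_trans (by norm_num) (le_max_left _ _)) (by norm_num)
  refine ⟨8 * G ^ 2 + 2 * K * G ^ 2 + κ * C, fun t ht => ?_⟩
  have ht0 := ht.1
  -- The scale is chosen to balance errors. With `J ≈ s` and `P ≈ s ^ 10`, the main term has order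
  -- `s ^ 20`. The equidistribution error is `J P ^ (9/5) ≈ s ^ 19`, the oscillation error `s ^ 20 /
  -- J ≈ s ^ 19`, and the heights `B ≤ J` contribute `J ^ 2 P ^ (3/2) ≈ s ^ 17`. Finally `s ^ 19 = t
  -- ^ (-2/3 + 1/30)`.
  set s : ℝ := t ^ (-(1 / 30) : ℝ) with hs
  have hs1 : 1 ≤ s := Real.one_le_rpow_of_pos_of_le_one_of_nonpos ht0 ht.2 (by norm_num)
  have hspow : ∀ n : ℕ, s ^ n = t ^ (-(n / 30) : ℝ) := by
    intro n
    rw [hs, ← Real.rpow_natCast, ← Real.rpow_mul ht0.le]; congr 1; ring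
  have ht30 : t⁻¹ = s ^ 30 := by
    rw [hspow, ← Real.rpow_neg_one]; norm_num
  set P : ℝ := G * s ^ 10 with hP
  have hs10 : 1 ≤ s ^ 10 := one_le_pow₀ hs1
  have hP1 : 1 ≤ P := by nlinarith
  have hP3 : P ^ 3 = G ^ 3 * t⁻¹ := by rw [hP, mul_pow, ht30]; ring
  have hCP : C ^ (3 / 2 : ℝ) / (2 * t) ≤ P ^ 3 := by
    rw [hP3, ← div_div, div_eq_mul_inv _ t]
    gcongr
  set J := ⌈s⌉₊ with hJ
  have hJ1 : 1 ≤ J := Nat.one_le_ceil_iff.mpr (by linarith)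
  have hJ2 : (J : ℝ) ≤ 2 * s := by
    have := (Nat.ceil_lt_add_one (by linarith : 0 ≤ s)).le; linarith
  have hsJ : s ≤ J := Nat.le_ceil s
  have hJP : J ≤ ⌈P⌉₊ := by
    have : s ≤ s ^ 10 := le_self_pow₀ hs1 (by norm_num)
    exact Nat.ceil_le_ceil (by nlinarith)
  have hJ0 : (0 : ℝ) < J := by linarith
  obtain ⟨m, M, h1, h2, h3⟩ := hC J hJ1
  have hfin := hfinall t ht0
  set Q := hfin.toFinset with hQ
  have hQvol : ∀ q ∈ Q, q.volume ≤ P ^ 3 := fun q hq =>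
    (volume_le_of_mem_ascending hδ hb ht0 (hfin.mem_toFinset.mp hq)).trans hCP
  -- As `B < D`, one has `B ^ 3 ≤ volume ≤ P ^ 3`, so all first heights are at most `⌈P⌉`. Slope
  -- intervals are used only for `B > J`.
  have hcard : ((ascending δ t).ncard : ℝ) =
      ∑ B ∈ Finset.Ioc 0 J, ((Q.filter fun q => q.fstHeight = B).card : ℝ) +
      ∑ i ∈ Finset.range J, ∑ B ∈ Finset.Ioc J ⌈P⌉₊,
        ((Q.filter fun q => q.fstHeight = B ∧ J * q.1.1 / B = i).card : ℝ) := by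
    rw [Set.ncard_eq_toFinset_card _ hfin, ← hQ,
      Finset.card_eq_sum_card_fiberwise (f := fun q => q.fstHeight) (t := Finset.Ioc 0 ⌈P⌉₊),
      ← Finset.sum_Ioc_consecutive _ (Nat.zero_le J) hJP, Finset.sum_comm]
    · push_cast
      congr 1
      refine Finset.sum_congr rfl fun B hB => ?_
      rw [card_filter_fstHeight_eq_sum Q hJ1 (Finset.mem_Ioc.mp hB).1]
      push_cast
      rfl
    · intro q hq
      simp only [Finset.coe_Ioc, Set.mem_Ioc]
      refine ⟨q.fstHeight_pos, ?_⟩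
      have h4 := hQvol q hq
      have h5 : (q.fstHeight : ℝ) ^ 3 ≤ q.volume := by
        have hlt := (hfin.mem_toFinset.mp (Finset.mem_coe.mp hq)).1
        have h6 : (q.fstHeight : ℝ) ≤ q.sndHeight := by exact_mod_cast hlt.le
        have h7 : (0 : ℝ) ≤ q.fstHeight := by positivity
        unfold volume
        calc (q.fstHeight : ℝ) ^ 3 = q.fstHeight * q.fstHeight * (q.fstHeight + 0) := by ring
          _ ≤ _ := by gcongr; linarith
      have h8 : (q.fstHeight : ℝ) ≤ P :=
        (pow_le_pow_iff_left₀ (by positivity) (by linarith) (by norm_num)).mp (h5.trans h4)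
      exact_mod_cast h8.trans (Nat.le_ceil P)
  set X := P ^ (3 / 2 : ℝ) with hX
  have hX2 : X ^ 2 = P ^ 3 := by
    rw [hX, ← Real.rpow_natCast, ← Real.rpow_mul (by linarith), ← Real.rpow_natCast]; norm_num
  have hsmall : ∑ B ∈ Finset.Ioc 0 J, ((Q.filter fun q => q.fstHeight = B).card : ℝ) ≤
      8 * G ^ 2 * s ^ 19 := by
    have hXle : X ≤ G ^ 2 * s ^ 15 := by
      refine le_of_sq_le_sq ?_ (by positivity)
      rw [hX2, hP, mul_pow, mul_pow]
      have : G ^ 3 ≤ (G ^ 2) ^ 2 := by rw [← pow_mul]; exact pow_le_pow_right₀ (by linarith) (by norm_num)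
      calc G ^ 3 * (s ^ 10) ^ 3 ≤ (G ^ 2) ^ 2 * (s ^ 10) ^ 3 := by gcongr
        _ = _ := by ring
    calc _ ≤ ∑ B ∈ Finset.Ioc 0 J, 2 * (2 * s) * (G ^ 2 * s ^ 15) := by
          refine Finset.sum_le_sum fun B hB => ?_
          refine (card_filter_fstHeight_le Q B (X := X) (by positivity)
            (fun q hq => hX2 ▸ hQvol q hq)).trans ?_
          have hBJ : (B : ℝ) ≤ J := by exact_mod_cast (Finset.mem_Ioc.mp hB).2
          gcongr
          linarith
      _ = J * (2 * (2 * s) * (G ^ 2 * s ^ 15)) := by simp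
      _ ≤ (2 * s) * (2 * (2 * s) * (G ^ 2 * s ^ 15)) := by gcongr
      _ = 8 * G ^ 2 * s ^ 17 := by ring
      _ ≤ _ := by
          gcongr
          norm_num
  have hsmall0 : 0 ≤ ∑ B ∈ Finset.Ioc 0 J, ((Q.filter fun q => q.fstHeight = B).card : ℝ) :=
    Finset.sum_nonneg fun _ _ => by positivity
  have hP95 : P ^ (9 / 5 : ℝ) ≤ G ^ 2 * s ^ 18 := by
    rw [hP, Real.mul_rpow (by linarith) (by positivity)]
    have e : (s ^ 10) ^ (9 / 5 : ℝ) = s ^ 18 := by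
      rw [← Real.rpow_natCast, ← Real.rpow_mul (by linarith), ← Real.rpow_natCast]; norm_num
    rw [e]
    gcongr
    calc G ^ (9 / 5 : ℝ) ≤ G ^ (2 : ℝ) :=
          Real.rpow_le_rpow_of_exponent_le (by linarith) (by norm_num)
      _ = G ^ 2 := by norm_cast
  set Y : ℝ := (2 * t) ^ (-(2 / 3) : ℝ) with hY
  have hY0 : 0 ≤ Y := by positivity
  have hYs : Y ≤ s ^ 20 := by
    rw [hspow, hY]
    calc (2 * t) ^ (-(2 / 3) : ℝ) ≤ t ^ (-(2 / 3) : ℝ) :=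
          Real.rpow_le_rpow_of_nonpos ht0 (by linarith) (by norm_num)
      _ = _ := by norm_num
  have hpt : ∀ z : ℝ, 0 ≤ z → z ≤ C → ∀ i < J,
      |∑ B ∈ Finset.Ioc J ⌈P⌉₊, ((halfFiber J B i (z ^ (3 / 2 : ℝ) / (2 * t))).ncard : ℝ) -
        κ * Y * z / J| ≤ K * (G ^ 2 * s ^ 18) := by
    intro z hz hzC i hi
    have h4 := hB P (z ^ (3 / 2 : ℝ) / (2 * t)) J i hP1 (by positivity)
      (le_trans (by gcongr) hCP) hJ1 hJP hi
    rw [rpow_three_halves_div_rpow hz ht0, ← hY] at h4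
    refine le_trans (le_of_eq ?_) (h4.trans (by gcongr))
    congr 2; ring
  have hbounds : ∀ i < J, ∀ B ∈ Finset.Ioc J ⌈P⌉₊, _ := fun i hi B hBm =>
    card_filter_ascending_bounds hδ ht0 hfin (i := i) hJ1 (Finset.mem_Ioc.mp hBm).1 (h1 i hi).1
      (h1 i hi).2.1 (h2 i hi)
  have hupper : ∑ i ∈ Finset.range J, ∑ B ∈ Finset.Ioc J ⌈P⌉₊,
        ((Q.filter fun q => q.fstHeight = B ∧ J * q.1.1 / B = i).card : ℝ) ≤
      κ * Y * ((∑ i ∈ Finset.range J, M i) / J) + J * (K * (G ^ 2 * s ^ 18)) := by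
    calc _ ≤ ∑ i ∈ Finset.range J, (κ * Y * M i / J + K * (G ^ 2 * s ^ 18)) := by
          refine Finset.sum_le_sum fun i hi => ?_
          have hi := Finset.mem_range.mp hi
          have h4 := hpt (M i) ((h1 i hi).1.trans (h1 i hi).2.1) (h1 i hi).2.2 i hi
          have h5 : ∑ B ∈ Finset.Ioc J ⌈P⌉₊,
              ((Q.filter fun q => q.fstHeight = B ∧ J * q.1.1 / B = i).card : ℝ) ≤
              ∑ B ∈ Finset.Ioc J ⌈P⌉₊,
              ((halfFiber J B i (M i ^ (3 / 2 : ℝ) / (2 * t))).ncard : ℝ) :=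
            Finset.sum_le_sum fun B hBm => by exact_mod_cast (hbounds i hi B hBm).2
          linarith [(abs_le.mp h4).2]
      _ = _ := by
          rw [Finset.sum_add_distrib, ← Finset.sum_div, ← Finset.mul_sum]
          simp only [Finset.sum_const, Finset.card_range, nsmul_eq_mul]
          ring
  have hlower : κ * Y * ((∑ i ∈ Finset.range J, m i) / J) - J * (K * (G ^ 2 * s ^ 18)) ≤
      ∑ i ∈ Finset.range J, ∑ B ∈ Finset.Ioc J ⌈P⌉₊,
        ((Q.filter fun q => q.fstHeight = B ∧ J * q.1.1 / B = i).card : ℝ) := by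
    calc _ = ∑ i ∈ Finset.range J, (κ * Y * m i / J - K * (G ^ 2 * s ^ 18)) := by
          rw [Finset.sum_sub_distrib, ← Finset.sum_div, ← Finset.mul_sum]
          simp only [Finset.sum_const, Finset.card_range, nsmul_eq_mul]
          ring
      _ ≤ _ := by
          refine Finset.sum_le_sum fun i hi => ?_
          have hi := Finset.mem_range.mp hi
          have h4 := hpt (m i) (h1 i hi).1 ((h1 i hi).2.1.trans (h1 i hi).2.2) i hi
          have h5 : ∑ B ∈ Finset.Ioc J ⌈P⌉₊,
              ((halfFiber J B i (m i ^ (3 / 2 : ℝ) / (2 * t))).ncard : ℝ) ≤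
              ∑ B ∈ Finset.Ioc J ⌈P⌉₊,
              ((Q.filter fun q => q.fstHeight = B ∧ J * q.1.1 / B = i).card : ℝ) :=
            Finset.sum_le_sum fun B hBm => by exact_mod_cast (hbounds i hi B hBm).1
          linarith [(abs_le.mp h4).1]
  set I := ∫ x in (0 : ℝ)..1, h x with hI
  have hIm := sum_div_le_integral_of_le hint hJ1 (m := m) fun i hi x hx a b => (h2 i hi x hx a b).1
  have hIM := integral_le_sum_div_of_le hint hJ1 (M := M) fun i hi x hx a b => (h2 i hi x hx a b).2
  have hgap : (∑ i ∈ Finset.range J, M i) / J - (∑ i ∈ Finset.range J, m i) / J ≤ C / s := by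
    rw [← sub_div, ← Finset.sum_sub_distrib]
    calc _ ≤ C / J := by gcongr
      _ ≤ _ := by gcongr
  have hYgap : κ * Y * (C / s) ≤ κ * C * s ^ 19 := by
    calc κ * Y * (C / s) ≤ κ * s ^ 20 * (C / s) := by gcongr
      _ = _ := by field_simp
  have hJK : J * (K * (G ^ 2 * s ^ 18)) ≤ 2 * K * G ^ 2 * s ^ 19 := by
    calc _ ≤ (2 * s) * (K * (G ^ 2 * s ^ 18)) := by gcongr
      _ = _ := by ring
  have hexp : t ^ (-(2 / 3) + 1 / 30 : ℝ) = s ^ 19 := by rw [hspow]; norm_num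
  have hκY : 0 ≤ κ * Y := by positivity
  have u1 : κ * Y * ((∑ i ∈ Finset.range J, M i) / J) ≤ κ * Y * (I + C / s) := by
    gcongr; linarith
  have l1 : κ * Y * (I - C / s) ≤ κ * Y * ((∑ i ∈ Finset.range J, m i) / J) := by
    gcongr; linarith
  rw [hcard, hexp, abs_le]
  have hκC : 0 ≤ κ * C * s ^ 19 := by positivity
  have hGs : 0 ≤ 8 * G ^ 2 * s ^ 19 := by positivity
  constructor <;> nlinarith
end UnimodularQuad


/-! ### Mellin transform of a counting function -/

section Mellin

variable {ι : Type*}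

/-- The number of indices at which a family takes a value at least `t`. -/
noncomputable def upperCount (D : ι → ℝ) (t : ℝ) : ℝ := ({q | t ≤ D q}.ncard : ℝ)

theorem antitoneOn_upperCount {D : ι → ℝ} (hfin : ∀ t > 0, {q | t ≤ D q}.Finite) :
    AntitoneOn (upperCount D) (Ioi 0) := by
  intro t ht u _ htu
  unfold upperCount
  exact_mod_cast Set.ncard_le_ncard (fun q (hq : u ≤ D q) => htu.trans hq) (hfin t ht)

theorem exists_upperCount_eq_zero {D : ι → ℝ} (hfin : ∀ t > 0, {q | t ≤ D q}.Finite) :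
    ∃ T : ℝ, ∀ t, T < t → upperCount D t = 0 := by
  obtain ⟨T, hT⟩ := ((hfin 1 one_pos).image D).bddAbove
  refine ⟨max T 1, fun t ht => ?_⟩
  have : {q | t ≤ D q} = ∅ := by
    ext q
    simp only [Set.mem_ofPred_eq, mem_empty_iff_false, iff_false, not_le]
    by_contra! h
    have h1 : 1 ≤ D q := (le_max_right _ _).trans (ht.le.trans h)
    have h2 : D q ≤ T := hT ⟨q, h1, rfl⟩
    exact absurd (lt_of_lt_of_le (lt_of_le_of_lt (le_max_left _ _) ht) h) (not_lt.mpr h2)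
  simp [upperCount, this]

theorem locallyIntegrableOn_upperCount {D : ι → ℝ} (hfin : ∀ t > 0, {q | t ≤ D q}.Finite) :
    MeasureTheory.LocallyIntegrableOn (fun t => (upperCount D t : ℂ)) (Ioi 0) := by
  rw [MeasureTheory.locallyIntegrableOn_iff isOpen_Ioi.isLocallyClosed]
  intro k hk hkc
  exact (((antitoneOn_upperCount hfin).mono hk).integrableOn_isCompact hkc).ofReal

/-- The remainder in `upperCount D t = C t ^ (-σ) + …`, the main term being cut off at `1`. -/
noncomputable def countRemainder (D : ι → ℝ) (C σ : ℝ) (t : ℝ) : ℂ :=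
  (upperCount D t : ℂ) - (C : ℂ) * (Ioc (0 : ℝ) 1).indicator (fun t : ℝ => (t : ℂ) ^ (-σ : ℂ)) t

theorem locallyIntegrableOn_countRemainder {D : ι → ℝ} (hfin : ∀ t > 0, {q | t ≤ D q}.Finite)
    (C σ : ℝ) : MeasureTheory.LocallyIntegrableOn (countRemainder D C σ) (Ioi 0) := by
  refine (locallyIntegrableOn_upperCount hfin).sub ?_
  rw [MeasureTheory.locallyIntegrableOn_iff isOpen_Ioi.isLocallyClosed]
  intro k hk hkc
  refine MeasureTheory.Integrable.const_mul ?_ _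
  refine MeasureTheory.IntegrableOn.indicator (ContinuousOn.integrableOn_compact hkc ?_)
    measurableSet_Ioc
  intro t ht
  refine ContinuousAt.continuousWithinAt ?_
  exact Complex.continuousAt_ofReal_cpow_const _ _ (Or.inr (ne_of_gt (hk ht)))

theorem countRemainder_isBigO_atTop {D : ι → ℝ} (hfin : ∀ t > 0, {q | t ≤ D q}.Finite)
    (C σ a : ℝ) : countRemainder D C σ =O[atTop] (fun t : ℝ => t ^ (-a)) := by
  obtain ⟨T, hT⟩ := exists_upperCount_eq_zero hfin
  refine Asymptotics.IsBigO.of_bound 0 ?_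
  filter_upwards [eventually_gt_atTop T, eventually_gt_atTop 1] with t ht ht1
  rw [countRemainder, hT t ht, Set.indicator_of_notMem (fun h => not_lt.mpr h.2 ht1)]
  simp

theorem countRemainder_isBigO_zero {D : ι → ℝ} {C σ ε K : ℝ}
    (hcount : ∀ t ∈ Ioc (0 : ℝ) 1, |upperCount D t - C * t ^ (-σ)| ≤ K * t ^ (-σ + ε)) :
    countRemainder D C σ =O[𝓝[>] 0] (fun t : ℝ => t ^ (-(σ - ε))) := by
  refine Asymptotics.IsBigO.of_bound K ?_
  filter_upwards [Ioc_mem_nhdsGT (zero_lt_one (α := ℝ))] with t ht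
  rw [countRemainder, Set.indicator_of_mem ht]
  have : (upperCount D t : ℂ) - C * (t : ℂ) ^ (-σ : ℂ) =
      ((upperCount D t - C * t ^ (-σ) : ℝ) : ℂ) := by
    push_cast [Complex.ofReal_cpow ht.1.le]
    rfl
  rw [this, Complex.norm_real, Real.norm_eq_abs, Real.norm_of_nonneg (by have := ht.1; positivity)]
  refine (hcount t ht).trans (le_of_eq ?_)
  congr 2; ring

/-- The main term cut off at `1` transforms into `C / (s - σ)`, which carries the pole. The
remainder is `O(t ^ (-(σ - ε)))` at `0` and vanishes for large `t`. -/
theorem hasMellin_upperCount {D : ι → ℝ} (hfin : ∀ t > 0, {q | t ≤ D q}.Finite)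
    {C σ ε K : ℝ} (hε : 0 < ε)
    (hcount : ∀ t ∈ Ioc (0 : ℝ) 1, |upperCount D t - C * t ^ (-σ)| ≤ K * t ^ (-σ + ε))
    {s : ℂ} (hs : σ < s.re) :
    HasMellin (fun t => (upperCount D t : ℂ)) s
      (mellin (countRemainder D C σ) s + C * (1 / (s - σ))) := by
  have h1 : MellinConvergent (countRemainder D C σ) s :=
    mellinConvergent_of_isBigO_rpow (a := s.re + 1) (b := σ - ε)
      (locallyIntegrableOn_countRemainder hfin C σ) (countRemainder_isBigO_atTop hfin C σ _)
      (by linarith) (countRemainder_isBigO_zero hcount) (by linarith)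
  have h2 := hasMellin_cpow_Ioc (-σ : ℂ) (s := s) (by simp; linarith)
  have h3 := hasMellin_const_smul h2.1 (C : ℂ)
  have h4 := hasMellin_add h1 h3.1
  rw [h3.2, h2.2] at h4
  simp only [smul_eq_mul, countRemainder, sub_add_cancel] at h4
  rw [← sub_eq_add_neg] at h4
  exact h4

/-- The case `x = 0` is included: the interval is then empty, in accordance with the convention that
vanishing terms contribute `0`. -/
theorem integral_indicator_Ioc_cpow {x : ℝ} (hx : 0 ≤ x) {s : ℂ} (hs : 0 < s.re) :
    ∫ t in Ioi (0 : ℝ), (Ioc 0 x).indicator (fun t : ℝ => s * (t : ℂ) ^ (s - 1)) t = (x : ℂ) ^ s := by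
  have hs0 : s ≠ 0 := by intro h; simp [h] at hs
  rw [MeasureTheory.setIntegral_indicator measurableSet_Ioc,
    Set.inter_eq_self_of_subset_right Ioc_subset_Ioi_self, MeasureTheory.integral_const_mul,
    ← intervalIntegral.integral_of_le hx, integral_cpow (Or.inl (by simpa using hs))]
  simp only [sub_add_cancel, Complex.ofReal_zero, Complex.zero_cpow hs0, sub_zero]
  field_simp

theorem integrable_indicator_Ioc_cpow (x : ℝ) {s : ℂ} (hs : 0 < s.re) :
    MeasureTheory.IntegrableOn
      ((Ioc 0 x).indicator (fun t : ℝ => s * (t : ℂ) ^ (s - 1))) (Ioi (0 : ℝ)) := by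
  have h := (intervalIntegral.intervalIntegrable_cpow' (a := 0) (b := x) (r := s - 1)
    (by simpa using hs)).1
  rw [MeasureTheory.IntegrableOn, MeasureTheory.integrable_indicator_iff measurableSet_Ioc]
  refine MeasureTheory.Integrable.mono_measure (h.const_mul s) ?_
  exact MeasureTheory.Measure.restrict_mono le_rfl MeasureTheory.Measure.restrict_le_self

/-- Writing `D q ^ r` as the integral of `r t ^ (r - 1)` up to `D q`, every finite partial sum is
dominated by the convergent Mellin integral of the counting function. -/
theorem summable_rpow_of_upperCount {D : ι → ℝ} (hD : ∀ q, 0 ≤ D q)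
    (hfin : ∀ t > 0, {q | t ≤ D q}.Finite) {r : ℝ} (hr : 0 < r)
    (hm : MellinConvergent (fun t => (upperCount D t : ℂ)) r) : Summable fun q => D q ^ r := by
  have hint : MeasureTheory.IntegrableOn (fun t : ℝ => r * (t ^ (r - 1) * upperCount D t)) (Ioi 0) := by
    refine MeasureTheory.Integrable.const_mul ?_ _
    refine (MeasureTheory.Integrable.norm hm).congr ?_
    filter_upwards [MeasureTheory.ae_restrict_mem measurableSet_Ioi] with t ht
    have ht : (0 : ℝ) < t := ht
    have h0 : 0 ≤ upperCount D t := Nat.cast_nonneg _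
    rw [norm_smul, Complex.norm_cpow_eq_rpow_re_of_pos ht, Complex.norm_of_nonneg h0]
    simp
  have hterm : ∀ q, D q ^ r = ∫ t in Ioi (0 : ℝ), (Ioc 0 (D q)).indicator
      (fun t : ℝ => r * t ^ (r - 1)) t := by
    intro q
    rw [MeasureTheory.setIntegral_indicator measurableSet_Ioc,
      Set.inter_eq_self_of_subset_right Ioc_subset_Ioi_self, MeasureTheory.integral_const_mul,
      ← intervalIntegral.integral_of_le (hD q), integral_rpow (Or.inl (by linarith))]
    simp only [sub_add_cancel, Real.zero_rpow hr.ne', sub_zero]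
    field_simp
  have htint : ∀ q, MeasureTheory.IntegrableOn
      ((Ioc 0 (D q)).indicator (fun t : ℝ => r * t ^ (r - 1))) (Ioi (0 : ℝ)) := by
    intro q
    have h := (intervalIntegral.intervalIntegrable_rpow' (a := 0) (b := D q) (r := r - 1)
      (by linarith)).1
    rw [MeasureTheory.IntegrableOn, MeasureTheory.integrable_indicator_iff measurableSet_Ioc]
    refine MeasureTheory.Integrable.mono_measure (h.const_mul r) ?_
    exact MeasureTheory.Measure.restrict_mono le_rfl MeasureTheory.Measure.restrict_le_self
  refine summable_of_sum_le (fun q => Real.rpow_nonneg (hD q) r)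
    (c := ∫ t in Ioi (0 : ℝ), r * (t ^ (r - 1) * upperCount D t)) fun F => ?_
  simp_rw [hterm]
  rw [← MeasureTheory.integral_finsetSum _ fun q _ => htint q]
  refine MeasureTheory.setIntegral_mono_on (MeasureTheory.integrable_finsetSum _ fun q _ => htint q)
    hint measurableSet_Ioi fun t ht => ?_
  have ht : (0 : ℝ) < t := ht
  calc ∑ q ∈ F, (Ioc 0 (D q)).indicator (fun t : ℝ => r * t ^ (r - 1)) t
      = ∑ q ∈ F, if t ≤ D q then r * t ^ (r - 1) else 0 := by
        refine Finset.sum_congr rfl fun q _ => ?_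
        simp [Set.indicator_apply, ht]
    _ = ((F.filter fun q => t ≤ D q).card : ℝ) * (r * t ^ (r - 1)) := by
        rw [← Finset.sum_filter, Finset.sum_const, nsmul_eq_mul]
    _ ≤ upperCount D t * (r * t ^ (r - 1)) := by
        gcongr
        unfold upperCount
        rw [← Set.ncard_coe_finset (F.filter fun q => t ≤ D q)]
        exact_mod_cast Set.ncard_le_ncard (fun q hq => (Finset.mem_filter.mp hq).2) (hfin t ht)
    _ = _ := by ring

/-- This is the layer cake formula with a complex exponent. Real summability at `s.re` justifies
exchanging sum and integral, after which the indicators at `t` count the terms that are at least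
`t`. -/
theorem tsum_cpow_eq_mul_mellin [Countable ι] {D : ι → ℝ} (hD : ∀ q, 0 ≤ D q)
    (hfin : ∀ t > 0, {q | t ≤ D q}.Finite) {s : ℂ} (hs : 0 < s.re)
    (hsum : Summable fun q => D q ^ s.re) :
    ∑' q, (D q : ℂ) ^ s = s * mellin (fun t => (upperCount D t : ℂ)) s := by
  have hs0 : s ≠ 0 := by intro h; simp [h] at hs
  have hnorm : ∀ q, ∫ t in Ioi (0 : ℝ),
      ‖(Ioc 0 (D q)).indicator (fun t : ℝ => s * (t : ℂ) ^ (s - 1)) t‖ =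
      ‖s‖ / s.re * D q ^ s.re := by
    intro q
    have e : ∀ t ∈ Ioi (0 : ℝ), ‖(Ioc 0 (D q)).indicator (fun t : ℝ => s * (t : ℂ) ^ (s - 1)) t‖ =
        (Ioc 0 (D q)).indicator (fun t : ℝ => ‖s‖ * t ^ (s.re - 1)) t := by
      intro t ht
      have ht : (0 : ℝ) < t := ht
      rw [norm_indicator_eq_indicator_norm]
      simp only [Set.indicator_apply, norm_mul, Complex.norm_cpow_eq_rpow_re_of_pos ht,
        Complex.sub_re, Complex.one_re]
    rw [MeasureTheory.setIntegral_congr_fun measurableSet_Ioi e,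
      MeasureTheory.setIntegral_indicator measurableSet_Ioc,
      Set.inter_eq_self_of_subset_right Ioc_subset_Ioi_self, MeasureTheory.integral_const_mul,
      ← intervalIntegral.integral_of_le (hD q), integral_rpow (Or.inl (by linarith))]
    simp only [sub_add_cancel, Real.zero_rpow hs.ne', sub_zero]
    field_simp
  have h := MeasureTheory.hasSum_integral_of_summable_integral_norm
    (μ := MeasureTheory.volume.restrict (Ioi (0 : ℝ)))
    (F := fun q => (Ioc 0 (D q)).indicator (fun t : ℝ => s * (t : ℂ) ^ (s - 1)))
    (fun q => integrable_indicator_Ioc_cpow (D q) hs) (by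
      simp_rw [hnorm]; exact hsum.mul_left _)
  simp_rw [integral_indicator_Ioc_cpow (hD _) hs] at h
  rw [h.tsum_eq, mellin, ← MeasureTheory.integral_const_mul]
  refine MeasureTheory.setIntegral_congr_fun measurableSet_Ioi fun t ht => ?_
  have ht : (0 : ℝ) < t := ht
  have hsupp : ∀ q, (Ioc 0 (D q)).indicator (fun t : ℝ => s * (t : ℂ) ^ (s - 1)) t =
      if t ≤ D q then s * (t : ℂ) ^ (s - 1) else 0 := by
    intro q
    simp [Set.indicator_apply, ht]
  simp only [hsupp]
  rw [tsum_eq_sum (s := (hfin t ht).toFinset) (fun q hq => if_neg (by simpa using hq)),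
    Finset.sum_congr rfl (fun q hq => if_pos (by simpa using hq)), Finset.sum_const,
    nsmul_eq_mul, upperCount, Set.ncard_eq_toFinset_card _ (hfin t ht), smul_eq_mul]
  push_cast
  ring

/-- Analytic continuation of a Dirichlet-type series from a power-saving count. -/
theorem exists_continuation_of_upperCount [Countable ι] {D : ι → ℝ} (hD : ∀ q, 0 ≤ D q)
    (hfin : ∀ t > 0, {q | t ≤ D q}.Finite) {C σ ε K : ℝ} (hσ : 0 < σ) (hε : 0 < ε)
    (hcount : ∀ t ∈ Ioc (0 : ℝ) 1, |upperCount D t - C * t ^ (-σ)| ≤ K * t ^ (-σ + ε)) :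
    (∀ s : ℂ, σ < s.re → Summable fun q => (D q : ℂ) ^ s) ∧
    ∃ G : ℂ → ℂ, (∀ s : ℂ, σ - ε < s.re → DifferentiableAt ℂ G s) ∧
      ∀ s : ℂ, σ < s.re → ∑' q, (D q : ℂ) ^ s = C * s / (s - σ) + s * G s := by
  have hreal : ∀ r : ℝ, σ < r → Summable fun q => D q ^ r := fun r hr =>
    summable_rpow_of_upperCount hD hfin (hσ.trans hr)
      (hasMellin_upperCount hfin hε hcount (s := r) (by simpa using hr)).1
  refine ⟨fun s hs => ?_, mellin (countRemainder D C σ), fun s hs => ?_, fun s hs => ?_⟩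
  · refine Summable.of_norm ((hreal s.re hs).congr fun q => ?_)
    rw [Complex.norm_cpow_eq_rpow_re_of_nonneg (hD q) (by linarith)]
  · exact mellin_differentiableAt_of_isBigO_rpow (a := s.re + 1) (b := σ - ε)
      (locallyIntegrableOn_countRemainder hfin C σ) (countRemainder_isBigO_atTop hfin C σ _)
      (by linarith) (countRemainder_isBigO_zero hcount) hs
  · rw [tsum_cpow_eq_mul_mellin hD hfin (hσ.trans hs) (hreal s.re hs),
      (hasMellin_upperCount hfin hε hcount hs).2]
    ring

end Mellin


/-! ### Lipschitz functions cut off to an interval -/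

theorem card_filter_near_le (J : ℕ) {y : ℝ} (hy : 0 ≤ y) :
    ((Finset.range J).filter fun i : ℕ => y - 1 ≤ i ∧ (i : ℝ) ≤ y + 1).card ≤ 3 := by
  calc _ ≤ (Finset.Icc (⌊y⌋₊ - 1) (⌊y⌋₊ + 1)).card := by
        refine Finset.card_le_card fun i hi => ?_
        obtain ⟨_, h1, h2⟩ := Finset.mem_filter.mp hi
        have h3 : (⌊y⌋₊ : ℝ) ≤ y := Nat.floor_le hy
        have h4 : y < ⌊y⌋₊ + 1 := Nat.lt_floor_add_one y
        have h5 : (⌊y⌋₊ : ℝ) ≤ ((i + 1 : ℕ) : ℝ) := by push_cast; linarith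
        have h6 : (i : ℝ) < ((⌊y⌋₊ + 2 : ℕ) : ℝ) := by push_cast; linarith
        have h5 := Nat.cast_le.mp h5
        have h6 := Nat.cast_lt.mp h6
        rw [Finset.mem_Icc]
        omega
    _ ≤ 3 := by rw [Nat.card_Icc]; omega

/-- A nonnegative function which is Lipschitz on a subinterval of `[0, 1]` and vanishes off it. -/
structure IsLipschitzBump (h : ℝ → ℝ) (α β : ℝ) : Prop where
  left_nonneg : 0 ≤ α
  le : α ≤ β
  right_le : β ≤ 1
  nonneg : ∀ x, 0 ≤ h x
  lipschitz : ∃ L : ℝ, 0 ≤ L ∧ ∀ x ∈ Icc α β, ∀ y ∈ Icc α β, |h x - h y| ≤ L * |x - y|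
  eq_zero : ∀ x, x ∉ Icc α β → h x = 0

namespace IsLipschitzBump

variable {h : ℝ → ℝ} {α β : ℝ}

theorem continuousOn (hh : IsLipschitzBump h α β) : ContinuousOn h (Icc α β) := by
  obtain ⟨L, hL, hlip⟩ := hh.lipschitz
  refine LipschitzOnWith.continuousOn (K := ⟨L, hL⟩) (LipschitzOnWith.of_dist_le_mul ?_)
  intro x hx y hy
  exact hlip x hx y hy

theorem eq_indicator (hh : IsLipschitzBump h α β) : h = (Icc α β).indicator h := by
  ext x
  by_cases hx : x ∈ Icc α β
  · rw [Set.indicator_of_mem hx]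
  · rw [Set.indicator_of_notMem hx, hh.eq_zero x hx]

theorem integrable (hh : IsLipschitzBump h α β) : MeasureTheory.Integrable h := by
  rw [hh.eq_indicator, MeasureTheory.integrable_indicator_iff measurableSet_Icc]
  exact hh.continuousOn.integrableOn_compact isCompact_Icc

theorem integral_eq (hh : IsLipschitzBump h α β) :
    ∫ x in (0 : ℝ)..1, h x = ∫ x in α..β, h x := by
  rw [intervalIntegral.integral_of_le zero_le_one, intervalIntegral.integral_of_le hh.le,
    ← MeasureTheory.integral_Icc_eq_integral_Ioc, ← MeasureTheory.integral_Icc_eq_integral_Ioc]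
  conv_lhs => rw [hh.eq_indicator]
  rw [MeasureTheory.setIntegral_indicator measurableSet_Icc,
    Set.inter_eq_self_of_subset_right (Icc_subset_Icc hh.left_nonneg hh.right_le)]

theorem reflect (hh : IsLipschitzBump h α β) :
    IsLipschitzBump (fun x => h (1 - x)) (1 - β) (1 - α) where
  left_nonneg := by linarith [hh.right_le]
  le := by linarith [hh.le]
  right_le := by linarith [hh.left_nonneg]
  nonneg x := hh.nonneg _
  lipschitz := by
    obtain ⟨L, hL, hlip⟩ := hh.lipschitz
    refine ⟨L, hL, fun x hx y hy => ?_⟩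
    have := hlip (1 - x) ⟨by linarith [hx.2], by linarith [hx.1]⟩ (1 - y)
      ⟨by linarith [hy.2], by linarith [hy.1]⟩
    rwa [sub_sub_sub_cancel_left, abs_sub_comm y x] at this
  eq_zero x hx := hh.eq_zero _ fun h1 => hx ⟨by linarith [h1.2], by linarith [h1.1]⟩

theorem hasBoundedOscillation (hh : IsLipschitzBump h α β) : HasBoundedOscillation h := by
  classical
  obtain ⟨L, hL, hlip⟩ := hh.lipschitz
  have hαβ := hh.le
  have hα := hh.left_nonneg
  have hβ := hh.right_le
  set H := h α + L with hH
  have hhα := hh.nonneg α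
  have hH0 : 0 ≤ H := by linarith
  have hbd : ∀ x, h x ≤ H := by
    intro x
    by_cases hx : x ∈ Icc α β
    · have h1 := (abs_le.mp (hlip x hx α ⟨le_rfl, hαβ⟩)).2
      have h2 : |x - α| ≤ 1 := by
        rw [abs_le]; constructor <;> linarith [hx.1, hx.2]
      nlinarith
    · rw [hh.eq_zero x hx]; exact hH0
  refine ⟨H + 2 * L + 6 * H, fun J hJ => ?_⟩
  have hJ0 : (0 : ℝ) < J := by exact_mod_cast hJ
  have hJ1 : (1 : ℝ) ≤ J := by exact_mod_cast hJ
  have hLJ : L / J ≤ L := div_le_self hL hJ1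
  set inside : ℕ → Prop := fun i => J * α ≤ (i : ℝ) - 1 ∧ (i : ℝ) + 1 ≤ J * β with hin
  set outside : ℕ → Prop := fun i => (i : ℝ) + 1 < J * α ∨ J * β < (i : ℝ) - 1 with hout
  -- Well inside `[α, β]` the oscillation is at most `2 L / J`, and well outside it is zero. The
  -- trivial bound `H` is used only for the indices within one step of `J α` or `J β`, at most three
  -- for each end.
  refine ⟨fun i => if inside i then max 0 (h (i / J) - L / J) else 0,
    fun i => if inside i then h (i / J) + L / J else if outside i then 0 else H, ?_, ?_, ?_⟩
  · intro i _
    have h1 := hh.nonneg (i / J)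
    have h2 := hbd (i / J)
    have h3 : 0 ≤ L / J := by positivity
    by_cases hi : inside i
    · simp only [hi, if_true]
      exact ⟨le_max_left _ _, max_le (by linarith) (by linarith), by linarith⟩
    · simp only [hi, if_false]
      split_ifs
      · exact ⟨le_rfl, le_rfl, by linarith⟩
      · exact ⟨le_rfl, hH0, by linarith⟩
  · intro i _ x hx hx1 hx2
    by_cases hi : inside i
    · simp only [hi, if_true]
      have hxm : x ∈ Icc α β := ⟨le_of_mul_le_mul_left (hi.1.trans hx1) hJ0,
        le_of_mul_le_mul_left (hx2.trans hi.2) hJ0⟩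
      have him : (i : ℝ) / J ∈ Icc α β := by
        constructor
        · rw [le_div_iff₀ hJ0]; linarith [hi.1]
        · rw [div_le_iff₀ hJ0]; linarith [hi.2]
      have h1 := hlip x hxm _ him
      have h2 : |x - i / J| ≤ 1 / J := by
        have e : x - i / J = (J * x - i) / J := by field_simp
        rw [e, abs_div, abs_of_pos hJ0]
        gcongr
        rw [abs_le]; constructor <;> linarith
      have h3 : L * |x - i / J| ≤ L / J := by
        calc _ ≤ L * (1 / J) := by gcongr
          _ = _ := by ring
      have h4 := abs_le.mp (h1.trans h3)
      exact ⟨max_le (hh.nonneg x) (by linarith [h4.1]), by linarith [h4.2]⟩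
    · simp only [hi, if_false]
      refine ⟨hh.nonneg x, ?_⟩
      split_ifs with ho
      · rw [hh.eq_zero x]
        rintro ⟨h1, h2⟩
        rcases ho with ho | ho
        · have := lt_of_mul_lt_mul_left (lt_of_le_of_lt hx2 ho) hJ0.le
          linarith
        · have := lt_of_mul_lt_mul_left (lt_of_lt_of_le ho hx1) hJ0.le
          linarith
      · exact hbd x
  · have hc1 := card_filter_near_le J (y := J * α) (by positivity)
    have hc2 := card_filter_near_le J (y := J * β) (by have := hα.trans hαβ; positivity)
    calc _ ≤ ∑ i ∈ Finset.range J, (2 * L / J +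
          (if J * α - 1 ≤ (i : ℝ) ∧ (i : ℝ) ≤ J * α + 1 then H else 0) +
          (if J * β - 1 ≤ (i : ℝ) ∧ (i : ℝ) ≤ J * β + 1 then H else 0)) := by
          refine Finset.sum_le_sum fun i _ => ?_
          have p0 : 0 ≤ 2 * L / J := by positivity
          have p1 : 0 ≤ (if J * α - 1 ≤ (i : ℝ) ∧ (i : ℝ) ≤ J * α + 1 then H else 0) := by
            split_ifs <;> [exact hH0; exact le_rfl]
          have p2 : 0 ≤ (if J * β - 1 ≤ (i : ℝ) ∧ (i : ℝ) ≤ J * β + 1 then H else 0) := by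
            split_ifs <;> [exact hH0; exact le_rfl]
          by_cases hi : inside i
          · simp only [hi, if_true]
            have := le_max_right 0 (h (i / J) - L / J)
            have e : 2 * L / J = L / J + L / J := by ring
            linarith
          · simp only [hi, if_false]
            by_cases ho : outside i
            · simp only [ho, if_true]; linarith
            · simp only [ho, if_false]
              simp only [hin, hout, not_and_or, not_or, not_le, not_lt] at hi ho
              rcases hi with hi | hi
              · rw [if_pos (c := J * α - 1 ≤ (i : ℝ) ∧ (i : ℝ) ≤ J * α + 1)
                  ⟨by linarith [ho.1], by linarith⟩]
                linarith
              · rw [if_pos (c := J * β - 1 ≤ (i : ℝ) ∧ (i : ℝ) ≤ J * β + 1)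
                  ⟨by linarith, by linarith [ho.2]⟩]
                linarith
      _ = 2 * L + ((Finset.range J).filter fun i : ℕ => J * α - 1 ≤ (i : ℝ) ∧ (i : ℝ) ≤ J * α + 1).card
            * H + ((Finset.range J).filter fun i : ℕ => J * β - 1 ≤ (i : ℝ) ∧ (i : ℝ) ≤ J * β + 1).card
            * H := by
          rw [Finset.sum_add_distrib, Finset.sum_add_distrib, ← Finset.sum_filter,
            ← Finset.sum_filter]
          simp only [Finset.sum_const, Finset.card_range, nsmul_eq_mul]
          field_simp
      _ ≤ 2 * L + 3 * H + 3 * H := by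
          gcongr
          · exact_mod_cast hc1
          · exact_mod_cast hc2
      _ ≤ _ := by linarith

end IsLipschitzBump

/-! ### Concave envelopes and the Jensen gap -/

/-- `s` is a Lipschitz selection of supergradients of `η` on `[0, 1]`. -/
structure IsEnvelope (η s : ℝ → ℝ) : Prop where
  supergradient : ∀ x ∈ Icc (0 : ℝ) 1, ∀ y ∈ Icc (0 : ℝ) 1, η y ≤ η x + (y - x) * s x
  lipschitz : ∃ L : ℝ, ∀ x ∈ Icc (0 : ℝ) 1, ∀ y ∈ Icc (0 : ℝ) 1, |s x - s y| ≤ L * |x - y|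

namespace IsEnvelope

variable {η s : ℝ → ℝ}

/-- The supergradient inequalities at `x` and at `y` bound the first order remainder from both
sides. With `s` Lipschitz this is quadratic, so `η` is differentiable with derivative `s`. -/
theorem abs_sub_le (h : IsEnvelope η s) {x y : ℝ} (hx : x ∈ Icc (0 : ℝ) 1) (hy : y ∈ Icc (0 : ℝ) 1) :
    |η y - η x - (y - x) * s x| ≤ |y - x| * |s y - s x| := by
  have h1 := h.supergradient x hx y hy
  have h2 := h.supergradient y hy x hx
  rw [← abs_mul, abs_le]
  have h3 := neg_abs_le ((y - x) * (s y - s x))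
  have h4 := abs_nonneg ((y - x) * (s y - s x))
  constructor <;> nlinarith

theorem continuousOn (h : IsEnvelope η s) : ContinuousOn η (Icc 0 1) := by
  obtain ⟨L, hL⟩ := h.lipschitz
  have hb : ∀ x ∈ Icc (0 : ℝ) 1, |s x| ≤ |s 0| + |L| := by
    intro x hx
    have h1 := hL x hx 0 (by simp)
    have h2 : |x - 0| ≤ 1 := by rw [sub_zero, abs_of_nonneg hx.1]; exact hx.2
    have h3 : L * |x - 0| ≤ |L| * 1 := by
      calc _ ≤ |L| * |x - 0| := by gcongr; exact le_abs_self L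
        _ ≤ _ := by gcongr
    have h4 := abs_sub_abs_le_abs_sub (s x) (s 0)
    linarith
  refine LipschitzOnWith.continuousOn (K := ⟨|s 0| + |L|, by positivity⟩)
    (LipschitzOnWith.of_dist_le_mul ?_)
  intro x hx y hy
  rw [Real.dist_eq, Real.dist_eq]
  have h1 := h.supergradient x hx y hy
  have h2 := h.supergradient y hy x hx
  have h3 := hb x hx
  have h4 := hb y hy
  have h5 : |(y - x) * s x| ≤ (|s 0| + |L|) * |x - y| := by
    rw [abs_mul, abs_sub_comm y x, mul_comm]; gcongr
  have h6 : |(x - y) * s y| ≤ (|s 0| + |L|) * |x - y| := by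
    rw [abs_mul, mul_comm]; gcongr
  show |η x - η y| ≤ (|s 0| + |L|) * |x - y|
  have h7 := neg_abs_le ((y - x) * s x)
  have h8 := le_abs_self ((x - y) * s y)
  rw [abs_le]
  constructor
  · have := le_abs_self ((y - x) * s x)
    linarith
  · linarith

theorem hasDerivAt (h : IsEnvelope η s) {x : ℝ} (hx : x ∈ Ioo (0 : ℝ) 1) : HasDerivAt η (s x) x := by
  obtain ⟨L, hL⟩ := h.lipschitz
  have hO : (fun y => η y - η x - (y - x) * s x) =O[𝓝 x] fun y => ‖y - x‖ ^ 2 := by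
    refine Asymptotics.IsBigO.of_bound |L| ?_
    filter_upwards [Icc_mem_nhds hx.1 hx.2] with y hy
    have h1 := h.abs_sub_le (Ioo_subset_Icc_self hx) hy
    have h2 := hL y hy x (Ioo_subset_Icc_self hx)
    have e : ‖‖y - x‖ ^ 2‖ = |y - x| ^ 2 := by rw [norm_pow, norm_norm, Real.norm_eq_abs]
    rw [e, Real.norm_eq_abs]
    calc _ ≤ |y - x| * |s y - s x| := h1
      _ ≤ |y - x| * (|L| * |y - x|) := by
          gcongr
          refine h2.trans ?_
          gcongr
          exact le_abs_self L
      _ = _ := by ring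
  have h1 : HasDerivAt (fun y => η y - η x - (y - x) * s x) 0 x := by
    have := hO.hasFDerivAt (𝕜 := ℝ) one_lt_two
    simpa using this.hasDerivAt
  have h2 : HasDerivAt (fun y => η x + (y - x) * s x) (s x) x := by
    have := (((hasDerivAt_id x).sub_const x).mul_const (s x)).const_add (η x)
    simpa using this
  have h3 := h1.add h2
  rw [zero_add] at h3
  refine h3.congr_of_eventuallyEq (Eventually.of_forall fun y => ?_)
  simp

/-- The derivative `s x + M x` is monotone. Difference bounds on `s` replace bounds on a second
derivative, which need not exist: the density of the arc jumps at the ends of its range. -/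
theorem convexOn_add_sq (h : IsEnvelope η s) {p p' M : ℝ} (hp : 0 ≤ p) (hp' : p' ≤ 1)
    (hM : ∀ x ∈ Icc p p', ∀ y ∈ Icc p p', x ≤ y → s x - s y ≤ M * (y - x)) :
    ConvexOn ℝ (Icc p p') (fun x => η x + M * x ^ 2 / 2) := by
  have hsub : Icc p p' ⊆ Icc 0 1 := Icc_subset_Icc hp hp'
  have hder : ∀ x ∈ interior (Icc p p'), HasDerivAt (fun x => η x + M * x ^ 2 / 2) (s x + M * x) x := by
    intro x hx
    rw [interior_Icc] at hx
    have h1 := h.hasDerivAt (x := x) ⟨by linarith [hx.1], by linarith [hx.2]⟩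
    have h2 : HasDerivAt (fun x : ℝ => M * x ^ 2 / 2) (M * x) x := by
      have := ((hasDerivAt_pow 2 x).const_mul M).div_const 2
      refine this.congr_deriv ?_
      push_cast; ring
    exact h1.add h2
  refine MonotoneOn.convexOn_of_deriv (convex_Icc _ _)
    ((h.continuousOn.mono hsub).add (by fun_prop))
    (fun x hx => (hder x hx).differentiableAt.differentiableWithinAt) ?_
  intro x hx y hy hxy
  rw [(hder x hx).deriv, (hder y hy).deriv]
  have := hM x (interior_subset hx) y (interior_subset hy) hxy
  linarith

theorem concaveOn_add_sq (h : IsEnvelope η s) {p p' m : ℝ} (hp : 0 ≤ p) (hp' : p' ≤ 1)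
    (hm : ∀ x ∈ Icc p p', ∀ y ∈ Icc p p', x ≤ y → m * (y - x) ≤ s x - s y) :
    ConcaveOn ℝ (Icc p p') (fun x => η x + m * x ^ 2 / 2) := by
  have hsub : Icc p p' ⊆ Icc 0 1 := Icc_subset_Icc hp hp'
  have hder : ∀ x ∈ interior (Icc p p'), HasDerivAt (fun x => η x + m * x ^ 2 / 2) (s x + m * x) x := by
    intro x hx
    rw [interior_Icc] at hx
    have h1 := h.hasDerivAt (x := x) ⟨by linarith [hx.1], by linarith [hx.2]⟩
    have h2 : HasDerivAt (fun x : ℝ => m * x ^ 2 / 2) (m * x) x := by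
      have := ((hasDerivAt_pow 2 x).const_mul m).div_const 2
      refine this.congr_deriv ?_
      push_cast; ring
    exact h1.add h2
  refine AntitoneOn.concaveOn_of_deriv (convex_Icc _ _)
    ((h.continuousOn.mono hsub).add (by fun_prop))
    (fun x hx => (hder x hx).differentiableAt.differentiableWithinAt) ?_
  intro x hx y hy hxy
  rw [(hder x hx).deriv, (hder y hy).deriv]
  have := hm x (interior_subset hx) y (interior_subset hy) hxy
  linarith

end IsEnvelope

/-- The Jensen gap of a pure square. Comparing `η` with parabolas therefore reduces its gap to this
explicit variance. -/
theorem weighted_sq_identity {B D : ℝ} (hB : 0 < B) (hD : 0 < D) (x y : ℝ) :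
    B * x ^ 2 + D * y ^ 2 - (B + D) * ((B * x + D * y) / (B + D)) ^ 2 =
      B * D / (B + D) * (x - y) ^ 2 := by
  field_simp
  ring

/-- Jensen's inequality for a function with one-sidedly bounded second derivative. -/
theorem ConvexOn.weighted_defect_le {η : ℝ → ℝ} {S : Set ℝ} {M : ℝ}
    (h : ConvexOn ℝ S (fun x => η x + M * x ^ 2 / 2)) {B D x y : ℝ} (hB : 0 < B) (hD : 0 < D)
    (hx : x ∈ S) (hy : y ∈ S) :
    (B + D) * η ((B * x + D * y) / (B + D)) - B * η x - D * η y ≤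
      M / 2 * (B * D / (B + D) * (x - y) ^ 2) := by
  have hBD : 0 < B + D := by linarith
  have h1 := h.2 hx hy (show 0 ≤ B / (B + D) by positivity)
    (show 0 ≤ D / (B + D) by positivity)
    (by field_simp)
  simp only [smul_eq_mul] at h1
  have e : B / (B + D) * x + D / (B + D) * y = (B * x + D * y) / (B + D) := by field_simp
  rw [e] at h1
  have h2 := mul_le_mul_of_nonneg_left h1 hBD.le
  have e2 : (B + D) * (B / (B + D) * (η x + M * x ^ 2 / 2) + D / (B + D) * (η y + M * y ^ 2 / 2)) =
      B * η x + D * η y + M / 2 * (B * x ^ 2 + D * y ^ 2) := by field_simp; ring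
  rw [e2] at h2
  rw [← weighted_sq_identity hB hD]
  linarith

theorem ConcaveOn.le_weighted_defect {η : ℝ → ℝ} {S : Set ℝ} {m : ℝ}
    (h : ConcaveOn ℝ S (fun x => η x + m * x ^ 2 / 2)) {B D x y : ℝ} (hB : 0 < B) (hD : 0 < D)
    (hx : x ∈ S) (hy : y ∈ S) :
    m / 2 * (B * D / (B + D) * (x - y) ^ 2) ≤
      (B + D) * η ((B * x + D * y) / (B + D)) - B * η x - D * η y := by
  have h1 : ConvexOn ℝ S (fun x => (-η) x + (-m) * x ^ 2 / 2) := by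
    refine h.neg.congr fun x _ => ?_
    simp only [Pi.neg_apply]; ring
  have := h1.weighted_defect_le hB hD hx hy
  simp only [Pi.neg_apply] at this
  linarith


/-! ### Descending arcs parametrized by their normal weight -/

/-- A plane arc `(X, Y)` on `[0, 1]` of class `C³` with nonvanishing curvature, given with its first
two derivatives. -/
structure IsInflectionFree (X Y X1 Y1 X2 Y2 : ℝ → ℝ) : Prop where
  hasDeriv_fst : ∀ t ∈ Icc (0 : ℝ) 1, HasDerivWithinAt X (X1 t) (Icc 0 1) t
  hasDeriv_snd : ∀ t ∈ Icc (0 : ℝ) 1, HasDerivWithinAt Y (Y1 t) (Icc 0 1) t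
  hasDeriv_fst' : ∀ t ∈ Icc (0 : ℝ) 1, HasDerivWithinAt X1 (X2 t) (Icc 0 1) t
  hasDeriv_snd' : ∀ t ∈ Icc (0 : ℝ) 1, HasDerivWithinAt Y1 (Y2 t) (Icc 0 1) t
  contDiff_fst : ContDiffOn ℝ 1 X1 (Icc 0 1)
  contDiff_snd : ContDiffOn ℝ 1 Y1 (Icc 0 1)
  contDiff_fst' : ContDiffOn ℝ 1 X2 (Icc 0 1)
  contDiff_snd' : ContDiffOn ℝ 1 Y2 (Icc 0 1)
  det_ne_zero : ∀ t ∈ Icc (0 : ℝ) 1, X1 t * Y2 t - Y1 t * X2 t ≠ 0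

/-- An arc with nonvanishing curvature that runs down and to the right and stays weakly below its
chord. -/
structure IsDescendingArc (X Y X1 Y1 X2 Y2 : ℝ → ℝ) : Prop
    extends IsInflectionFree X Y X1 Y1 X2 Y2 where
  monotoneOn : MonotoneOn X (Icc 0 1)
  antitoneOn : AntitoneOn Y (Icc 0 1)
  le_chord : ∀ t ∈ Icc (0 : ℝ) 1, ∃ θ ∈ Icc (0 : ℝ) 1,
    X t = (1 - θ) * X 0 + θ * X 1 ∧ Y t ≤ (1 - θ) * Y 0 + θ * Y 1

/-- The weight `x` for which the direction `(x, 1 - x)` is normal to the velocity `(X1, Y1)`. -/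
noncomputable def normalWeight (X1 Y1 : ℝ → ℝ) (t : ℝ) : ℝ := -Y1 t / (X1 t - Y1 t)

/-- The density of `X - Y` with respect to `normalWeight`. -/
noncomputable def normalDensity (X1 Y1 X2 Y2 : ℝ → ℝ) (t : ℝ) : ℝ :=
  (X1 t - Y1 t) ^ 3 / (X1 t * Y2 t - Y1 t * X2 t)

theorem hasDerivWithinAt_interior_Icc {f : ℝ → ℝ} {f' a b t : ℝ} (ha : 0 ≤ a) (hb : b ≤ 1)
    (h : HasDerivWithinAt f f' (Icc 0 1) t) :
    HasDerivWithinAt f f' (interior (Icc a b)) t :=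
  h.mono (interior_subset.trans (Icc_subset_Icc ha hb))

namespace IsDescendingArc

variable {X Y X1 Y1 X2 Y2 : ℝ → ℝ}

theorem fst_nonneg (hc : IsDescendingArc X Y X1 Y1 X2 Y2) {t : ℝ} (ht : t ∈ Icc (0 : ℝ) 1) :
    0 ≤ X1 t := by
  have := hc.monotoneOn.derivWithin_nonneg (x := t)
  rwa [(hc.hasDeriv_fst t ht).derivWithin (uniqueDiffOn_Icc zero_lt_one t ht)] at this

theorem snd_nonpos (hc : IsDescendingArc X Y X1 Y1 X2 Y2) {t : ℝ} (ht : t ∈ Icc (0 : ℝ) 1) :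
    Y1 t ≤ 0 := by
  have := hc.antitoneOn.derivWithin_nonpos (x := t)
  rwa [(hc.hasDeriv_snd t ht).derivWithin (uniqueDiffOn_Icc zero_lt_one t ht)] at this

theorem sub_pos (hc : IsDescendingArc X Y X1 Y1 X2 Y2) {t : ℝ} (ht : t ∈ Icc (0 : ℝ) 1) :
    0 < X1 t - Y1 t := by
  have h1 := hc.fst_nonneg ht
  have h2 := hc.snd_nonpos ht
  refine lt_of_le_of_ne (by linarith) fun h => hc.det_ne_zero t ht ?_
  have h3 : X1 t = 0 := by linarith
  have h4 : Y1 t = 0 := by linarith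
  rw [h3, h4]; ring

theorem continuousOn_det (hc : IsDescendingArc X Y X1 Y1 X2 Y2) :
    ContinuousOn (fun t => X1 t * Y2 t - Y1 t * X2 t) (Icc 0 1) :=
  (hc.contDiff_fst.continuousOn.mul hc.contDiff_snd'.continuousOn).sub
    (hc.contDiff_snd.continuousOn.mul hc.contDiff_fst'.continuousOn)

theorem hasDerivWithinAt_normalWeight (hc : IsDescendingArc X Y X1 Y1 X2 Y2) {t : ℝ}
    (ht : t ∈ Icc (0 : ℝ) 1) :
    HasDerivWithinAt (normalWeight X1 Y1)
      (-(X1 t * Y2 t - Y1 t * X2 t) / (X1 t - Y1 t) ^ 2) (Icc 0 1) t := by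
  have h1 := hc.hasDeriv_fst' t ht
  have h2 := hc.hasDeriv_snd' t ht
  refine ((h2.neg).div (h1.sub h2) (hc.sub_pos ht).ne').congr_deriv ?_
  simp only [Pi.neg_apply, Pi.sub_apply]
  ring

theorem continuousOn_normalWeight (hc : IsDescendingArc X Y X1 Y1 X2 Y2) :
    ContinuousOn (normalWeight X1 Y1) (Icc 0 1) := fun _ ht =>
  (hc.hasDerivWithinAt_normalWeight ht).continuousWithinAt

theorem hasDerivWithinAt_weighted (hc : IsDescendingArc X Y X1 Y1 X2 Y2) (x : ℝ) {t : ℝ}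
    (ht : t ∈ Icc (0 : ℝ) 1) :
    HasDerivWithinAt (fun t => x * X t + (1 - x) * Y t)
      ((X1 t - Y1 t) * (x - normalWeight X1 Y1 t)) (Icc 0 1) t := by
  refine (((hc.hasDeriv_fst t ht).const_mul x).add
    ((hc.hasDeriv_snd t ht).const_mul (1 - x))).congr_deriv ?_
  have := (hc.sub_pos ht).ne'
  rw [normalWeight]
  field_simp
  ring

theorem continuousOn_weighted (hc : IsDescendingArc X Y X1 Y1 X2 Y2) (x : ℝ) :
    ContinuousOn (fun t => x * X t + (1 - x) * Y t) (Icc 0 1) := fun _ ht =>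
  (hc.hasDerivWithinAt_weighted x ht).continuousWithinAt

theorem normalWeight_mem (hc : IsDescendingArc X Y X1 Y1 X2 Y2) {t : ℝ} (ht : t ∈ Icc (0 : ℝ) 1) :
    normalWeight X1 Y1 t ∈ Icc (0 : ℝ) 1 := by
  have h1 := hc.fst_nonneg ht
  have h2 := hc.snd_nonpos ht
  have h3 := hc.sub_pos ht
  exact ⟨div_nonneg (by linarith) h3.le, (div_le_one h3).mpr (by linarith)⟩

/-- By continuity the determinant has one sign. Were it negative, `normalWeight` would increase, and
for the weight `x` normal at the midpoint the function `x X + (1 - x) Y` would have a strict maximum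
there. The midpoint would then lie above the chord. -/
theorem det_pos (hc : IsDescendingArc X Y X1 Y1 X2 Y2) {t : ℝ} (ht : t ∈ Icc (0 : ℝ) 1) :
    0 < X1 t * Y2 t - Y1 t * X2 t := by
  by_contra hneg
  have hall : ∀ r ∈ Icc (0 : ℝ) 1, X1 r * Y2 r - Y1 r * X2 r < 0 := by
    intro r hr
    by_contra hr0
    obtain ⟨z, hz, hz0⟩ := isPreconnected_Icc.intermediate_value ht hr hc.continuousOn_det
      ⟨not_lt.mp hneg, not_lt.mp hr0⟩
    exact hc.det_ne_zero z hz hz0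
  have hmono : StrictMonoOn (normalWeight X1 Y1) (Icc 0 1) := by
    refine strictMonoOn_of_hasDerivWithinAt_pos (convex_Icc _ _) hc.continuousOn_normalWeight
      (fun r hr => hasDerivWithinAt_interior_Icc le_rfl le_rfl
        (hc.hasDerivWithinAt_normalWeight (interior_subset hr))) fun r hr => ?_
    have := hall r (interior_subset hr)
    have := hc.sub_pos (interior_subset hr)
    apply div_pos <;> [linarith; positivity]
  have hmid : (1 / 2 : ℝ) ∈ Icc (0 : ℝ) 1 := by constructor <;> norm_num
  set x := normalWeight X1 Y1 (1 / 2) with hx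
  have hx01 : x ∈ Icc (0 : ℝ) 1 := hc.normalWeight_mem hmid
  have hcont := hc.continuousOn_weighted x
  have h1 : StrictMonoOn (fun t => x * X t + (1 - x) * Y t) (Icc 0 (1 / 2)) := by
    refine strictMonoOn_of_hasDerivWithinAt_pos (convex_Icc _ _)
      (hcont.mono (Icc_subset_Icc le_rfl (by norm_num)))
      (fun r hr => hasDerivWithinAt_interior_Icc le_rfl (by norm_num)
        (hc.hasDerivWithinAt_weighted x
          (Icc_subset_Icc le_rfl (by norm_num) (interior_subset hr)))) fun r hr => ?_
    rw [interior_Icc] at hr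
    have hr' : r ∈ Icc (0 : ℝ) 1 := ⟨hr.1.le, by linarith [hr.2]⟩
    exact mul_pos (hc.sub_pos hr') (_root_.sub_pos.mpr (hmono hr' hmid hr.2))
  have h2 : StrictAntiOn (fun t => x * X t + (1 - x) * Y t) (Icc (1 / 2) 1) := by
    refine strictAntiOn_of_hasDerivWithinAt_neg (convex_Icc _ _)
      (hcont.mono (Icc_subset_Icc (by norm_num) le_rfl))
      (fun r hr => hasDerivWithinAt_interior_Icc (by norm_num) le_rfl
        (hc.hasDerivWithinAt_weighted x
          (Icc_subset_Icc (by norm_num) le_rfl (interior_subset hr)))) fun r hr => ?_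
    rw [interior_Icc] at hr
    have hr' : r ∈ Icc (0 : ℝ) 1 := ⟨by linarith [hr.1], hr.2.le⟩
    exact mul_neg_of_pos_of_neg (hc.sub_pos hr') (sub_neg.mpr (hmono hmid hr' hr.1))
  have h3 := h1 (a := 0) (b := 1 / 2) (by constructor <;> norm_num) (by constructor <;> norm_num)
    (by norm_num)
  have h4 := h2 (a := 1 / 2) (b := 1) (by constructor <;> norm_num) (by constructor <;> norm_num)
    (by norm_num)
  obtain ⟨θ, hθ, e1, e2⟩ := hc.le_chord _ hmid
  simp only at h3 h4
  have h5 : (1 - x) * Y (1 / 2) ≤ (1 - x) * ((1 - θ) * Y 0 + θ * Y 1) :=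
    mul_le_mul_of_nonneg_left e2 (by linarith [hx01.2])
  have h6 : x * X (1 / 2) = x * ((1 - θ) * X 0 + θ * X 1) := by rw [e1]
  have h7 := mul_le_mul_of_nonneg_left h3.le (by linarith [hθ.2] : 0 ≤ 1 - θ)
  have h8 := mul_le_mul_of_nonneg_left h4.le hθ.1
  rcases eq_or_lt_of_le hθ.1 with h0 | h0
  · subst h0; linarith
  · have h8 := mul_lt_mul_of_pos_left h4 h0
    linarith

theorem strictAntiOn_normalWeight (hc : IsDescendingArc X Y X1 Y1 X2 Y2) :
    StrictAntiOn (normalWeight X1 Y1) (Icc 0 1) := by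
  refine strictAntiOn_of_hasDerivWithinAt_neg (convex_Icc _ _) hc.continuousOn_normalWeight
    (fun r hr => hasDerivWithinAt_interior_Icc le_rfl le_rfl
      (hc.hasDerivWithinAt_normalWeight (interior_subset hr))) fun r hr => ?_
  have := hc.det_pos (interior_subset hr)
  have := hc.sub_pos (interior_subset hr)
  apply div_neg_of_neg_of_pos <;> [linarith; positivity]

theorem normalDensity_pos (hc : IsDescendingArc X Y X1 Y1 X2 Y2) {t : ℝ} (ht : t ∈ Icc (0 : ℝ) 1) :
    0 < normalDensity X1 Y1 X2 Y2 t :=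
  div_pos (pow_pos (hc.sub_pos ht) 3) (hc.det_pos ht)

/-- The ratio of the derivative of `X - Y` to that of `-normalWeight` is `normalDensity`, so a bound
on the latter makes `(X - Y) + M * normalWeight` antitone. -/
theorem sub_le_mul_of_normalDensity_le (hc : IsDescendingArc X Y X1 Y1 X2 Y2) {t₁ t₂ M : ℝ}
    (h1 : 0 ≤ t₁) (h12 : t₁ ≤ t₂) (h2 : t₂ ≤ 1)
    (hM : ∀ t ∈ Icc t₁ t₂, normalDensity X1 Y1 X2 Y2 t ≤ M) :
    (X t₂ - Y t₂) - (X t₁ - Y t₁) ≤ M * (normalWeight X1 Y1 t₁ - normalWeight X1 Y1 t₂) := by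
  have hsub : Icc t₁ t₂ ⊆ Icc 0 1 := Icc_subset_Icc h1 h2
  have hder : ∀ t ∈ Icc (0 : ℝ) 1, HasDerivWithinAt (fun t => (X t - Y t) + M * normalWeight X1 Y1 t)
      ((X1 t - Y1 t) + M * (-(X1 t * Y2 t - Y1 t * X2 t) / (X1 t - Y1 t) ^ 2)) (Icc 0 1) t :=
    fun t ht => ((hc.hasDeriv_fst t ht).sub (hc.hasDeriv_snd t ht)).add
      ((hc.hasDerivWithinAt_normalWeight ht).const_mul M)
  have h := antitoneOn_of_hasDerivWithinAt_nonpos (convex_Icc t₁ t₂)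
    (fun t ht => (hder t (hsub ht)).continuousWithinAt.mono hsub)
    (fun t ht => hasDerivWithinAt_interior_Icc h1 h2 (hder t (hsub (interior_subset ht))))
    fun t ht => by
      have ht' := interior_subset ht
      have hu := hc.sub_pos (hsub ht')
      have hd := hc.det_pos (hsub ht')
      have := hM t ht'
      rw [normalDensity, div_le_iff₀ hd] at this
      have e : (X1 t - Y1 t) + M * (-(X1 t * Y2 t - Y1 t * X2 t) / (X1 t - Y1 t) ^ 2) =
        ((X1 t - Y1 t) ^ 3 - M * (X1 t * Y2 t - Y1 t * X2 t)) / (X1 t - Y1 t) ^ 2 := by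
        field_simp; ring
      rw [e]
      exact div_nonpos_of_nonpos_of_nonneg (by linarith) (by positivity)
  have := h (left_mem_Icc.mpr h12) (right_mem_Icc.mpr h12) h12
  simp only at this
  linarith

theorem mul_le_sub_of_le_normalDensity (hc : IsDescendingArc X Y X1 Y1 X2 Y2) {t₁ t₂ m : ℝ}
    (h1 : 0 ≤ t₁) (h12 : t₁ ≤ t₂) (h2 : t₂ ≤ 1)
    (hm : ∀ t ∈ Icc t₁ t₂, m ≤ normalDensity X1 Y1 X2 Y2 t) :
    m * (normalWeight X1 Y1 t₁ - normalWeight X1 Y1 t₂) ≤ (X t₂ - Y t₂) - (X t₁ - Y t₁) := by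
  have hsub : Icc t₁ t₂ ⊆ Icc 0 1 := Icc_subset_Icc h1 h2
  have hder : ∀ t ∈ Icc (0 : ℝ) 1, HasDerivWithinAt (fun t => (X t - Y t) + m * normalWeight X1 Y1 t)
      ((X1 t - Y1 t) + m * (-(X1 t * Y2 t - Y1 t * X2 t) / (X1 t - Y1 t) ^ 2)) (Icc 0 1) t :=
    fun t ht => ((hc.hasDeriv_fst t ht).sub (hc.hasDeriv_snd t ht)).add
      ((hc.hasDerivWithinAt_normalWeight ht).const_mul m)
  have h := monotoneOn_of_hasDerivWithinAt_nonneg (convex_Icc t₁ t₂)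
    (fun t ht => (hder t (hsub ht)).continuousWithinAt.mono hsub)
    (fun t ht => hasDerivWithinAt_interior_Icc h1 h2 (hder t (hsub (interior_subset ht))))
    fun t ht => by
      have ht' := interior_subset ht
      have hu := hc.sub_pos (hsub ht')
      have hd := hc.det_pos (hsub ht')
      have := hm t ht'
      rw [normalDensity, le_div_iff₀ hd] at this
      have e : (X1 t - Y1 t) + m * (-(X1 t * Y2 t - Y1 t * X2 t) / (X1 t - Y1 t) ^ 2) =
        ((X1 t - Y1 t) ^ 3 - m * (X1 t * Y2 t - Y1 t * X2 t)) / (X1 t - Y1 t) ^ 2 := by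
        field_simp; ring
      rw [e]
      exact div_nonneg (by linarith) (by positivity)
  have := h (left_mem_Icc.mpr h12) (right_mem_Icc.mpr h12) h12
  simp only at this
  linarith

/-- The third derivative enters here: the density involves second derivatives, so class `C³` makes
it `C¹`, and a positive `C¹` function on a compact interval has Lipschitz powers. -/
theorem exists_abs_normalDensity_rpow_sub_le (hc : IsDescendingArc X Y X1 Y1 X2 Y2) :
    ∃ L : ℝ, 0 ≤ L ∧ ∀ t ∈ Icc (0 : ℝ) 1, ∀ r ∈ Icc (0 : ℝ) 1,
      |normalDensity X1 Y1 X2 Y2 t ^ (2 / 3 : ℝ) - normalDensity X1 Y1 X2 Y2 r ^ (2 / 3 : ℝ)| ≤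
        L * |t - r| := by
  have h1 : ContDiffOn ℝ 1 (normalDensity X1 Y1 X2 Y2) (Icc 0 1) :=
    ((hc.contDiff_fst.sub hc.contDiff_snd).pow 3).div
      ((hc.contDiff_fst.mul hc.contDiff_snd').sub (hc.contDiff_snd.mul hc.contDiff_fst'))
      hc.det_ne_zero
  have h2 : ContDiffOn ℝ 1 (fun t => normalDensity X1 Y1 X2 Y2 t ^ (2 / 3 : ℝ)) (Icc 0 1) :=
    h1.rpow_const_of_ne fun t ht => (hc.normalDensity_pos ht).ne'
  obtain ⟨K, hK⟩ := (h2.locallyLipschitzOn (convex_Icc _ _)).exists_lipschitzOnWith_of_compact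
    isCompact_Icc
  exact ⟨K, K.2, fun t ht r hr => hK.dist_le_mul t ht r hr⟩

/-- The speed of `normalWeight` has a positive minimum on the compact interval, so its inverse is
Lipschitz and the density is Lipschitz also as a function of the weight. -/
theorem exists_mul_abs_sub_le (hc : IsDescendingArc X Y X1 Y1 X2 Y2) :
    ∃ c : ℝ, 0 < c ∧ ∀ t ∈ Icc (0 : ℝ) 1, ∀ r ∈ Icc (0 : ℝ) 1,
      c * |t - r| ≤ |normalWeight X1 Y1 t - normalWeight X1 Y1 r| := by
  have hcont : ContinuousOn (fun t => (X1 t * Y2 t - Y1 t * X2 t) / (X1 t - Y1 t) ^ 2) (Icc 0 1) :=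
    hc.continuousOn_det.div ((hc.contDiff_fst.continuousOn.sub hc.contDiff_snd.continuousOn).pow 2)
      fun t ht => (pow_pos (hc.sub_pos ht) 2).ne'
  obtain ⟨t₀, ht₀, hmin⟩ := isCompact_Icc.exists_isMinOn (nonempty_Icc.mpr zero_le_one) hcont
  set c := (X1 t₀ * Y2 t₀ - Y1 t₀ * X2 t₀) / (X1 t₀ - Y1 t₀) ^ 2 with hcdef
  have hc0 : 0 < c := div_pos (hc.det_pos ht₀) (pow_pos (hc.sub_pos ht₀) 2)
  have hder : ∀ t ∈ Icc (0 : ℝ) 1, HasDerivWithinAt (fun t => normalWeight X1 Y1 t + c * t)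
      (-(X1 t * Y2 t - Y1 t * X2 t) / (X1 t - Y1 t) ^ 2 + c * 1) (Icc 0 1) t :=
    fun t ht => (hc.hasDerivWithinAt_normalWeight ht).add ((hasDerivWithinAt_id _ _).const_mul c)
  have hanti := antitoneOn_of_hasDerivWithinAt_nonpos (convex_Icc (0 : ℝ) 1)
    (fun t ht => (hder t ht).continuousWithinAt)
    (fun t ht => hasDerivWithinAt_interior_Icc le_rfl le_rfl (hder t (interior_subset ht)))
    fun t ht => by
      have := hmin (interior_subset ht)
      simp only [Set.mem_ofPred_eq] at this
      rw [neg_div]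
      linarith
  have key : ∀ t ∈ Icc (0 : ℝ) 1, ∀ r ∈ Icc (0 : ℝ) 1, t ≤ r →
      c * |t - r| ≤ |normalWeight X1 Y1 t - normalWeight X1 Y1 r| := by
    intro t ht r hr htr
    have h1 := hanti ht hr htr
    simp only at h1
    rw [abs_sub_comm t r, abs_of_nonneg (by linarith : 0 ≤ r - t)]
    refine le_trans ?_ (le_abs_self _)
    linarith
  refine ⟨c, hc0, fun t ht r hr => ?_⟩
  rcases le_total t r with h | h
  · exact key t ht r hr h
  · rw [abs_sub_comm t r, abs_sub_comm (normalWeight X1 Y1 t)]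
    exact key r hr t ht h

end IsDescendingArc


/-! ### Points of contact and the support function -/

namespace IsDescendingArc

variable {X Y X1 Y1 X2 Y2 : ℝ → ℝ}

/-- `T x` is the parameter at which `normalWeight` takes the value nearest to `x`. -/
def IsContact (X1 Y1 T : ℝ → ℝ) : Prop :=
  ∀ x, T x ∈ Icc (0 : ℝ) 1 ∧
    normalWeight X1 Y1 (T x) = max (normalWeight X1 Y1 1) (min x (normalWeight X1 Y1 0))

/-- The `2/3`-power of the density at the point of contact, cut off outside the range of
`normalWeight`. -/
noncomputable def contactDensity (X1 Y1 X2 Y2 T : ℝ → ℝ) : ℝ → ℝ :=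
  (Icc (normalWeight X1 Y1 1) (normalWeight X1 Y1 0)).indicator
    fun x => normalDensity X1 Y1 X2 Y2 (T x) ^ (2 / 3 : ℝ)

theorem normalWeight_one_le (hc : IsDescendingArc X Y X1 Y1 X2 Y2) :
    normalWeight X1 Y1 1 ≤ normalWeight X1 Y1 0 :=
  hc.strictAntiOn_normalWeight.antitoneOn (by simp) (by simp) zero_le_one

theorem exists_isContact (hc : IsDescendingArc X Y X1 Y1 X2 Y2) : ∃ T, IsContact X1 Y1 T := by
  have h : ∀ x : ℝ, ∃ t ∈ Icc (0 : ℝ) 1,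
      normalWeight X1 Y1 t = max (normalWeight X1 Y1 1) (min x (normalWeight X1 Y1 0)) := by
    intro x
    exact isPreconnected_Icc.intermediate_value (by simp) (by simp) hc.continuousOn_normalWeight
      ⟨le_max_left _ _, max_le hc.normalWeight_one_le (min_le_right _ _)⟩
  choose T h1 h2 using h
  exact ⟨T, fun x => ⟨h1 x, h2 x⟩⟩

variable {T : ℝ → ℝ}

theorem contact_of_mem (hc : IsDescendingArc X Y X1 Y1 X2 Y2) (hT : IsContact X1 Y1 T) {t : ℝ}
    (ht : t ∈ Icc (0 : ℝ) 1) : T (normalWeight X1 Y1 t) = t := by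
  have hanti := hc.strictAntiOn_normalWeight
  refine hanti.injOn (hT _).1 ht ?_
  rw [(hT _).2, min_eq_left (hanti.antitoneOn (by simp) ht ht.1),
    max_eq_right (hanti.antitoneOn ht (by simp) ht.2)]

theorem normalWeight_mem_Icc (hc : IsDescendingArc X Y X1 Y1 X2 Y2) {t : ℝ}
    (ht : t ∈ Icc (0 : ℝ) 1) :
    normalWeight X1 Y1 t ∈ Icc (normalWeight X1 Y1 1) (normalWeight X1 Y1 0) :=
  ⟨hc.strictAntiOn_normalWeight.antitoneOn ht (by simp) ht.2,
    hc.strictAntiOn_normalWeight.antitoneOn (by simp) ht ht.1⟩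

theorem normalWeight_contact (hT : IsContact X1 Y1 T) {x : ℝ}
    (hx : x ∈ Icc (normalWeight X1 Y1 1) (normalWeight X1 Y1 0)) :
    normalWeight X1 Y1 (T x) = x := by
  rw [(hT x).2, min_eq_left hx.2, max_eq_right hx.1]

theorem contactDensity_normalWeight (hc : IsDescendingArc X Y X1 Y1 X2 Y2) (hT : IsContact X1 Y1 T)
    {t : ℝ} (ht : t ∈ Icc (0 : ℝ) 1) :
    contactDensity X1 Y1 X2 Y2 T (normalWeight X1 Y1 t) =
      normalDensity X1 Y1 X2 Y2 t ^ (2 / 3 : ℝ) := by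
  rw [contactDensity, Set.indicator_of_mem (hc.normalWeight_mem_Icc ht), hc.contact_of_mem hT ht]

theorem contact_antitone (hc : IsDescendingArc X Y X1 Y1 X2 Y2) (hT : IsContact X1 Y1 T) :
    Antitone T := by
  intro x y hxy
  by_contra h
  have h1 := hc.strictAntiOn_normalWeight (hT x).1 (hT y).1 (not_le.mp h)
  rw [(hT x).2, (hT y).2] at h1
  exact absurd h1 (not_lt.mpr (max_le_max_left _ (min_le_min_right _ hxy)))

/-- The derivative of `x X + (1 - x) Y` is a positive multiple of `x - normalWeight`, which is
nonpositive before `T x` and nonnegative after it because `normalWeight` decreases. For clamped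
weights only one of the two ranges is nontrivial and the minimum is an endpoint. -/
theorem isLeast_contact (hc : IsDescendingArc X Y X1 Y1 X2 Y2) (hT : IsContact X1 Y1 T) (x : ℝ) :
    IsLeast ((fun t => x * X t + (1 - x) * Y t) '' Icc 0 1) (x * X (T x) + (1 - x) * Y (T x)) := by
  have hTx := (hT x).1
  have hanti := hc.strictAntiOn_normalWeight
  refine ⟨⟨T x, hTx, rfl⟩, ?_⟩
  rintro _ ⟨t, ht, rfl⟩
  have hcont := hc.continuousOn_weighted x
  rcases le_total t (T x) with h | h
  · refine antitoneOn_of_hasDerivWithinAt_nonpos (convex_Icc 0 (T x))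
      (hcont.mono (Icc_subset_Icc le_rfl hTx.2))
      (fun r hr => hasDerivWithinAt_interior_Icc le_rfl hTx.2
        (hc.hasDerivWithinAt_weighted x (Icc_subset_Icc le_rfl hTx.2 (interior_subset hr))))
      (fun r hr => ?_) ⟨ht.1, h⟩ ⟨hTx.1, le_rfl⟩ h
    rw [interior_Icc] at hr
    have hr' : r ∈ Icc (0 : ℝ) 1 := ⟨hr.1.le, hr.2.le.trans hTx.2⟩
    refine mul_nonpos_of_nonneg_of_nonpos (hc.sub_pos hr').le (sub_nonpos.mpr ?_)
    have h1 := hanti hr' hTx hr.2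
    rw [(hT x).2] at h1
    have h2 := (hc.normalWeight_mem_Icc hr').2
    have h3 := (le_max_right _ _).trans_lt h1
    rcases min_lt_iff.mp h3 with h4 | h4
    · exact h4.le
    · exact absurd h4 (not_lt.mpr h2)
  · refine monotoneOn_of_hasDerivWithinAt_nonneg (convex_Icc (T x) 1)
      (hcont.mono (Icc_subset_Icc hTx.1 le_rfl))
      (fun r hr => hasDerivWithinAt_interior_Icc hTx.1 le_rfl
        (hc.hasDerivWithinAt_weighted x (Icc_subset_Icc hTx.1 le_rfl (interior_subset hr))))
      (fun r hr => ?_) ⟨le_rfl, hTx.2⟩ ⟨h, ht.2⟩ h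
    rw [interior_Icc] at hr
    have hr' : r ∈ Icc (0 : ℝ) 1 := ⟨hTx.1.trans hr.1.le, hr.2.le⟩
    refine mul_nonneg (hc.sub_pos hr').le (sub_nonneg.mpr ?_)
    have h1 := hanti hTx hr' hr.1
    rw [(hT x).2] at h1
    have h2 := (hc.normalWeight_mem_Icc hr').1
    rcases lt_max_iff.mp h1 with h4 | h4
    · exact absurd h4 (not_lt.mpr h2)
    · exact (h4.trans_le (min_le_left _ _)).le

theorem isLipschitzBump (hc : IsDescendingArc X Y X1 Y1 X2 Y2) (hT : IsContact X1 Y1 T) :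
    IsLipschitzBump (contactDensity X1 Y1 X2 Y2 T) (normalWeight X1 Y1 1)
      (normalWeight X1 Y1 0) where
  left_nonneg := (hc.normalWeight_mem (by simp)).1
  le := hc.normalWeight_one_le
  right_le := (hc.normalWeight_mem (by simp)).2
  nonneg := Set.indicator_nonneg fun x _ =>
    Real.rpow_nonneg (hc.normalDensity_pos (hT x).1).le _
  lipschitz := by
    obtain ⟨L, hL, h1⟩ := hc.exists_abs_normalDensity_rpow_sub_le
    obtain ⟨c, hc0, h2⟩ := hc.exists_mul_abs_sub_le
    refine ⟨L / c, by positivity, fun x hx y hy => ?_⟩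
    have h3 := h1 _ (hT x).1 _ (hT y).1
    have h4 := h2 _ (hT x).1 _ (hT y).1
    rw [normalWeight_contact hT hx, normalWeight_contact hT hy] at h4
    rw [contactDensity, Set.indicator_of_mem hx, Set.indicator_of_mem hy]
    refine h3.trans ?_
    rw [div_mul_eq_mul_div, le_div_iff₀ hc0]
    calc _ = L * (c * |T x - T y|) := by ring
      _ ≤ _ := by gcongr
  eq_zero x hx := Set.indicator_of_notMem hx _

/-- If both contact points coincide the left side is zero. Otherwise all weights met between them
lie in `[x, y]`, even when one end is clamped, and the bound on the density applies throughout. -/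
theorem sub_le_of_contactDensity_le (hc : IsDescendingArc X Y X1 Y1 X2 Y2) (hT : IsContact X1 Y1 T)
    {x y M : ℝ} (hxy : x ≤ y) (hM0 : 0 ≤ M)
    (hM : ∀ z ∈ Icc x y, contactDensity X1 Y1 X2 Y2 T z ≤ M) :
    (X (T x) - Y (T x)) - (X (T y) - Y (T y)) ≤ M ^ (3 / 2 : ℝ) * (y - x) := by
  have hanti := hc.strictAntiOn_normalWeight
  have hyx : 0 ≤ y - x := by linarith
  have hMp : 0 ≤ M ^ (3 / 2 : ℝ) := Real.rpow_nonneg hM0 _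
  rcases eq_or_ne (normalWeight X1 Y1 (T x)) (normalWeight X1 Y1 (T y)) with h | h
  · rw [hanti.injOn (hT x).1 (hT y).1 h, sub_self]
    positivity
  have hT' := hc.contact_antitone hT hxy
  have hlt := lt_of_le_of_ne (hanti.antitoneOn (hT y).1 (hT x).1 hT') h
  have hx' : x ≤ normalWeight X1 Y1 (T x) := by
    have h1 := hlt.trans_le (hc.normalWeight_mem_Icc (hT y).1).2
    rw [(hT x).2] at h1 ⊢
    have h2 := (le_max_right _ _).trans_lt h1
    rcases min_lt_iff.mp h2 with h4 | h4
    · rw [min_eq_left h4.le]; exact le_max_right _ _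
    · exact absurd h4 (lt_irrefl _)
  have hy' : normalWeight X1 Y1 (T y) ≤ y := by
    have h1 := (hc.normalWeight_mem_Icc (hT x).1).1.trans_lt hlt
    rw [(hT y).2] at h1 ⊢
    rcases lt_max_iff.mp h1 with h4 | h4
    · exact absurd h4 (lt_irrefl _)
    · rw [max_eq_right h4.le]; exact min_le_left _ _
  have hb := hc.sub_le_mul_of_normalDensity_le (M := M ^ (3 / 2 : ℝ)) (hT y).1.1 hT' (hT x).1.2
    fun t ht => by
      have ht01 : t ∈ Icc (0 : ℝ) 1 := ⟨(hT y).1.1.trans ht.1, ht.2.trans (hT x).1.2⟩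
      have h1 := hM (normalWeight X1 Y1 t)
        ⟨hx'.trans (hanti.antitoneOn ht01 (hT x).1 ht.2),
          (hanti.antitoneOn (hT y).1 ht01 ht.1).trans hy'⟩
      rw [hc.contactDensity_normalWeight hT ht01] at h1
      have hp := (hc.normalDensity_pos ht01).le
      have h2 := Real.rpow_le_rpow (Real.rpow_nonneg hp _) h1 (by norm_num : (0 : ℝ) ≤ 3 / 2)
      rwa [← Real.rpow_mul hp, show (2 / 3 : ℝ) * (3 / 2) = 1 by norm_num, Real.rpow_one] at h2
  refine hb.trans ?_
  gcongr

theorem le_sub_of_le_contactDensity (hc : IsDescendingArc X Y X1 Y1 X2 Y2) (hT : IsContact X1 Y1 T)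
    {x y m : ℝ} (hxy : x ≤ y) (hm0 : 0 ≤ m)
    (hm : ∀ z ∈ Icc x y, m ≤ contactDensity X1 Y1 X2 Y2 T z) :
    m ^ (3 / 2 : ℝ) * (y - x) ≤ (X (T x) - Y (T x)) - (X (T y) - Y (T y)) := by
  have hanti := hc.strictAntiOn_normalWeight
  have hT' := hc.contact_antitone hT hxy
  -- For `m = 0` monotonicity of the arc suffices. For `m > 0` the cut-off density cannot vanish on
  -- `[x, y]`, so no weight there is clamped.
  rcases eq_or_lt_of_le hm0 with h0 | h0
  · rw [← h0, Real.zero_rpow (by norm_num), zero_mul]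
    have h1 := hc.monotoneOn (hT y).1 (hT x).1 hT'
    have h2 := hc.antitoneOn (hT y).1 (hT x).1 hT'
    linarith
  have hmem : ∀ z ∈ Icc x y, z ∈ Icc (normalWeight X1 Y1 1) (normalWeight X1 Y1 0) := by
    intro z hz
    by_contra hne
    have := hm z hz
    rw [contactDensity, Set.indicator_of_notMem hne] at this
    linarith
  have ex := normalWeight_contact hT (hmem x ⟨le_rfl, hxy⟩)
  have ey := normalWeight_contact hT (hmem y ⟨hxy, le_rfl⟩)
  have hb := hc.mul_le_sub_of_le_normalDensity (m := m ^ (3 / 2 : ℝ)) (hT y).1.1 hT' (hT x).1.2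
    fun t ht => by
      have ht01 : t ∈ Icc (0 : ℝ) 1 := ⟨(hT y).1.1.trans ht.1, ht.2.trans (hT x).1.2⟩
      have h1 := hm (normalWeight X1 Y1 t)
        ⟨ex.symm.trans_le (hanti.antitoneOn ht01 (hT x).1 ht.2),
          (hanti.antitoneOn (hT y).1 ht01 ht.1).trans_eq ey⟩
      rw [hc.contactDensity_normalWeight hT ht01] at h1
      have hp := (hc.normalDensity_pos ht01).le
      have h2 := Real.rpow_le_rpow hm0 h1 (by norm_num : (0 : ℝ) ≤ 3 / 2)
      rwa [← Real.rpow_mul hp, show (2 / 3 : ℝ) * (3 / 2) = 1 by norm_num, Real.rpow_one] at h2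
  rwa [ex, ey] at hb

/-- A minimum of functions affine in `x`: evaluating at weight `y` the function of the contact point
of `x` gives a supporting line of slope `X - Y`. -/
theorem isEnvelope (hc : IsDescendingArc X Y X1 Y1 X2 Y2) (hT : IsContact X1 Y1 T) :
    IsEnvelope (fun x => x * X (T x) + (1 - x) * Y (T x)) (fun x => X (T x) - Y (T x)) where
  supergradient x _ y _ := by
    have := (hc.isLeast_contact hT y).2 ⟨T x, (hT x).1, rfl⟩
    simp only at this
    linarith
  lipschitz := by
    have hb := hc.isLipschitzBump hT
    obtain ⟨L, hL, hlip⟩ := hb.lipschitz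
    set h := contactDensity X1 Y1 X2 Y2 T
    set α := normalWeight X1 Y1 1
    set M := h α + L
    have hα := hb.nonneg α
    have hM0 : 0 ≤ M := add_nonneg hα hL
    have hM : ∀ z, h z ≤ M := by
      intro z
      by_cases hz : z ∈ Icc α (normalWeight X1 Y1 0)
      · have h1 := (abs_le.mp (hlip z hz α ⟨le_rfl, hb.le⟩)).2
        have h2 : |z - α| ≤ 1 := by
          have := hb.left_nonneg
          have := hb.right_le
          rw [abs_le]; constructor <;> linarith [hz.1, hz.2]
        have h3 : L * |z - α| ≤ L * 1 := by gcongr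
        show h z ≤ h α + L
        linarith
      · rw [hb.eq_zero z hz]; exact hM0
    have key : ∀ x y : ℝ, x ≤ y → |(X (T x) - Y (T x)) - (X (T y) - Y (T y))| ≤
        M ^ (3 / 2 : ℝ) * |x - y| := by
      intro x y hxy
      have h1 := hc.sub_le_of_contactDensity_le hT hxy hM0 fun z _ => hM z
      have h2 := hc.le_sub_of_le_contactDensity hT hxy le_rfl fun z _ => hb.nonneg z
      rw [Real.zero_rpow (by norm_num), zero_mul] at h2
      rwa [abs_of_nonneg h2, abs_sub_comm x y, abs_of_nonneg (by linarith : 0 ≤ y - x)]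
    refine ⟨M ^ (3 / 2 : ℝ), fun x _ y _ => ?_⟩
    rcases le_total x y with hxy | hxy
    · exact key x y hxy
    · rw [abs_sub_comm x y, abs_sub_comm (X (T x) - Y (T x))]
      exact key y x hxy

/-- Under `x = normalWeight t` one has `|dx| = det / (X1 - Y1)² dt` and `h = (X1 - Y1)² / det ^
(2/3)`. The coordinate-dependent factors cancel and `det ^ (1/3)` remains. -/
theorem integral_contactDensity (hc : IsDescendingArc X Y X1 Y1 X2 Y2) (hT : IsContact X1 Y1 T) :
    ∫ x in (0 : ℝ)..1, contactDensity X1 Y1 X2 Y2 T x =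
      ∫ t in (0 : ℝ)..1, |X1 t * Y2 t - Y1 t * X2 t| ^ (1 / 3 : ℝ) := by
  have hb := hc.isLipschitzBump hT
  have h01 : uIcc (0 : ℝ) 1 = Icc 0 1 := uIcc_of_le zero_le_one
  have hsub : ContinuousOn (fun t => X1 t - Y1 t) (Icc 0 1) :=
    hc.contDiff_fst.continuousOn.sub hc.contDiff_snd.continuousOn
  have key := intervalIntegral.integral_comp_mul_deriv'' (a := 0) (b := 1)
    (f := normalWeight X1 Y1) (f' := fun t => -(X1 t * Y2 t - Y1 t * X2 t) / (X1 t - Y1 t) ^ 2)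
    (g := contactDensity X1 Y1 X2 Y2 T)
    (by rw [h01]; exact hc.continuousOn_normalWeight)
    (fun t ht => by
      rw [min_eq_left zero_le_one, max_eq_right zero_le_one] at ht
      exact ((hc.hasDerivWithinAt_normalWeight (Ioo_subset_Icc_self ht)).hasDerivAt
        (Icc_mem_nhds ht.1 ht.2)).hasDerivWithinAt)
    (by
      rw [h01]
      exact hc.continuousOn_det.neg.div (hsub.pow 2) fun t ht => (pow_pos (hc.sub_pos ht) 2).ne')
    (by
      rw [h01]
      refine hb.continuousOn.mono ?_
      rintro _ ⟨t, ht, rfl⟩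
      exact hc.normalWeight_mem_Icc ht)
  rw [hb.integral_eq, intervalIntegral.integral_symm, ← key, ← intervalIntegral.integral_neg]
  refine intervalIntegral.integral_congr fun t ht => ?_
  rw [h01] at ht
  have hu := hc.sub_pos ht
  have hd := hc.det_pos ht
  simp only [Function.comp_apply]
  rw [hc.contactDensity_normalWeight hT ht, abs_of_pos hd, normalDensity,
    Real.div_rpow (by positivity) hd.le, ← Real.rpow_natCast (X1 t - Y1 t) 3, ← Real.rpow_mul hu.le]
  have e : X1 t * Y2 t - Y1 t * X2 t = (X1 t * Y2 t - Y1 t * X2 t) ^ (1 / 3 : ℝ) *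
      (X1 t * Y2 t - Y1 t * X2 t) ^ (2 / 3 : ℝ) := by
    rw [← Real.rpow_add hd]; norm_num
  have hp := Real.rpow_pos_of_pos hd (2 / 3)
  rw [show ((3 : ℕ) : ℝ) * (2 / 3) = (2 : ℕ) by norm_num, Real.rpow_natCast]
  generalize (X1 t * Y2 t - Y1 t * X2 t) ^ (2 / 3 : ℝ) = P at *
  generalize (X1 t * Y2 t - Y1 t * X2 t) ^ (1 / 3 : ℝ) = Q at *
  rw [e]
  field_simp

/-- The support function of the arc governs the defects: between two weights, the weighted defect
of the minimum is controlled by the bounds for the density. -/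
theorem weighted_defect_mem (hc : IsDescendingArc X Y X1 Y1 X2 Y2) (hT : IsContact X1 Y1 T)
    {p p' m M : ℝ} (hp : 0 ≤ p) (hp' : p' ≤ 1) (hm : 0 ≤ m) (hM : 0 ≤ M)
    (hbd : ∀ x ∈ Icc p p', m ≤ contactDensity X1 Y1 X2 Y2 T x ∧ contactDensity X1 Y1 X2 Y2 T x ≤ M)
    {B D x y : ℝ} (hB : 0 < B) (hD : 0 < D) (hx : x ∈ Icc p p') (hy : y ∈ Icc p p')
    {η : ℝ → ℝ} (hη : η = fun x => x * X (T x) + (1 - x) * Y (T x)) :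
    (B + D) * η ((B * x + D * y) / (B + D)) - B * η x - D * η y ∈
      Icc (m ^ (3 / 2 : ℝ) / 2 * (B * D / (B + D) * (x - y) ^ 2))
        (M ^ (3 / 2 : ℝ) / 2 * (B * D / (B + D) * (x - y) ^ 2)) := by
  subst hη
  have he := hc.isEnvelope hT
  refine ⟨(he.concaveOn_add_sq hp hp' fun z hz w hw hzw => ?_).le_weighted_defect hB hD hx hy,
    (he.convexOn_add_sq hp hp' fun z hz w hw hzw => ?_).weighted_defect_le hB hD hx hy⟩
  · exact hc.le_sub_of_le_contactDensity hT hzw hm fun v hv =>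
      (hbd v ⟨hz.1.trans hv.1, hv.2.trans hw.2⟩).1
  · exact hc.sub_le_of_contactDensity_le hT hzw hM fun v hv =>
      (hbd v ⟨hz.1.trans hv.1, hv.2.trans hw.2⟩).2

end IsDescendingArc


/-! ### Reduction of a curved arc to a descending arc -/

theorem one_sub_mem_Icc {t : ℝ} (ht : t ∈ Icc (0 : ℝ) 1) : 1 - t ∈ Icc (0 : ℝ) 1 :=
  ⟨by linarith [ht.2], by linarith [ht.1]⟩

theorem HasDerivWithinAt.comp_one_sub {f : ℝ → ℝ} {f' t : ℝ}
    (hf : HasDerivWithinAt f f' (Icc 0 1) (1 - t)) :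
    HasDerivWithinAt (fun t => f (1 - t)) (-f') (Icc 0 1) t := by
  have h1 : HasDerivWithinAt (fun t : ℝ => 1 - t) (-1) (Icc 0 1) t :=
    (hasDerivWithinAt_id _ _).const_sub 1
  have := HasDerivWithinAt.comp t hf h1 fun r hr => one_sub_mem_Icc hr
  rwa [mul_neg_one] at this

theorem ContDiffOn.comp_one_sub {f : ℝ → ℝ} (hf : ContDiffOn ℝ 1 f (Icc 0 1)) :
    ContDiffOn ℝ 1 (fun t => f (1 - t)) (Icc 0 1) :=
  hf.comp (contDiffOn_const.sub contDiffOn_id) fun _ hr => one_sub_mem_Icc hr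

namespace IsInflectionFree

variable {X Y X1 Y1 X2 Y2 : ℝ → ℝ}

/-- Needed because the given parametrization may run along the graph from right to left. -/
theorem reverse (ha : IsInflectionFree X Y X1 Y1 X2 Y2) :
    IsInflectionFree (fun t => X (1 - t)) (fun t => Y (1 - t)) (fun t => -X1 (1 - t))
      (fun t => -Y1 (1 - t)) (fun t => X2 (1 - t)) (fun t => Y2 (1 - t)) where
  hasDeriv_fst t ht := (ha.hasDeriv_fst _ (one_sub_mem_Icc ht)).comp_one_sub
  hasDeriv_snd t ht := (ha.hasDeriv_snd _ (one_sub_mem_Icc ht)).comp_one_sub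
  hasDeriv_fst' t ht := by
    have := (ha.hasDeriv_fst' _ (one_sub_mem_Icc ht)).comp_one_sub.neg
    rwa [neg_neg] at this
  hasDeriv_snd' t ht := by
    have := (ha.hasDeriv_snd' _ (one_sub_mem_Icc ht)).comp_one_sub.neg
    rwa [neg_neg] at this
  contDiff_fst := ha.contDiff_fst.comp_one_sub.neg
  contDiff_snd := ha.contDiff_snd.comp_one_sub.neg
  contDiff_fst' := ha.contDiff_fst'.comp_one_sub
  contDiff_snd' := ha.contDiff_snd'.comp_one_sub
  det_ne_zero t ht h := ha.det_ne_zero _ (one_sub_mem_Icc ht) (by linarith)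

/-- Convexity bounds `g` on `[x, r]` by the larger of `g x` and `g r = 0`, so a nonnegative `g`
descends. The chord condition is convexity between the two ends. -/
theorem isDescendingArc_of_graph (ha : IsInflectionFree X Y X1 Y1 X2 Y2)
    (hX : StrictMonoOn X (Icc 0 1)) {g : ℝ → ℝ} {r : ℝ} (hr : 0 < r)
    (hg : ConvexOn ℝ (Icc 0 r) g) (hg0 : ∀ x ∈ Icc 0 r, 0 ≤ g x) (hgr : g r = 0)
    (hY : ∀ t ∈ Icc (0 : ℝ) 1, Y t = g (X t)) (himg : X '' Icc 0 1 = Icc 0 r) :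
    IsDescendingArc X Y X1 Y1 X2 Y2 := by
  have hmem : ∀ t ∈ Icc (0 : ℝ) 1, X t ∈ Icc 0 r := fun t ht => himg ▸ mem_image_of_mem X ht
  have h0 : X 0 = 0 := by
    obtain ⟨t, ht, he⟩ : (0 : ℝ) ∈ X '' Icc 0 1 := himg ▸ left_mem_Icc.mpr hr.le
    exact le_antisymm ((hX.monotoneOn (by simp) ht ht.1).trans_eq he) (hmem 0 (by simp)).1
  have h1 : X 1 = r := by
    obtain ⟨t, ht, he⟩ : r ∈ X '' Icc 0 1 := himg ▸ right_mem_Icc.mpr hr.le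
    exact le_antisymm (hmem 1 (by simp)).2 (he.symm.trans_le (hX.monotoneOn ht (by simp) ht.2))
  refine ⟨ha, hX.monotoneOn, fun t ht s hs hts => ?_, fun t ht => ?_⟩
  · rw [hY t ht, hY s hs]
    have hle := hg.le_max_of_mem_Icc (hmem t ht) (right_mem_Icc.mpr hr.le)
      ⟨hX.monotoneOn ht hs hts, (hmem s hs).2⟩
    rwa [hgr, max_eq_left (hg0 _ (hmem t ht))] at hle
  · have hm := hmem t ht
    have hθ : X t / r ∈ Icc (0 : ℝ) 1 := ⟨div_nonneg hm.1 hr.le, (div_le_one hr).mpr hm.2⟩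
    refine ⟨X t / r, hθ, by rw [h0, h1]; field_simp; ring, ?_⟩
    have := hg.2 (left_mem_Icc.mpr hr.le) (right_mem_Icc.mpr hr.le)
      (sub_nonneg.mpr hθ.2) hθ.1 (by ring)
    simp only [smul_eq_mul, mul_zero, zero_add, div_mul_cancel₀ _ hr.ne'] at this
    rwa [hY t ht, hY 0 (by simp), hY 1 (by simp), h0, h1]

end IsInflectionFree

theorem planeDet_ne_zero_of_curvature_ne_zero {Γ : ℝ → Plane} {t : ℝ} (h : curvature Γ t ≠ 0) :
    planeDet (velocity Γ t) (acceleration Γ t) ≠ 0 := by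
  intro h0
  apply h
  rw [curvature, h0, abs_zero, zero_div]

theorem HasDerivWithinAt.plane_apply {f : ℝ → Plane} {f' : Plane} {s : Set ℝ} {t : ℝ}
    (h : HasDerivWithinAt f f' s t) (i : Fin 2) :
    HasDerivWithinAt (fun t => f t i) (f' i) s t := by
  exact (EuclideanSpace.proj (𝕜 := ℝ) i).hasFDerivAt.comp_hasDerivWithinAt t h

namespace IsCurvedArc

variable {Γ : ℝ → Plane}

theorem hasDerivWithinAt_velocity (hΓ : IsCurvedArc Γ) {t : ℝ} (ht : t ∈ Icc (0 : ℝ) 1) :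
    HasDerivWithinAt Γ (velocity Γ t) (Icc 0 1) t :=
  (hΓ.contDiffOn.differentiableOn (by norm_num) t ht).hasDerivWithinAt

theorem contDiffOn_velocity (hΓ : IsCurvedArc Γ) : ContDiffOn ℝ 2 (velocity Γ) (Icc 0 1) :=
  hΓ.contDiffOn.derivWithin (uniqueDiffOn_Icc zero_lt_one) (by norm_num)

theorem acceleration_eq (Γ : ℝ → Plane) :
    acceleration Γ = derivWithin (velocity Γ) (Icc 0 1) := by
  funext t
  show iteratedDerivWithin (1 + 1) Γ (Icc 0 1) t = _
  rw [iteratedDerivWithin_succ, iteratedDerivWithin_one]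
  rfl

theorem hasDerivWithinAt_acceleration (hΓ : IsCurvedArc Γ) {t : ℝ} (ht : t ∈ Icc (0 : ℝ) 1) :
    HasDerivWithinAt (velocity Γ) (acceleration Γ t) (Icc 0 1) t := by
  rw [acceleration_eq]
  exact (hΓ.contDiffOn_velocity.differentiableOn (by norm_num) t ht).hasDerivWithinAt

theorem contDiffOn_acceleration (hΓ : IsCurvedArc Γ) :
    ContDiffOn ℝ 1 (acceleration Γ) (Icc 0 1) := by
  rw [acceleration_eq]
  exact hΓ.contDiffOn_velocity.derivWithin (uniqueDiffOn_Icc zero_lt_one) (by norm_num)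

end IsCurvedArc

theorem SpecialLinearGroup.cast_det_fin_two (A : Matrix.SpecialLinearGroup (Fin 2) ℤ) :
    (A.1 0 0 : ℝ) * A.1 1 1 - A.1 0 1 * A.1 1 0 = 1 := by
  have := A.2
  rw [Matrix.det_fin_two] at this
  exact_mod_cast this

theorem injective_latticeChart (A : Matrix.SpecialLinearGroup (Fin 2) ℤ) (τ : Plane) :
    Function.Injective (latticeChart A τ) := by
  intro p q h
  have hdet := SpecialLinearGroup.cast_det_fin_two A
  have h0 : latticeChart A τ p 0 = latticeChart A τ q 0 := by rw [h]
  have h1 : latticeChart A τ p 1 = latticeChart A τ q 1 := by rw [h]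
  simp only [latticeChart, PiLp.toLp_apply, Matrix.cons_val_zero, Matrix.cons_val_one] at h0 h1
  ext i
  fin_cases i
  · show p 0 = q 0
    linear_combination (A.1 1 1 : ℝ) * h0 - (A.1 0 1 : ℝ) * h1 - (p 0 - q 0) * hdet
  · show p 1 = q 1
    linear_combination (A.1 0 0 : ℝ) * h1 - (A.1 1 0 : ℝ) * h0 - (p 1 - q 1) * hdet

theorem IsCurvedArc.isInflectionFree {Γ : ℝ → Plane} (hΓ : IsCurvedArc Γ)
    (A : Matrix.SpecialLinearGroup (Fin 2) ℤ) (τ : Plane) :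
    IsInflectionFree (fun t => latticeChart A τ (Γ t) 0) (fun t => latticeChart A τ (Γ t) 1)
      (fun t => A.1 0 0 * velocity Γ t 0 + A.1 0 1 * velocity Γ t 1)
      (fun t => A.1 1 0 * velocity Γ t 0 + A.1 1 1 * velocity Γ t 1)
      (fun t => A.1 0 0 * acceleration Γ t 0 + A.1 0 1 * acceleration Γ t 1)
      (fun t => A.1 1 0 * acceleration Γ t 0 + A.1 1 1 * acceleration Γ t 1) := by
  have hv := contDiffOn_euclidean.mp (hΓ.contDiffOn_velocity.of_le one_le_two)
  have ha := contDiffOn_euclidean.mp hΓ.contDiffOn_acceleration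
  have hcd : ∀ (u : ℝ → Plane), (∀ i, ContDiffOn ℝ 1 (fun t => u t i) (Icc 0 1)) → ∀ a b : ℝ,
      ContDiffOn ℝ 1 (fun t => a * u t 0 + b * u t 1) (Icc 0 1) := fun u hu a b =>
    (contDiffOn_const.mul (hu 0)).add (contDiffOn_const.mul (hu 1))
  have hder : ∀ (u : ℝ → Plane) (u' : Plane) (t : ℝ), HasDerivWithinAt u u' (Icc 0 1) t →
      ∀ a b : ℝ, HasDerivWithinAt (fun t => a * u t 0 + b * u t 1) (a * u' 0 + b * u' 1)
        (Icc 0 1) t := fun u u' t hu a b =>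
    ((hu.plane_apply 0).const_mul a).add ((hu.plane_apply 1).const_mul b)
  refine ⟨fun t ht => ?_, fun t ht => ?_,
    fun t ht => hder _ _ t (hΓ.hasDerivWithinAt_acceleration ht) _ _,
    fun t ht => hder _ _ t (hΓ.hasDerivWithinAt_acceleration ht) _ _,
    hcd _ hv _ _, hcd _ hv _ _, hcd _ ha _ _, hcd _ ha _ _, fun t ht h => ?_⟩
  · exact (hder _ _ t (hΓ.hasDerivWithinAt_velocity ht) _ _).add_const (τ 0)
  · exact (hder _ _ t (hΓ.hasDerivWithinAt_velocity ht) _ _).add_const (τ 1)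
  · apply planeDet_ne_zero_of_curvature_ne_zero (hΓ.curved t ht)
    rw [planeDet]
    linear_combination h - (velocity Γ t 0 * acceleration Γ t 1 -
      velocity Γ t 1 * acceleration Γ t 0) * SpecialLinearGroup.cast_det_fin_two A

/-- A chart with determinant one preserves the determinant of velocity and acceleration, hence
equiaffine length, and reversing the parameter changes only its sign. -/
theorem exists_isDescendingArc {Γ : ℝ → Plane} (hΓ : IsCurvedArc Γ)
    (A : Matrix.SpecialLinearGroup (Fin 2) ℤ) (τ : Plane) {S : Set Plane}
    (hS : S = latticeChart A τ '' (Γ '' Icc 0 1)) (hconv : IsConvexCornerGraph S) :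
    ∃ X Y X1 Y1 X2 Y2 : ℝ → ℝ, IsDescendingArc X Y X1 Y1 X2 Y2 ∧
      S = (fun t => (!₂[X t, Y t] : Plane)) '' Icc 0 1 ∧
      ∫ t in (0 : ℝ)..1, |X1 t * Y2 t - Y1 t * X2 t| ^ (1 / 3 : ℝ) = equiaffineLength Γ := by
  have hI := hΓ.isInflectionFree A τ
  have hdet : ∀ t, (A.1 0 0 * velocity Γ t 0 + A.1 0 1 * velocity Γ t 1) *
      (A.1 1 0 * acceleration Γ t 0 + A.1 1 1 * acceleration Γ t 1) -
      (A.1 1 0 * velocity Γ t 0 + A.1 1 1 * velocity Γ t 1) *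
      (A.1 0 0 * acceleration Γ t 0 + A.1 0 1 * acceleration Γ t 1) =
      planeDet (velocity Γ t) (acceleration Γ t) := fun t => by
    rw [planeDet]
    linear_combination (velocity Γ t 0 * acceleration Γ t 1 -
      velocity Γ t 1 * acceleration Γ t 0) * SpecialLinearGroup.cast_det_fin_two A
  obtain ⟨r, u, g, hr, hu, hg, hmaps, hg0, hgr, hSg⟩ := hconv
  set P : ℝ → Plane := fun t => latticeChart A τ (Γ t) with hP
  have hSP : S = P '' Icc 0 1 := by rw [hS, image_image]
  have hpt : ∀ p : Plane, (!₂[p 0, p 1] : Plane) = p := by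
    intro p; ext i; fin_cases i <;> rfl
  have hon : ∀ p : Plane, p ∈ S ↔ p 0 ∈ Icc 0 r ∧ p 1 = g (p 0) := by
    intro p
    rw [hSg]
    constructor
    · rintro ⟨x, hx, rfl⟩
      exact ⟨hx, rfl⟩
    · rintro ⟨h1, h2⟩
      exact ⟨p 0, h1, by simp only [← h2]; exact hpt p⟩
  have hPS : ∀ t ∈ Icc (0 : ℝ) 1, P t 0 ∈ Icc 0 r ∧ P t 1 = g (P t 0) := fun t ht =>
    (hon _).mp (hSP ▸ mem_image_of_mem P ht)
  have himg : (fun t => P t 0) '' Icc 0 1 = Icc 0 r := by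
    apply Subset.antisymm
    · rintro _ ⟨t, ht, rfl⟩
      exact (hPS t ht).1
    · intro x hx
      have : (!₂[x, g x] : Plane) ∈ P '' Icc 0 1 := hSP ▸ (hon _).mpr ⟨hx, rfl⟩
      obtain ⟨t, ht, he⟩ := this
      exact ⟨t, ht, by simp only [he]; rfl⟩
  have hinj : InjOn (fun t => P t 0) (Icc 0 1) := by
    intro t ht s hs he
    simp only at he
    have h1 : P t = P s := by
      rw [← hpt (P t), ← hpt (P s), (hPS t ht).2, (hPS s hs).2, he]
    exact hΓ.injOn ht hs (injective_latticeChart A τ h1)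
  have hcont : ContinuousOn (fun t => P t 0) (Icc 0 1) := fun t ht =>
    (hI.hasDeriv_fst t ht).continuousWithinAt
  have hg0' : ∀ x ∈ Icc 0 r, 0 ≤ g x := fun x hx => (hmaps hx).1
  -- On a graph the first coordinate determines the point, so along an injective arc it is injective
  -- and continuous, hence strictly monotone. The decreasing case is reversed.
  rcases hcont.strictMonoOn_of_injOn_Icc' zero_le_one hinj with hmono | hanti
  · refine ⟨_, _, _, _, _, _, hI.isDescendingArc_of_graph hmono hr hg hg0' hgr
      (fun t ht => (hPS t ht).2) himg, ?_, ?_⟩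
    · rw [hSP]
      exact image_congr fun t _ => (hpt _).symm
    · rw [equiaffineLength]
      exact intervalIntegral.integral_congr fun t _ => by simp only [hdet]
  · have hrev : (fun t : ℝ => 1 - t) '' Icc 0 1 = Icc 0 1 := by
      rw [Set.image_const_sub_Icc]; norm_num
    have hmono : StrictMonoOn (fun t => P (1 - t) 0) (Icc 0 1) := fun t ht s hs hts =>
      hanti (one_sub_mem_Icc hs) (one_sub_mem_Icc ht) (by linarith)
    refine ⟨_, _, _, _, _, _, hI.reverse.isDescendingArc_of_graph hmono hr hg hg0' hgr
      (fun t ht => (hPS _ (one_sub_mem_Icc ht)).2) ?_, ?_, ?_⟩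
    · rw [← himg]
      conv_rhs => rw [← hrev, image_image]
    · rw [hSP]
      conv_lhs => rw [← hrev, image_image]
      exact image_congr fun t _ => (hpt _).symm
    · have := intervalIntegral.integral_comp_sub_left (a := 0) (b := 1)
        (fun t => |planeDet (velocity Γ t) (acceleration Γ t)| ^ (1 / 3 : ℝ)) 1
      rw [sub_self, sub_zero] at this
      rw [equiaffineLength, ← this]
      exact intervalIntegral.integral_congr fun t _ => by
        simp only [neg_mul, ← hdet]
        rw [← abs_neg]
        ring_nf

/-- This ensures that the pole is not cancelled. -/
theorem IsCurvedArc.equiaffineLength_pos {Γ : ℝ → Plane} (hΓ : IsCurvedArc Γ) :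
    0 < equiaffineLength Γ := by
  have hv := contDiffOn_euclidean.mp hΓ.contDiffOn_velocity
  have ha := contDiffOn_euclidean.mp hΓ.contDiffOn_acceleration
  have hc : ContinuousOn (fun t => planeDet (velocity Γ t) (acceleration Γ t)) (Icc 0 1) :=
    ((hv 0).continuousOn.mul (ha 1).continuousOn).sub ((hv 1).continuousOn.mul (ha 0).continuousOn)
  refine intervalIntegral.intervalIntegral_pos_of_pos_on (ContinuousOn.intervalIntegrable ?_)
    (fun t ht => ?_) zero_lt_one
  · rw [uIcc_of_le zero_le_one]
    exact hc.abs.rpow_const fun t _ => Or.inr (by norm_num)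
  · exact Real.rpow_pos_of_pos (abs_pos.mpr (planeDet_ne_zero_of_curvature_ne_zero
      (hΓ.curved t (Ioo_subset_Icc_self ht)))) _


/-! ### Combining the two orders of the heights -/

namespace UnimodularQuad

/-- Exchange of the two vectors and of the two coordinate axes. -/
def swap (q : UnimodularQuad) : UnimodularQuad :=
  ⟨(q.1.2.2.2, q.1.2.2.1, q.1.2.1, q.1.1), by have := q.2; push_cast at this ⊢; linarith⟩

theorem swap_swap (q : UnimodularQuad) : q.swap.swap = q := rfl

theorem fstHeight_swap (q : UnimodularQuad) : q.swap.fstHeight = q.sndHeight := Nat.add_comm _ _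

theorem sndHeight_swap (q : UnimodularQuad) : q.swap.sndHeight = q.fstHeight := Nat.add_comm _ _

theorem volume_swap (q : UnimodularQuad) : q.swap.volume = q.volume := by
  unfold volume
  rw [fstHeight_swap, sndHeight_swap]
  ring

/-- Equal heights divide `1` by `a D = B c + 1`, which leaves only the standard basis. -/
theorem subsingleton_fstHeight_eq_sndHeight :
    {q : UnimodularQuad | q.fstHeight = q.sndHeight}.Subsingleton := by
  have key : ∀ q : UnimodularQuad, q.fstHeight = q.sndHeight → q.1.1 = 1 ∧ q.fstHeight = 1 := by
    intro q hq
    have h1 := q.fst_mul_sndHeight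
    rw [← hq, mul_comm] at h1
    have hB : q.fstHeight = 1 := by
      have h2 : q.fstHeight ∣ 1 := by
        rw [← Nat.dvd_add_right (Dvd.intro q.1.2.2.1 rfl), ← h1]
        exact Dvd.intro _ rfl
      exact Nat.dvd_one.mp h2
    have h3 := q.fst_le_fstHeight
    rw [hB] at h1 h3
    exact ⟨by omega, hB⟩
  intro q hq q' hq'
  obtain ⟨h1, h2⟩ := key q hq
  obtain ⟨h1', h2'⟩ := key q' hq'
  have hq : q.fstHeight = q.sndHeight := hq
  have hq' : q'.fstHeight = q'.sndHeight := hq'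
  exact ext_of_heights (by omega) (by omega) (by omega)

theorem setOf_le_eq (δ : UnimodularQuad → ℝ) (t : ℝ) :
    {q | t ≤ δ q} = (ascending δ t ∪ swap '' ascending (δ ∘ swap) t) ∪
      {q | q.fstHeight = q.sndHeight ∧ t ≤ δ q} := by
  ext q
  constructor
  · intro hq
    rcases lt_trichotomy q.fstHeight q.sndHeight with h | h | h
    · exact Or.inl (Or.inl ⟨h, hq⟩)
    · exact Or.inr ⟨h, hq⟩
    · refine Or.inl (Or.inr ⟨q.swap, ⟨?_, hq⟩, q.swap_swap⟩)
      rwa [fstHeight_swap, sndHeight_swap]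
  · rintro ((h | ⟨p, h, rfl⟩) | h)
    · exact h.2
    · exact h.2
    · exact h.2

theorem finite_setOf_le {δ : UnimodularQuad → ℝ} {t : ℝ} (h1 : (ascending δ t).Finite)
    (h2 : (ascending (δ ∘ swap) t).Finite) : {q | t ≤ δ q}.Finite := by
  rw [setOf_le_eq]
  exact (h1.union (h2.image _)).union
    (subsingleton_fstHeight_eq_sndHeight.finite.subset fun q hq => hq.1)

theorem abs_upperCount_sub_le {δ : UnimodularQuad → ℝ} {t : ℝ} (h1 : (ascending δ t).Finite)
    (h2 : (ascending (δ ∘ swap) t).Finite) :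
    |upperCount δ t - ((ascending δ t).ncard + (ascending (δ ∘ swap) t).ncard)| ≤ 1 := by
  have hE : {q : UnimodularQuad | q.fstHeight = q.sndHeight ∧ t ≤ δ q}.Subsingleton :=
    subsingleton_fstHeight_eq_sndHeight.anti fun q hq => hq.1
  have hd1 : Disjoint (ascending δ t) (swap '' ascending (δ ∘ swap) t) := by
    rw [Set.disjoint_left]
    rintro _ hq ⟨p, hp, rfl⟩
    have e1 := hq.1
    have e2 := hp.1
    rw [fstHeight_swap, sndHeight_swap] at e1
    omega
  have hd2 : Disjoint (ascending δ t ∪ swap '' ascending (δ ∘ swap) t)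
      {q | q.fstHeight = q.sndHeight ∧ t ≤ δ q} := by
    rw [Set.disjoint_left]
    rintro _ (hq | ⟨p, hp, rfl⟩) ⟨h, _⟩
    · have := hq.1; omega
    · have := hp.1
      rw [fstHeight_swap, sndHeight_swap] at h
      omega
  have hinj : Function.Injective swap := fun p q h => by
    rw [← p.swap_swap, h, q.swap_swap]
  have hc : {q | t ≤ δ q}.ncard = (ascending δ t).ncard + (ascending (δ ∘ swap) t).ncard +
      {q | q.fstHeight = q.sndHeight ∧ t ≤ δ q}.ncard := by
    rw [setOf_le_eq, Set.ncard_union_eq hd2 (h1.union (h2.image _)) hE.finite,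
      Set.ncard_union_eq hd1 h1 (h2.image _), Set.ncard_image_of_injective _ hinj]
  have hE1 : {q | q.fstHeight = q.sndHeight ∧ t ≤ δ q}.ncard ≤ 1 :=
    (Set.ncard_le_one hE.finite).mpr fun _ ha _ hb => hE ha hb
  have hE1' : (({q | q.fstHeight = q.sndHeight ∧ t ≤ δ q}.ncard : ℕ) : ℝ) ≤ 1 := by
    exact_mod_cast hE1
  rw [upperCount, hc]
  push_cast
  rw [add_sub_cancel_left, abs_of_nonneg (by positivity)]
  exact hE1'

/-- The number of unimodular pairs of large defect, for a defect governed in both orders of the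
heights. -/
theorem exists_abs_upperCount_sub_le {h : ℝ → ℝ} {α β : ℝ} (hh : IsLipschitzBump h α β)
    {δ : UnimodularQuad → ℝ} (h1 : IsGoverned h δ)
    (h2 : IsGoverned (fun x => h (1 - x)) (δ ∘ swap)) :
    (∀ t > 0, {q | t ≤ δ q}.Finite) ∧ ∃ K : ℝ, ∀ t ∈ Ioc (0 : ℝ) 1,
      |upperCount δ t - 2 * (3 / Real.pi ^ 2 * pronicIntegral) * 2 ^ (-(2 / 3) : ℝ) *
        (∫ x in (0 : ℝ)..1, h x) * t ^ (-(2 / 3) : ℝ)| ≤ K * t ^ (-(2 / 3) + 1 / 30 : ℝ) := by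
  have hr := hh.reflect
  have hf1 : ∀ t > 0, (ascending δ t).Finite := fun t ht =>
    finite_ascending hh.hasBoundedOscillation h1 ht
  have hf2 : ∀ t > 0, (ascending (δ ∘ swap) t).Finite := fun t ht =>
    finite_ascending hr.hasBoundedOscillation h2 ht
  refine ⟨fun t ht => finite_setOf_le (hf1 t ht) (hf2 t ht), ?_⟩
  obtain ⟨K₁, hK₁⟩ := exists_abs_ncard_ascending_sub_le hh.hasBoundedOscillation
    hh.integrable.intervalIntegrable h1
  obtain ⟨K₂, hK₂⟩ := exists_abs_ncard_ascending_sub_le hr.hasBoundedOscillation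
    hr.integrable.intervalIntegrable h2
  have hint : ∫ x in (0 : ℝ)..1, h (1 - x) = ∫ x in (0 : ℝ)..1, h x := by
    have := intervalIntegral.integral_comp_sub_left (a := 0) (b := 1) h 1
    rwa [sub_self, sub_zero] at this
  -- The last summand pays for the single pair of equal heights, as the error term is at least `1`
  -- for `t ≤ 1`.
  refine ⟨K₁ + K₂ + 1, fun t ht => ?_⟩
  have e1 := hK₁ t ht
  have e2 := hK₂ t ht
  rw [hint] at e2
  rw [Real.mul_rpow zero_le_two ht.1.le] at e1 e2
  have e3 := abs_upperCount_sub_le (hf1 t ht.1) (hf2 t ht.1)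
  have e4 : 1 ≤ t ^ (-(2 / 3) + 1 / 30 : ℝ) :=
    Real.one_le_rpow_of_pos_of_le_one_of_nonpos ht.1 ht.2 (by norm_num)
  rw [abs_le] at e1 e2 e3 ⊢
  constructor <;> nlinarith [e1.1, e1.2, e2.1, e2.2, e3.1, e3.2]

end UnimodularQuad

/-! ### Support defects of a descending arc -/

namespace IsDescendingArc

variable {X Y X1 Y1 X2 Y2 T : ℝ → ℝ} {S : Set Plane}

theorem supportNumber_eq (hc : IsDescendingArc X Y X1 Y1 X2 Y2) (hT : IsContact X1 Y1 T)
    (hS : S = (fun t => (!₂[X t, Y t] : Plane)) '' Icc 0 1) {a b : ℕ} (hab : 0 < a + b) :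
    supportNumber S a b = ((a + b : ℕ) : ℝ) *
      ((a / ((a + b : ℕ) : ℝ)) * X (T (a / ((a + b : ℕ) : ℝ))) +
        (1 - a / ((a + b : ℕ) : ℝ)) * Y (T (a / ((a + b : ℕ) : ℝ)))) := by
  have hpos : (0 : ℝ) < ((a + b : ℕ) : ℝ) := by exact_mod_cast hab
  set x : ℝ := a / ((a + b : ℕ) : ℝ) with hx
  have e : ∀ t, (a : ℝ) * X t + b * Y t = ((a + b : ℕ) : ℝ) * (x * X t + (1 - x) * Y t) := by
    intro t
    rw [hx]
    field_simp
    push_cast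
    ring
  have hl := hc.isLeast_contact hT x
  have hmem := (hT x).1
  have : IsLeast ((fun p : Plane => (a : ℝ) * p 0 + (b : ℝ) * p 1) '' S)
      (((a + b : ℕ) : ℝ) * (x * X (T x) + (1 - x) * Y (T x))) := by
    rw [hS, image_image]
    constructor
    · exact ⟨T x, hmem, e _⟩
    · rintro _ ⟨t, ht, rfl⟩
      refine le_of_le_of_eq ?_ (e t).symm
      exact mul_le_mul_of_nonneg_left (hl.2 ⟨t, ht, rfl⟩) hpos.le
  exact this.csInf_eq

/-- Homogeneity writes the defect as a Jensen gap at the slopes `a / B` and `c / D`, with the sum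
vector giving their weighted mean. As the slopes differ by `1 / (B D)`, the variance factor is
exactly the inverse of the volume. -/
theorem supportDefect_mem (hc : IsDescendingArc X Y X1 Y1 X2 Y2) (hT : IsContact X1 Y1 T)
    (hS : S = (fun t => (!₂[X t, Y t] : Plane)) '' Icc 0 1) (q : UnimodularQuad) {m M : ℝ}
    (hm : 0 ≤ m) (hM : 0 ≤ M)
    (hbd : ∀ x ∈ Icc ((q.1.2.2.1 : ℝ) / q.sndHeight) ((q.1.1 : ℝ) / q.fstHeight),
      m ≤ contactDensity X1 Y1 X2 Y2 T x ∧ contactDensity X1 Y1 X2 Y2 T x ≤ M) :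
    m ^ (3 / 2 : ℝ) / (2 * q.volume) ≤ supportDefect S q ∧
      supportDefect S q ≤ M ^ (3 / 2 : ℝ) / (2 * q.volume) := by
  have hB : (0 : ℝ) < q.fstHeight := by exact_mod_cast q.fstHeight_pos
  have hD : (0 : ℝ) < q.sndHeight := by exact_mod_cast q.sndHeight_pos
  have hdiff := q.div_sub_div_heights
  have hle : (q.1.2.2.1 : ℝ) / q.sndHeight ≤ (q.1.1 : ℝ) / q.fstHeight := by
    rw [← sub_nonneg, hdiff]; positivity
  have hsub := q.Icc_slopes_subset
  set η : ℝ → ℝ := fun x => x * X (T x) + (1 - x) * Y (T x) with hη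
  have key := hc.weighted_defect_mem hT (hsub (left_mem_Icc.mpr hle)).1
    (hsub (right_mem_Icc.mpr hle)).2 hm hM hbd hB hD (right_mem_Icc.mpr hle)
    (left_mem_Icc.mpr hle) hη
  have hvol : (q.fstHeight : ℝ) * q.sndHeight / (q.fstHeight + q.sndHeight) *
      ((q.1.1 : ℝ) / q.fstHeight - (q.1.2.2.1 : ℝ) / q.sndHeight) ^ 2 = 1 / q.volume := by
    rw [hdiff, UnimodularQuad.volume]
    field_simp
  rw [hvol] at key
  have hdef : supportDefect S q = |q.fstHeight * η ((q.1.1 : ℝ) / q.fstHeight) +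
      q.sndHeight * η ((q.1.2.2.1 : ℝ) / q.sndHeight) - (q.fstHeight + q.sndHeight) *
        η ((q.fstHeight * ((q.1.1 : ℝ) / q.fstHeight) +
          q.sndHeight * ((q.1.2.2.1 : ℝ) / q.sndHeight)) / (q.fstHeight + q.sndHeight))| := by
    rw [mul_div_cancel₀ _ hB.ne', mul_div_cancel₀ _ hD.ne']
    have hs : 0 < (q.1.1 + q.1.2.2.1) + (q.1.2.1 + q.1.2.2.2) := by
      have := q.fstHeight_pos
      unfold UnimodularQuad.fstHeight at this
      omega
    have e3 := hc.supportNumber_eq hT hS hs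
    have e : (((q.1.1 + q.1.2.2.1) + (q.1.2.1 + q.1.2.2.2) : ℕ) : ℝ) =
        q.fstHeight + q.sndHeight := by
      unfold UnimodularQuad.fstHeight UnimodularQuad.sndHeight
      push_cast; ring
    rw [e] at e3
    push_cast at e3
    have e1 := hc.supportNumber_eq hT hS q.fstHeight_pos
    have e2 := hc.supportNumber_eq hT hS q.sndHeight_pos
    show |supportNumber S q.1.1 q.1.2.1 + supportNumber S q.1.2.2.1 q.1.2.2.2 -
      supportNumber S (q.1.1 + q.1.2.2.1) (q.1.2.1 + q.1.2.2.2)| = _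
    rw [e1, e2, e3]
    rfl
  obtain ⟨k1, k2⟩ := key
  have hv := q.volume_pos
  have hn : 0 ≤ m ^ (3 / 2 : ℝ) / 2 * (1 / q.volume) := by positivity
  have e4 : ∀ z : ℝ, z / (2 * q.volume) = z / 2 * (1 / q.volume) := fun z => by field_simp
  rw [hdef, ← abs_neg, abs_of_nonneg (by linarith), e4, e4]
  constructor <;> linarith

theorem isGoverned (hc : IsDescendingArc X Y X1 Y1 X2 Y2) (hT : IsContact X1 Y1 T)
    (hS : S = (fun t => (!₂[X t, Y t] : Plane)) '' Icc 0 1) :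
    UnimodularQuad.IsGoverned (contactDensity X1 Y1 X2 Y2 T) (supportDefect S) :=
  fun q _ _ _ hm hM hbd => hc.supportDefect_mem hT hS q hm hM hbd

/-- Exchanging vectors and axes maps the slope interval by `x ↦ 1 - x` and preserves the volume. The
preceding defect bounds do not depend on the order of the heights, so they apply to the swapped
pair. -/
theorem isGoverned_swap (hc : IsDescendingArc X Y X1 Y1 X2 Y2) (hT : IsContact X1 Y1 T)
    (hS : S = (fun t => (!₂[X t, Y t] : Plane)) '' Icc 0 1) :
    UnimodularQuad.IsGoverned (fun x => contactDensity X1 Y1 X2 Y2 T (1 - x))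
      (supportDefect S ∘ UnimodularQuad.swap) := by
  intro q _ m M hm hM hbd
  have hB : (0 : ℝ) < q.fstHeight := by exact_mod_cast q.fstHeight_pos
  have hD : (0 : ℝ) < q.sndHeight := by exact_mod_cast q.sndHeight_pos
  have e1 : (q.swap.1.2.2.1 : ℝ) / q.swap.sndHeight = 1 - q.1.1 / q.fstHeight := by
    rw [q.sndHeight_swap, eq_sub_iff_add_eq, ← add_div, div_eq_one_iff_eq hB.ne', add_comm]
    exact_mod_cast rfl
  have e2 : (q.swap.1.1 : ℝ) / q.swap.fstHeight = 1 - q.1.2.2.1 / q.sndHeight := by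
    rw [q.fstHeight_swap, eq_sub_iff_add_eq, ← add_div, div_eq_one_iff_eq hD.ne', add_comm]
    exact_mod_cast rfl
  rw [← q.volume_swap]
  refine hc.supportDefect_mem hT hS q.swap hm hM fun x hx => ?_
  rw [e1, e2] at hx
  have := hbd (1 - x) ⟨by linarith [hx.2], by linarith [hx.1]⟩
  simpa only [sub_sub_cancel] using this

end IsDescendingArc

theorem supportDefect_nonneg (S : Set Plane) (q : UnimodularQuad) : 0 ≤ supportDefect S q :=
  abs_nonneg _

/-! ### The pole, its residue and the conclusion -/

/-- The behaviour at `σ` of a function `C s / (s - σ) + s G s` with `G` holomorphic. -/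
theorem simple_pole_of_add_holomorphic {C σ ε : ℝ} (hC : C ≠ 0) (hσ : 0 < σ) (hε : 0 < ε)
    {G : ℂ → ℂ} (hG : ∀ s : ℂ, σ - ε < s.re → DifferentiableAt ℂ G s) {F : ℂ → ℂ}
    (hF : F = fun s => (C : ℂ) * s / (s - σ) + s * G s) :
    MeromorphicOn F {s : ℂ | σ - ε < s.re} ∧ AnalyticOnNhd ℂ F ({s : ℂ | σ - ε < s.re} \ {(σ : ℂ)}) ∧
      meromorphicOrderAt F σ = -1 ∧
      Tendsto (fun s : ℂ => (s - σ) * F s) (𝓝[≠] (σ : ℂ)) (𝓝 ((σ * C : ℝ) : ℂ)) := by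
  have hopen : IsOpen {s : ℂ | σ - ε < s.re} := isOpen_lt continuous_const Complex.continuous_re
  have hGa : AnalyticOnNhd ℂ G {s : ℂ | σ - ε < s.re} :=
    DifferentiableOn.analyticOnNhd (fun s hs => (hG s hs).differentiableWithinAt) hopen
  have hσm : (σ : ℂ) ∈ {s : ℂ | σ - ε < s.re} := by
    show σ - ε < (σ : ℂ).re
    rw [Complex.ofReal_re]; linarith
  have hnum : ∀ s ∈ {s : ℂ | σ - ε < s.re}, AnalyticAt ℂ (fun s => (C : ℂ) * s + (s - σ) * (s * G s)) s :=
    fun s hs => (analyticAt_const.mul analyticAt_id).add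
      ((analyticAt_id.sub analyticAt_const).mul (analyticAt_id.mul (hGa s hs)))
  -- Away from `σ` the function is `(s - σ)⁻¹` times an analytic function whose value at `σ` is `C
  -- σ`, nonzero. Order and residue are read off from this.
  have heq : ∀ s : ℂ, s ≠ σ → F s = (s - σ)⁻¹ * ((C : ℂ) * s + (s - σ) * (s * G s)) := by
    intro s hs
    have : s - σ ≠ 0 := sub_ne_zero.mpr hs
    rw [hF]
    field_simp
  have hmero : MeromorphicOn F {s : ℂ | σ - ε < s.re} := by
    intro s hs
    rw [hF]
    exact ((analyticAt_const.mul analyticAt_id).meromorphicAt.div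
      (analyticAt_id.sub analyticAt_const).meromorphicAt).add
      (analyticAt_id.mul (hGa s hs)).meromorphicAt
  refine ⟨hmero, ?_, ?_, ?_⟩
  · rintro s ⟨hs, hne⟩
    rw [hF]
    exact ((analyticAt_const.mul analyticAt_id).div (analyticAt_id.sub analyticAt_const)
      (sub_ne_zero.mpr hne)).add (analyticAt_id.mul (hGa s hs))
  · rw [show (-1 : WithTop ℤ) = ((-1 : ℤ) : WithTop ℤ) from rfl,
      meromorphicOrderAt_eq_int_iff (hmero _ hσm)]
    refine ⟨_, hnum _ hσm, ?_, ?_⟩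
    · rw [sub_self, zero_mul, add_zero]
      exact_mod_cast mul_ne_zero hC hσ.ne'
    · filter_upwards [self_mem_nhdsWithin] with s hs
      rw [heq s hs, zpow_neg_one, smul_eq_mul]
  · have h1 : Tendsto (fun s => (C : ℂ) * s + (s - σ) * (s * G s)) (𝓝[≠] (σ : ℂ))
        (𝓝 ((C : ℂ) * σ + (σ - σ) * (σ * G σ))) :=
      (hnum _ hσm).continuousAt.tendsto.mono_left nhdsWithin_le_nhds
    have e : (C : ℂ) * σ + (σ - σ) * (σ * G σ) = ((σ * C : ℝ) : ℂ) := by push_cast; ring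
    rw [e] at h1
    refine h1.congr' ?_
    filter_upwards [self_mem_nhdsWithin] with s hs
    rw [heq s hs, mul_inv_cancel_left₀ (sub_ne_zero.mpr hs)]

theorem pronicIntegral_pos : 0 < pronicIntegral := by
  rw [pronicIntegral_eq]
  have := Real.Gamma_pos_of_pos (show (0 : ℝ) < 1 / 3 by norm_num)
  have := Real.pi_pos
  positivity

/-- On the left, `2 / 3` is the location of the pole, the next factor `2` stands for the two orders
of the heights, and `2 ^ (-2/3)` comes from the factor `2` in the defect `h ^ (3/2) / (2 * volume)`.
-/
theorem residue_constant_eq (L : ℝ) :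
    2 / 3 * (2 * (3 / Real.pi ^ 2 * pronicIntegral) * 2 ^ (-(2 / 3) : ℝ) * L) =
      Real.sqrt 3 / ((4 : ℝ) ^ (1 / 3 : ℝ) * Real.pi ^ 3) * Real.Gamma (1 / 3) ^ 3 * L := by
  have h4 : (4 : ℝ) ^ (1 / 3 : ℝ) = 2 ^ (2 / 3 : ℝ) := by
    rw [show (4 : ℝ) = 2 ^ (2 : ℝ) by norm_num, ← Real.rpow_mul zero_le_two]
    norm_num
  have h2 : (0 : ℝ) < 2 ^ (2 / 3 : ℝ) := by positivity
  have := Real.pi_pos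
  rw [pronicIntegral_eq, h4, Real.rpow_neg zero_le_two]
  field_simp
  ring

theorem theorem2 (Γ : ℝ → Plane) (hΓ : IsCurvedArc Γ)
    (A : Matrix.SpecialLinearGroup (Fin 2) ℤ) (τ : Plane) (S : Set Plane)
    (hS : S = latticeChart A τ '' (Γ '' Icc 0 1)) (hconv : IsConvexCornerGraph S) :
    (∀ s : ℂ, 2 / 3 < s.re →
      Summable fun q : UnimodularQuad => (supportDefect S q : ℂ) ^ s) ∧
    ∃ (U : Set ℂ) (F : ℂ → ℂ), IsOpen U ∧ (2 / 3 : ℂ) ∈ U ∧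
      MeromorphicOn F (U ∪ {s : ℂ | 2 / 3 < s.re}) ∧
      AnalyticOnNhd ℂ F ((U ∪ {s : ℂ | 2 / 3 < s.re}) \ {2 / 3}) ∧
      (∀ s : ℂ, 2 / 3 < s.re → F s = boundaryZeta S s) ∧
      meromorphicOrderAt F (2 / 3) = -1 ∧
      Tendsto (fun s : ℂ => (s - 2 / 3) * F s) (𝓝[≠] (2 / 3))
        (𝓝 ((Real.sqrt 3 / ((4 : ℝ) ^ (1 / 3 : ℝ) * Real.pi ^ 3) * Real.Gamma (1 / 3) ^ 3 *
          equiaffineLength Γ : ℝ) : ℂ)) := by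
  obtain ⟨X, Y, X1, Y1, X2, Y2, hc, hSP, hlen⟩ := exists_isDescendingArc hΓ A τ hS hconv
  obtain ⟨T, hT⟩ := hc.exists_isContact
  obtain ⟨hfin, K, hK⟩ := UnimodularQuad.exists_abs_upperCount_sub_le (hc.isLipschitzBump hT)
    (hc.isGoverned hT hSP) (hc.isGoverned_swap hT hSP)
  rw [hc.integral_contactDensity hT, hlen] at hK
  obtain ⟨hsum, G, hG, hGeq⟩ := exists_continuation_of_upperCount (supportDefect_nonneg S) hfin
    (by norm_num) (by norm_num) hK
  set C : ℝ := 2 * (3 / Real.pi ^ 2 * pronicIntegral) * 2 ^ (-(2 / 3) : ℝ) * equiaffineLength Γ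
    with hCdef
  have hC : C ≠ 0 := by
    have h1 := pronicIntegral_pos
    have h2 := hΓ.equiaffineLength_pos
    have h3 := Real.pi_pos
    positivity
  obtain ⟨h1, h2, h3, h4⟩ := simple_pole_of_add_holomorphic hC (by norm_num) (by norm_num) hG rfl
  have hcast : ((2 / 3 : ℝ) : ℂ) = 2 / 3 := by push_cast; rfl
  have hU : {s : ℂ | (2 / 3 : ℝ) - 1 / 30 < s.re} ∪ {s : ℂ | 2 / 3 < s.re} =
      {s : ℂ | (2 / 3 : ℝ) - 1 / 30 < s.re} :=
    Set.union_eq_self_of_subset_right fun s (hs : 2 / 3 < s.re) =>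
      show (2 / 3 : ℝ) - 1 / 30 < s.re by linarith
  rw [residue_constant_eq] at h4
  rw [hcast] at h1 h2 h3 h4 hGeq
  refine ⟨hsum, {s : ℂ | (2 / 3 : ℝ) - 1 / 30 < s.re}, _,
    isOpen_lt continuous_const Complex.continuous_re, ?_,
    by rw [hU]; exact h1, by rw [hU]; exact h2, fun s hs => (hGeq s hs).symm, h3, h4⟩
  show (2 / 3 : ℝ) - 1 / 30 < (2 / 3 : ℂ).re
  rw [← hcast, Complex.ofReal_re]
  norm_num
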